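/- Let $V$ be a finite dimensional vector space over a field $K$, let $0\ne q\in K$, and let $R:V\otimes V\to V\otimes V$ be a Hecke symmetry with parameter $q$, i.e. a linear operator such that $$(R\otimes\mathrm{Id})(\mathrm{Id}\otimes R)(R\otimes\mathrm{Id})=(\mathrm{Id}\otimes R)(R\otimes\mathrm{Id})(\mathrm{Id}\otimes R),\qquad (R-q\,\mathrm{Id})(R+\mathrm{Id})=0 .$$ On $V^{\otimes m}$ put $T_i=\mathrm{Id}^{\otimes(i-1)}\otimes R\otimes\mathrm{Id}^{\otimes(m-i-1)}$ for $1\le i<m$, and let $\Upsilon^{(m)}=\bigcap_{i=1}^{m-1}(T_i-q)V^{\otimes m}$ (so $\Upsilon^{(0)}=K$, $\Upsilon^{(1)}=V$). Suppose that $\dim\Upsilon^{(n)}=1$ and $\Upsilon^{(n+1)}=0$ for some $n>0$, and fix a nonzero $t\in\Upsilon^{(n)}$. There are unique $\theta,\bar\theta,\psi\in GL(V)$ with the following properties. Writing products in the tensor algebra without the sign $\otimes$, for all $v\in V$, $$T_n\cdots T_2T_1(vt)=t\,\theta(v),\qquad T_1T_2\cdots T_n(tv)=\bar\theta(v)\,t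 .$$ The dual operator $\psi^*:V^*\to V^*$ is the restriction to degree $1$ of the Nakayama automorphism of the quadratic dual $A=\mathbb S(V,R)^!$ of $\mathbb S(V,R)=\mathbb T(V)/(\mathrm{Im}(R-q\,\mathrm{Id}))$. Here $A=\bigoplus_k A_k$ is the quotient of $\mathbb T(V^*)$ by the ideal generated by the annihilator of $\mathrm{Im}(R-q\,\mathrm{Id})$ in $V^*\otimes V^*$ under the pairing $\langle f\otimes g,v\otimes w\rangle=f(v)g(w)$, and its Nakayama automorphism is the grading-preserving algebra automorphism $\nu$ such that $ba=\nu(a)b$ for all $0\le k\le n$, $a\in A_k$, $b\in A_{n-k}$. For $1\le k\le n$ the operators $(\psi^{-1}\theta)^{\otimes k}$ and $(\psi\bar\theta)^{\otimes k}$ on $V^{\otimes k}$ map $\Upsilon^{(k)}$ into itself, and their restrictions $\xi_k$ and $\eta_k$ to $\Upsilon^{(k)}$ satisfy $$\operatorname{tr}\xi_k=\operatorname{tr}\eta_k=(-1)^{kn-k}\,q^{k(k+1)/2}\begin{bmatrix}n\\k\end{bmatrix}_q ,$$ where $\begin{bmatrix}n\\k\end{bmatrix}_q$ is the $q$-binomial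 coefficient (the value at $q$ of the Gaussian polynomial). In particular, $$\operatorname{tr}(\psi^{-1}\theta)=\operatorname{tr}(\psi\bar\theta)=(-1)^{n-1}q\,[n]_q,\qquad [n]_q=\sum_{i=1}^{n}q^{i-1}.$$ -/

import Mathlib

open scoped TensorProduct

namespace HeckeSym

noncomputable section

/-! ### `q`-integers and `q`-binomial coefficients -/

/-- The `q`-integer `[n]_q = 1 + q + ... + q^(n-1)`. -/
def qInt {K : Type*} [Field K] (q : K) (n : ℕ) : K :=
  ∑ i ∈ Finset.range n, q ^ i

/-- The `q`-binomial coefficient: the value at `q` of the Gaussian polynomial, given by the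
`q`-Pascal rule (so that it is meaningful when `q` is a root of unity). -/
def qBinom {K : Type*} [Field K] (q : K) : ℕ → ℕ → K
  | _, 0 => 1
  | 0, _ + 1 => 0
  | n + 1, k + 1 => qBinom q n k + q ^ (k + 1) * qBinom q n (k + 1)

/-! ### Hecke symmetries -/

section Basic

variable {K V : Type*} [Field K] [AddCommGroup V] [Module K V]

/-- `Id_V ⊗ R`, written on `(V ⊗ V) ⊗ V`. -/
def idTensor (R : V ⊗[K] V →ₗ[K] V ⊗[K] V) :
    (V ⊗[K] V) ⊗[K] V →ₗ[K] (V ⊗[K] V) ⊗[K] V :=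
  (TensorProduct.assoc K V V V).symm.toLinearMap ∘ₗ R.lTensor V ∘ₗ
    (TensorProduct.assoc K V V V).toLinearMap

/-- A Hecke symmetry on `V` with parameter `q`. -/
structure IsHeckeSymmetry (q : K) (R : V ⊗[K] V →ₗ[K] V ⊗[K] V) : Prop where
  ne_zero : q ≠ 0
  braid : R.rTensor V ∘ₗ idTensor R ∘ₗ R.rTensor V =
    idTensor R ∘ₗ R.rTensor V ∘ₗ idTensor R
  hecke : (R - q • LinearMap.id) ∘ₗ (R + LinearMap.id) = 0

/-! ### The action of the Hecke algebra generators on tensor powers -/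

/-- Given `v = (v_0, ..., v_(n-1))` and distinct positions `i`, `j`, the linear map
`V ⊗ V → V^(⊗n)` which sends `a ⊗ b` to the pure tensor obtained from
`v_0 ⊗ ... ⊗ v_(n-1)` on replacing the factor number `i` by `a` and number `j` by `b`. -/
def placeAt {n : ℕ} (i j : Fin n) (hij : i ≠ j) (v : Fin n → V) :
    V ⊗[K] V →ₗ[K] ⨂[K]^n V :=
  TensorProduct.lift <| LinearMap.mk₂ K
    (fun a b => PiTensorProduct.tprod K (Function.update (Function.update v i a) j b))
    (fun a a' b => by
      simp only [Function.update_comm hij, MultilinearMap.map_update_add])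
    (fun c a b => by
      simp only [Function.update_comm hij, MultilinearMap.map_update_smul])
    (fun a b b' => by simp only [MultilinearMap.map_update_add])
    (fun c a b => by simp only [MultilinearMap.map_update_smul])

theorem placeAt_tmul {n : ℕ} (i j : Fin n) (hij : i ≠ j) (v : Fin n → V) (a b : V) :
    placeAt (K := K) i j hij v (a ⊗ₜ b) =
      PiTensorProduct.tprod K (Function.update (Function.update v i a) j b) := rfl

theorem placeAt_update_left {n : ℕ} (i j : Fin n) (hij : i ≠ j) (v : Fin n → V) (x : V) :
    placeAt (K := K) i j hij (Function.update v i x) = placeAt i j hij v := by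
  ext a b
  simp [placeAt_tmul]

theorem placeAt_update_right {n : ℕ} (i j : Fin n) (hij : i ≠ j) (v : Fin n → V) (x : V) :
    placeAt (K := K) i j hij (Function.update v j x) = placeAt i j hij v := by
  ext a b
  simp [placeAt_tmul, Function.update_comm hij]

theorem placeAt_update_add {n : ℕ} (i j : Fin n) (hij : i ≠ j) (v : Fin n → V)
    (m : Fin n) (hi : m ≠ i) (hj : m ≠ j) (x y : V) :
    placeAt (K := K) i j hij (Function.update v m (x + y)) =
      placeAt i j hij (Function.update v m x) + placeAt i j hij (Function.update v m y) := by
  ext a b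
  simp [placeAt_tmul, Function.update_comm hi, Function.update_comm hj]

theorem placeAt_update_smul {n : ℕ} (i j : Fin n) (hij : i ≠ j) (v : Fin n → V)
    (m : Fin n) (hi : m ≠ i) (hj : m ≠ j) (c : K) (x : V) :
    placeAt (K := K) i j hij (Function.update v m (c • x)) =
      c • placeAt i j hij (Function.update v m x) := by
  ext a b
  simp [placeAt_tmul, Function.update_comm hi, Function.update_comm hj]

/-- The operator on `V^(⊗n)` which applies `R` to the factors in the positions `i`, `j`. -/
def actAt (R : V ⊗[K] V →ₗ[K] V ⊗[K] V) {n : ℕ} (i j : Fin n) (hij : i ≠ j) :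
    Module.End K (⨂[K]^n V) :=
  PiTensorProduct.lift <| MultilinearMap.mk'
    (fun v => placeAt i j hij v (R (v i ⊗ₜ v j)))
    (fun v m x y => by
      by_cases hi : m = i
      · subst hi
        simp [placeAt_update_left, hij.symm, TensorProduct.add_tmul]
      · by_cases hj : m = j
        · subst hj
          simp [placeAt_update_right, hij, TensorProduct.tmul_add]
        · simp [placeAt_update_add, hi, hj, Function.update_of_ne (Ne.symm hi),
            Function.update_of_ne (Ne.symm hj)])
    (fun v m c x => by
      by_cases hi : m = i
      · subst hi
        simp [placeAt_update_left, hij.symm, ← TensorProduct.smul_tmul']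
      · by_cases hj : m = j
        · subst hj
          simp [placeAt_update_right, hij]
        · simp [placeAt_update_smul, hi, hj, Function.update_of_ne (Ne.symm hi),
            Function.update_of_ne (Ne.symm hj)])

theorem actAt_tprod (R : V ⊗[K] V →ₗ[K] V ⊗[K] V) {n : ℕ} (i j : Fin n) (hij : i ≠ j)
    (v : Fin n → V) :
    actAt R i j hij (PiTensorProduct.tprod K v) = placeAt i j hij v (R (v i ⊗ₜ v j)) := by
  simp [actAt]

/-- The operator `Id^(⊗i) ⊗ R ⊗ Id^(⊗(n-i-2))` on `V^(⊗n)`. Positions are counted from `0`: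
this is the action of the Hecke algebra generator which is called `T_(i+1)` when they are
counted from `1`. -/
def heckeT (R : V ⊗[K] V →ₗ[K] V ⊗[K] V) (n i : ℕ) (hi : i + 1 < n) :
    Module.End K (⨂[K]^n V) :=
  actAt R ⟨i, by omega⟩ ⟨i + 1, hi⟩ (by simp)

/-- The action on `V^(⊗(n+1))` of `T_n ⋯ T_2 T_1` (the operator `T_1` is applied first). -/
def heckeDown (R : V ⊗[K] V →ₗ[K] V ⊗[K] V) (n : ℕ) : Module.End K (⨂[K]^(n + 1) V) :=
  ((List.finRange n).reverse.map
    fun i : Fin n => heckeT R (n + 1) i (Nat.succ_lt_succ i.isLt)).prod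

/-- The action on `V^(⊗(n+1))` of `T_1 T_2 ⋯ T_n` (the operator `T_n` is applied first). -/
def heckeUp (R : V ⊗[K] V →ₗ[K] V ⊗[K] V) (n : ℕ) : Module.End K (⨂[K]^(n + 1) V) :=
  ((List.finRange n).map
    fun i : Fin n => heckeT R (n + 1) i (Nat.succ_lt_succ i.isLt)).prod

/-- The subspace `Υ^(n) = ⋂_i (T_i - q) V^(⊗n)` of `V^(⊗n)`, the intersection being over all
generators `T_1, ..., T_(n-1)` (it is the whole `V^(⊗n)` when `n ≤ 1`). -/
def Upsilon (q : K) (R : V ⊗[K] V →ₗ[K] V ⊗[K] V) (n : ℕ) : Submodule K (⨂[K]^n V) :=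
  ⨅ (i : ℕ) (hi : i + 1 < n), LinearMap.range (heckeT R n i hi - q • LinearMap.id)

/-! ### Multiplication by vectors in the tensor algebra -/

/-- `consMul v u` is the product `v u` in `V^(⊗(n+1))` of a vector `v` and `u ∈ V^(⊗n)`. -/
def consMul {n : ℕ} : V →ₗ[K] ⨂[K]^n V →ₗ[K] ⨂[K]^(n + 1) V :=
  PiTensorProduct.lift.toLinearMap ∘ₗ
    (PiTensorProduct.tprod K (s := fun _ : Fin (n + 1) => V)).curryLeft

/-- `snocMul u v` is the product `u v` in `V^(⊗(n+1))` of `u ∈ V^(⊗n)` and a vector `v`. -/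
def snocMul {n : ℕ} : ⨂[K]^n V →ₗ[K] V →ₗ[K] ⨂[K]^(n + 1) V :=
  PiTensorProduct.lift (PiTensorProduct.tprod K (s := fun _ : Fin (n + 1) => V)).curryRight

theorem consMul_tprod {n : ℕ} (v : V) (w : Fin n → V) :
    consMul v (PiTensorProduct.tprod K w) =
      PiTensorProduct.tprod K (Fin.cons v w : Fin (n + 1) → V) := by
  simp [consMul]

theorem snocMul_tprod {n : ℕ} (v : V) (w : Fin n → V) :
    snocMul (PiTensorProduct.tprod K w) v =
      PiTensorProduct.tprod K (Fin.snoc w v : Fin (n + 1) → V) := by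
  simp [snocMul]

/-! ### The operators which describe the braiding of `V` with `t` -/

/-- `θ` is the operator determined by `T_n ⋯ T_1 (v t) = t θ(v)`. -/
def IsTheta (R : V ⊗[K] V →ₗ[K] V ⊗[K] V) {n : ℕ} (t : ⨂[K]^n V) (θ : V ≃ₗ[K] V) : Prop :=
  ∀ v : V, heckeDown R n (consMul v t) = snocMul t (θ v)

/-- `θ'` is the operator determined by `T_1 ⋯ T_n (t v) = θ'(v) t`. -/
def IsThetaBar (R : V ⊗[K] V →ₗ[K] V ⊗[K] V) {n : ℕ} (t : ⨂[K]^n V) (θ' : V ≃ₗ[K] V) :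
    Prop :=
  ∀ v : V, heckeUp R n (snocMul t v) = consMul (θ' v) t

/-! ### Quadratic algebras, the quadratic dual, Nakayama automorphisms -/

/-- The relations `w = 0` for `w ∈ W ⊆ V ⊗ V`, in the tensor algebra of `V`. -/
inductive QuadRel (W : Submodule K (V ⊗[K] V)) :
    TensorAlgebra K V → TensorAlgebra K V → Prop
  | of (w : V ⊗[K] V) (hw : w ∈ W) :
      QuadRel W (LinearMap.mul' K (TensorAlgebra K V)
        (TensorProduct.map (TensorAlgebra.ι K) (TensorAlgebra.ι K) w)) 0

/-- The quadratic algebra `T(V)/(W)`, where `W ⊆ V ⊗ V`. -/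
abbrev QuadAlg (W : Submodule K (V ⊗[K] V)) : Type _ := RingQuot (QuadRel W)

/-- The canonical map of `V` to `T(V)/(W)`. -/
def QuadAlg.gen (W : Submodule K (V ⊗[K] V)) : V →ₗ[K] QuadAlg W :=
  (RingQuot.mkAlgHom K (QuadRel W)).toLinearMap ∘ₗ TensorAlgebra.ι K

/-- The homogeneous component of degree `k` of `T(V)/(W)`: the span of all products of `k`
elements of the image of `V`. -/
def QuadAlg.component (W : Submodule K (V ⊗[K] V)) (k : ℕ) : Submodule K (QuadAlg W) :=
  LinearMap.range (QuadAlg.gen W) ^ k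

/-- The relations of the quadratic dual: the annihilator `W^⊥ ⊆ V* ⊗ V*` of `W ⊆ V ⊗ V` with
respect to the pairing `⟨f ⊗ g, v ⊗ w⟩ = f(v) g(w)`. -/
def dualRelations (W : Submodule K (V ⊗[K] V)) :
    Submodule K (Module.Dual K V ⊗[K] Module.Dual K V) :=
  W.dualAnnihilator.comap (TensorProduct.dualDistrib K V V)

/-- The space of relations `Im (R - q)` of the algebra `S(V, R) = T(V)/(Im (R - q))`. -/
def symRelations (q : K) (R : V ⊗[K] V →ₗ[K] V ⊗[K] V) : Submodule K (V ⊗[K] V) :=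
  LinearMap.range (R - q • LinearMap.id)

/-- `ν` is the distinguished Nakayama automorphism of the graded algebra `A = T(V)/(W)` whose
top component has degree `n`: it preserves the grading, and `b a = ν(a) b` for all `a ∈ A_k`,
`b ∈ A_(n-k)`. -/
structure IsNakayama (W : Submodule K (V ⊗[K] V)) (n : ℕ) (ν : QuadAlg W ≃ₐ[K] QuadAlg W) :
    Prop where
  map_component : ∀ k : ℕ, ∀ a ∈ QuadAlg.component W k, ν a ∈ QuadAlg.component W k
  mul_eq : ∀ k ≤ n, ∀ a ∈ QuadAlg.component W k, ∀ b ∈ QuadAlg.component W (n - k),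
    b * a = ν a * b

/-- `ψ` is the operator on `V` such that the dual operator `ψ*` on `V*` is the restriction to
degree 1 of the Nakayama automorphism of the quadratic dual of `S(V, R)`, whose top degree is
`n`. -/
def IsPsi (q : K) (R : V ⊗[K] V →ₗ[K] V ⊗[K] V) (n : ℕ) (ψ : V ≃ₗ[K] V) : Prop :=
  ∃ ν : QuadAlg (dualRelations (symRelations q R)) ≃ₐ[K]
      QuadAlg (dualRelations (symRelations q R)),
    IsNakayama (dualRelations (symRelations q R)) n ν ∧
    ∀ f : Module.Dual K V,
      ν (QuadAlg.gen (dualRelations (symRelations q R)) f) =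
        QuadAlg.gen (dualRelations (symRelations q R)) (ψ.toLinearMap.dualMap f)

/-- The operator `χ^(⊗k)` on `V^(⊗k)`. -/
def tensorPow (χ : V →ₗ[K] V) (k : ℕ) : Module.End K (⨂[K]^k V) :=
  PiTensorProduct.map fun _ => χ

end Basic

end

end HeckeSym

/-! Everything takes place in the tensor algebra, with the generators normalized to g_i = -q⁻¹ T_i
(`gen`, indexed from 0). They satisfy the braid relations and (g + 1)(g - q⁻¹) = 0. As 1 + g_i is
proportional to T_i - q, the space Υ^(m) is the intersection of the images of the 1 + g_i, and every
g_i acts on it by q⁻¹. The sum Ш_{k,l} over all (k,l)-shuffles maps Υ^(k)Υ^(l) into Υ^(k+l)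
(`IsHecke.shuffleSum_mem_seg`) and acts on Υ^(k+l) by a scalar, a q-binomial coefficient up to a
power of q (`pow_mul_shuffleCount`).

Put ϑ = (-q)⁻ⁿ θ, so that g_n ⋯ g_1 (v t) = t ϑ(v); it exists because the left side lies in Υ^(n) ⊗
V = t V. Moving u ∈ Υ^(k) past t one factor at a time gives t ϑ^(⊗k)(u). Since Υ^(n+1) = 0, all
shuffle sums landing there vanish, and this yields the central identity t ϑ^(⊗k)(u) = c_k
Ш_{k,n-k}(u t), where the shuffles act on the first n factors and c_k = (-1)^k q^(-k(k-1)/2)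
(`IsHecke.moveBlock_eq_shuffleSum`, `IsVolume.mul_mapT`).

The quadratic dual A acts on the spaces Υ^(j) by right contractions, and linear forms on A_m
correspond to elements of Υ^(m). Hence A_n is detected by contraction with t, and ψ is characterized
by a rotation property: contracting the last factor of t with f is the same as contracting the first
one with ψ*f (`IsRot`, `IsVolume.isPsi_iff`). Equivalently, t is fixed by moving its last factor to
the front through ψ⁻¹.

For the trace, write t = ∑ x_j y_j with x_j of degree n - k and y_j ∈ Υ^(k), and take a linear form
F with F(t) = 1. The central identity gives (ψ⁻¹ϑ)^(⊗k)(u) = c_k ∑ F(Ш(u x_j)) ψ⁻¹(y_j), a sum of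
operators of rank one, with trace c_k F(Ш(∑ ψ⁻¹(y_j) x_j)). By k rotations the inner sum is t, on
which Ш is a scalar (`IsVolume.exists_rank_one_sum`). The factor (-q)^(nk) passes back from ϑ to θ.
The statement for the other operator follows by reversing the order of tensor factors, which turns ψ
into ψ⁻¹. -/

open scoped TensorProduct

namespace HeckeSym

noncomputable section

/-! ### Braid relations and quantum shuffles in an arbitrary ring. -/

section Braided

variable {E : Type*} [Ring E]

/-- A sequence of elements satisfying the braid relations. -/
structure Braided (c : ℕ → E) : Prop where
  braid : ∀ i, c i * c (i + 1) * c i = c (i + 1) * c i * c (i + 1)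
  comm : ∀ i j, i + 2 ≤ j → Commute (c i) (c j)

/-- The product `c_(s+j-1) ⋯ c_(s+1) c_s`. -/
def moveRight (c : ℕ → E) (s : ℕ) : ℕ → E
  | 0 => 1
  | j + 1 => c (s + j) * moveRight c s j

/-- The sum over all `(k, l)`-shuffles acting on the positions `s, ..., s + k + l - 1`. -/
def shuffleSum (c : ℕ → E) (s : ℕ) : ℕ → ℕ → E
  | 0, _ => 1
  | _ + 1, 0 => 1
  | k + 1, l + 1 =>
    shuffleSum c s (k + 1) l + shuffleSum c s k (l + 1) * moveRight c (s + k) (l + 1)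
  termination_by k l => k + l

variable {c : ℕ → E}

@[simp] theorem moveRight_zero (s : ℕ) : moveRight c s 0 = 1 := rfl

theorem moveRight_succ (s j : ℕ) : moveRight c s (j + 1) = c (s + j) * moveRight c s j := rfl

theorem moveRight_succ' (s j : ℕ) :
    moveRight c s (j + 1) = moveRight c (s + 1) j * c s := by
  induction j with
  | zero => simp [moveRight_succ]
  | succ j ih =>
    rw [moveRight_succ, ih, moveRight_succ, mul_assoc]
    congr 2; omega

theorem moveRight_add (s i j : ℕ) :
    moveRight c s (i + j) = moveRight c (s + i) j * moveRight c s i := by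
  induction j with
  | zero => simp
  | succ j ih => rw [← add_assoc, moveRight_succ, ih, moveRight_succ, mul_assoc, add_assoc]

@[simp] theorem shuffleSum_zero_left (s l : ℕ) : shuffleSum c s 0 l = 1 := by
  simp [shuffleSum]

@[simp] theorem shuffleSum_zero_right (s k : ℕ) : shuffleSum c s k 0 = 1 := by
  cases k <;> simp [shuffleSum]

/-- Shuffles are sorted by the block whose last factor ends up in the last place: the second block
in the first summand, the first block in the other. -/
theorem shuffleSum_succ_succ (s k l : ℕ) :
    shuffleSum c s (k + 1) (l + 1) = shuffleSum c s (k + 1) l +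
      shuffleSum c s k (l + 1) * moveRight c (s + k) (l + 1) := by
  rw [shuffleSum]

theorem shuffleSum_one_succ (s l : ℕ) :
    shuffleSum c s 1 (l + 1) = shuffleSum c s 1 l + moveRight c s (l + 1) := by
  rw [shuffleSum_succ_succ]; simp

theorem moveRight_induction (P : E → Prop) (h1 : P 1) (hmul : ∀ a b, P a → P b → P (a * b))
    (s j : ℕ) (h : ∀ i, s ≤ i → i < s + j → P (c i)) : P (moveRight c s j) := by
  induction j with
  | zero => exact h1
  | succ j ih =>
    exact hmul _ _ (h _ (by omega) (by omega)) (ih fun i hi hi' => h i hi (by omega))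

theorem shuffleSum_induction (P : E → Prop) (h1 : P 1) (hmul : ∀ a b, P a → P b → P (a * b))
    (hadd : ∀ a b, P a → P b → P (a + b)) (s k l : ℕ)
    (h : ∀ i, s ≤ i → i + 1 < s + k + l → P (c i)) : P (shuffleSum c s k l) := by
  induction hm : k + l using Nat.strong_induction_on generalizing k l with
  | _ m ih =>
    rcases k with _ | k
    · simpa using h1
    rcases l with _ | l
    · simpa using h1
    rw [shuffleSum_succ_succ]
    refine hadd _ _ (ih _ (by omega) _ _ (fun i hi hi' => h i hi (by omega)) rfl)
      (hmul _ _ (ih _ (by omega) _ _ (fun i hi hi' => h i hi (by omega)) rfl) ?_)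
    exact moveRight_induction P h1 hmul _ _ fun i hi hi' => h i (by omega) (by omega)

theorem Commute.moveRight_right {x : E} (s j : ℕ)
    (h : ∀ i, s ≤ i → i < s + j → Commute x (c i)) : Commute x (moveRight c s j) :=
  moveRight_induction (Commute x) (Commute.one_right x) (fun _ _ => Commute.mul_right) s j h

theorem Commute.shuffleSum_right {x : E} (s k l : ℕ)
    (h : ∀ i, s ≤ i → i + 1 < s + k + l → Commute x (c i)) : Commute x (shuffleSum c s k l) :=
  shuffleSum_induction (Commute x) (Commute.one_right x) (fun _ _ => Commute.mul_right)
    (fun _ _ => Commute.add_right) s k l h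

theorem Braided.comm' (hc : Braided c) (i j : ℕ) (h : i + 2 ≤ j ∨ j + 2 ≤ i) :
    Commute (c i) (c j) :=
  h.elim (hc.comm i j) fun h => (hc.comm j i h).symm

/-- The generator commutes with the letters of index below `i`, meets `c (i + 1) * c i`, where the
braid relation turns it into `c i`, and this commutes with the remaining letters. -/
theorem Braided.moveRight_mul_gen (hc : Braided c) (s m i : ℕ) (hs : s ≤ i)
    (hi : i + 1 < s + m) : moveRight c s m * c (i + 1) = c i * moveRight c s m := by
  obtain ⟨a, rfl⟩ := Nat.exists_eq_add_of_le hs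
  obtain ⟨b, rfl⟩ : ∃ b, m = a + 2 + b := ⟨m - (a + 2), by omega⟩
  rw [moveRight_add s (a + 2) b]
  have h1 : Commute (c (s + a)) (moveRight c (s + (a + 2)) b) :=
    Commute.moveRight_right _ _ fun j hj _ => hc.comm _ _ (by omega)
  have h2 : Commute (c (s + a + 1)) (moveRight c s a) :=
    Commute.moveRight_right _ _ fun j _ hj => hc.comm' _ _ (by omega)
  have h3 := hc.braid (s + a)
  rw [← mul_assoc (c (s + a)), h1.eq, mul_assoc, mul_assoc]
  congr 1
  rw [moveRight_succ, moveRight_succ]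
  simp only [← add_assoc]
  rw [mul_assoc, mul_assoc, ← h2.eq, ← mul_assoc, ← mul_assoc, ← h3]
  simp only [mul_assoc]

theorem Braided.moveRight_mul_moveRight (hc : Braided c) (s m s' j : ℕ) (hs : s ≤ s')
    (hj : s' + j < s + m) :
    moveRight c s m * moveRight c (s' + 1) j = moveRight c s' j * moveRight c s m := by
  induction j with
  | zero => simp
  | succ j ih =>
    rw [moveRight_succ, moveRight_succ, ← mul_assoc, add_right_comm,
      hc.moveRight_mul_gen s m (s' + j) (by omega) (by omega), mul_assoc,
      ih (by omega), mul_assoc]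

/-- Moving two adjacent factors to the right by `j` positions. -/
theorem Braided.moveRight_mul_moveRight_mul_gen (hc : Braided c) (s j : ℕ) :
    moveRight c s j * moveRight c (s + 1) j * c s =
      c (s + j) * (moveRight c s j * moveRight c (s + 1) j) := by
  rw [mul_assoc, ← moveRight_succ',
    ← hc.moveRight_mul_moveRight s (j + 1) s j le_rfl (by omega), moveRight_succ, mul_assoc]

theorem Braided.moveRight_mul_shuffleSum (hc : Braided c) (s m k l : ℕ) (h : k + l ≤ m) :
    moveRight c s m * shuffleSum c (s + 1) k l = shuffleSum c s k l * moveRight c s m := by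
  induction hn : k + l using Nat.strong_induction_on generalizing k l with
  | _ n ih =>
    rcases k with _ | k
    · simp
    rcases l with _ | l
    · simp
    rw [shuffleSum_succ_succ, shuffleSum_succ_succ, mul_add, add_mul,
      ih _ (by omega) (k + 1) l (by omega) rfl, ← mul_assoc,
      ih _ (by omega) k (l + 1) (by omega) rfl, mul_assoc, add_right_comm s 1 k,
      hc.moveRight_mul_moveRight _ _ _ _ (by omega) (by omega), mul_assoc]

/-- Associativity of the quantum shuffle product: both sides sum over all shuffles of three blocks
of lengths 1, `k`, `l`. -/
theorem Braided.shuffleSum_assoc (hc : Braided c) (s k l : ℕ) :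
    shuffleSum c s 1 (k + l) * shuffleSum c (s + 1) k l =
      shuffleSum c s (k + 1) l * shuffleSum c s 1 k := by
  induction hn : k + l using Nat.strong_induction_on generalizing k l with
  | _ n ih =>
    subst hn
    rcases k with _ | k
    · simp
    rcases l with _ | l
    · simp
    have e1 := ih _ (by omega) (k + 1) l rfl
    have e2 := ih _ (by omega) k (l + 1) rfl
    have e3 : moveRight c s (k + 1 + (l + 1)) * shuffleSum c (s + 1) (k + 1) (l + 1) = _ :=
      hc.moveRight_mul_shuffleSum s _ _ _ le_rfl
    have hcomm : Commute (shuffleSum c s 1 k) (moveRight c (s + (k + 1)) (l + 1)) :=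
      Commute.moveRight_right _ _ fun i hi _ =>
        (Commute.shuffleSum_right _ _ _ fun j _ hj => hc.comm' _ _ (by omega)).symm
    have e4 : moveRight c s (k + 1 + (l + 1)) =
        moveRight c (s + (k + 1)) (l + 1) * moveRight c s (k + 1) := moveRight_add _ _ _
    have hL : shuffleSum c s 1 (k + 1 + (l + 1)) =
        shuffleSum c s 1 (k + 1 + l) + moveRight c s (k + 1 + (l + 1)) :=
      shuffleSum_one_succ s (k + 1 + l)
    have hY : shuffleSum c (s + 1) (k + 1) (l + 1) = shuffleSum c (s + 1) (k + 1) l +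
        shuffleSum c (s + 1) k (l + 1) * moveRight c (s + (k + 1)) (l + 1) := by
      rw [shuffleSum_succ_succ, add_right_comm s 1 k, add_assoc s k 1]
    rw [hL, add_mul, e3, hY, mul_add, e1, ← mul_assoc,
      show k + 1 + l = k + (l + 1) by omega, e2, mul_assoc, hcomm.eq,
      shuffleSum_succ_succ s (k + 1) l, add_mul, e4, shuffleSum_one_succ s k]
    simp only [mul_add, mul_assoc]
    abel

end Braided

/-! ### Degrees, contractions and tensor powers inside the tensor algebra. -/

section TensorAlg

variable {K V : Type*} [Field K] [AddCommGroup V] [Module K V]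

local notation "𝕋" => TensorAlgebra K V
local notation "𝕚" => TensorAlgebra.ι K

/-- The homogeneous component of degree `m` of the tensor algebra. -/
def deg (K V : Type*) [Field K] [AddCommGroup V] [Module K V] (m : ℕ) :
    Submodule K (TensorAlgebra K V) :=
  LinearMap.range (TensorAlgebra.ι K : V →ₗ[K] TensorAlgebra K V) ^ m

theorem mem_deg_zero {x : 𝕋} : x ∈ deg K V 0 ↔ ∃ r : K, algebraMap K 𝕋 r = x := by
  rw [deg, pow_zero, Submodule.mem_one]

theorem one_mem_deg : (1 : 𝕋) ∈ deg K V 0 := mem_deg_zero.2 ⟨1, map_one _⟩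

theorem mem_deg_one {x : 𝕋} : x ∈ deg K V 1 ↔ ∃ v : V, 𝕚 v = x := by
  rw [deg, pow_one, LinearMap.mem_range]

theorem ι_mem_deg (v : V) : 𝕚 v ∈ deg K V 1 := mem_deg_one.2 ⟨v, rfl⟩

theorem mul_mem_deg {a b : ℕ} {x y : 𝕋} (hx : x ∈ deg K V a) (hy : y ∈ deg K V b) :
    x * y ∈ deg K V (a + b) := by
  rw [deg, pow_add]; exact Submodule.mul_mem_mul hx hy

theorem cons_mem_deg {m : ℕ} (v : V) {y : 𝕋} (hy : y ∈ deg K V m) :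
    𝕚 v * y ∈ deg K V (m + 1) := by
  rw [add_comm]; exact mul_mem_deg (ι_mem_deg v) hy

theorem snoc_mem_deg {m : ℕ} (v : V) {y : 𝕋} (hy : y ∈ deg K V m) :
    y * 𝕚 v ∈ deg K V (m + 1) := mul_mem_deg hy (ι_mem_deg v)

/-- A subspace which contains the products `x y`, with `x`, `y` of degrees `a`, `b`, contains the
component of degree `a + b`. -/
theorem deg_add_le {a b : ℕ} {S : Submodule K 𝕋}
    (h : ∀ x ∈ deg K V a, ∀ y ∈ deg K V b, x * y ∈ S) : deg K V (a + b) ≤ S := by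
  rw [deg, pow_add]; exact Submodule.mul_le.2 h

theorem deg_succ_le {m : ℕ} {S : Submodule K 𝕋}
    (h : ∀ v, ∀ y ∈ deg K V m, 𝕚 v * y ∈ S) : deg K V (m + 1) ≤ S := by
  rw [add_comm]
  refine deg_add_le fun x hx y hy => ?_
  obtain ⟨v, rfl⟩ := mem_deg_one.1 hx
  exact h v y hy

theorem deg_succ_le' {m : ℕ} {S : Submodule K 𝕋}
    (h : ∀ v, ∀ y ∈ deg K V m, y * 𝕚 v ∈ S) : deg K V (m + 1) ≤ S := by
  refine deg_add_le fun x hx y hy => ?_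
  obtain ⟨v, rfl⟩ := mem_deg_one.1 hy
  exact h v x hx

theorem eqOn_deg_add {M : Type*} [AddCommGroup M] [Module K M] {φ χ : 𝕋 →ₗ[K] M} {a b : ℕ}
    (h : ∀ x ∈ deg K V a, ∀ y ∈ deg K V b, φ (x * y) = χ (x * y)) {x : 𝕋}
    (hx : x ∈ deg K V (a + b)) : φ x = χ x :=
  deg_add_le (S := LinearMap.eqLocus φ χ) h hx

theorem eqOn_deg_succ {M : Type*} [AddCommGroup M] [Module K M] {φ χ : 𝕋 →ₗ[K] M} {m : ℕ}
    (h : ∀ v, ∀ y ∈ deg K V m, φ (𝕚 v * y) = χ (𝕚 v * y)) {x : 𝕋}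
    (hx : x ∈ deg K V (m + 1)) : φ x = χ x :=
  deg_succ_le (S := LinearMap.eqLocus φ χ) h hx

theorem eqOn_deg_succ' {M : Type*} [AddCommGroup M] [Module K M] {φ χ : 𝕋 →ₗ[K] M} {m : ℕ}
    (h : ∀ v, ∀ y ∈ deg K V m, φ (y * 𝕚 v) = χ (y * 𝕚 v)) {x : 𝕋}
    (hx : x ∈ deg K V (m + 1)) : φ x = χ x :=
  deg_succ_le' (S := LinearMap.eqLocus φ χ) h hx

theorem mapsTo_deg_succ {φ : 𝕋 →ₗ[K] 𝕋} {m : ℕ} {S : Submodule K 𝕋}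
    (h : ∀ v, ∀ y ∈ deg K V m, φ (𝕚 v * y) ∈ S) {x : 𝕋}
    (hx : x ∈ deg K V (m + 1)) : φ x ∈ S :=
  deg_succ_le (S := S.comap φ) h hx

/-! ### Left contraction -/

/-- The augmentation of the tensor algebra. -/
def aug : 𝕋 →ₐ[K] K := TensorAlgebra.algebraMapInv

@[simp] theorem aug_ι (v : V) : aug (𝕚 v) = (0 : K) := by
  simp [aug, TensorAlgebra.algebraMapInv]

/-- The algebra homomorphism to triangular matrices whose upper right entry is the left
contraction. -/
def lcMatrix (f : Module.Dual K V) : 𝕋 →ₐ[K] Matrix (Fin 2) (Fin 2) 𝕋 :=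
  TensorAlgebra.lift K
    { toFun := fun v => !![0, algebraMap K 𝕋 (f v); 0, 𝕚 v]
      map_add' := fun v w => by
        ext i j; fin_cases i <;> fin_cases j <;> simp
      map_smul' := fun r v => by
        ext i j; fin_cases i <;> fin_cases j <;> simp [Algebra.smul_def] }

theorem lcMatrix_ι (f : Module.Dual K V) (v : V) :
    lcMatrix f (𝕚 v) = !![0, algebraMap K 𝕋 (f v); 0, 𝕚 v] := by
  simp [lcMatrix]

theorem lcMatrix_spec (f : Module.Dual K V) (x : 𝕋) :
    lcMatrix f x 0 0 = algebraMap K 𝕋 (aug x) ∧ lcMatrix f x 1 0 = 0 ∧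
      lcMatrix f x 1 1 = x := by
  induction x using TensorAlgebra.induction with
  | algebraMap r =>
    rw [AlgHom.commutes, AlgHom.commutes]
    simp [Matrix.algebraMap_matrix_apply]
  | ι v => rw [lcMatrix_ι]; simp
  | mul x y hx hy =>
    rw [map_mul, map_mul]
    simp [Matrix.mul_apply, hx, hy]
  | add x y hx hy => simp [hx, hy]

/-- The left contraction by a linear form `f`: the linear map which sends `v x` to `f(v) x`. -/
def lc (f : Module.Dual K V) : 𝕋 →ₗ[K] 𝕋 where
  toFun x := lcMatrix f x 0 1
  map_add' := by simp
  map_smul' := by simp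

/-- The upper right entry of a product of triangular matrices: a Leibniz rule twisted by the
augmentation. -/
theorem lc_mul (f : Module.Dual K V) (x y : 𝕋) :
    lc f (x * y) = aug x • lc f y + lc f x * y := by
  obtain ⟨h1, h2, h3⟩ := lcMatrix_spec f x
  obtain ⟨h4, h5, h6⟩ := lcMatrix_spec f y
  change lcMatrix f (x * y) 0 1 = aug x • lcMatrix f y 0 1 + lcMatrix f x 0 1 * y
  rw [map_mul, Matrix.mul_apply, Fin.sum_univ_two, h1, h6, Algebra.smul_def]

theorem lc_ι (f : Module.Dual K V) (v : V) : lc f (𝕚 v) = algebraMap K 𝕋 (f v) := by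
  change lcMatrix f (𝕚 v) 0 1 = _
  rw [lcMatrix_ι]; simp

@[simp] theorem lc_cons (f : Module.Dual K V) (v : V) (y : 𝕋) :
    lc f (𝕚 v * y) = f v • y := by
  rw [lc_mul, lc_ι, aug_ι, zero_smul, zero_add, Algebra.smul_def]

theorem lc_algebraMap (f : Module.Dual K V) (r : K) : lc f (algebraMap K 𝕋 r) = 0 := by
  change lcMatrix f (algebraMap K 𝕋 r) 0 1 = _
  rw [AlgHom.commutes]
  simp [Matrix.algebraMap_matrix_apply]

@[simp] theorem lc_one (f : Module.Dual K V) : lc f (1 : 𝕋) = 0 := by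
  rw [← map_one (algebraMap K 𝕋), lc_algebraMap]

theorem lc_mem_deg (f : Module.Dual K V) {m : ℕ} {x : 𝕋} (hx : x ∈ deg K V (m + 1)) :
    lc f x ∈ deg K V m :=
  mapsTo_deg_succ (fun v y hy => by rw [lc_cons]; exact Submodule.smul_mem _ _ hy) hx

/-! ### Reversal and right contraction -/

/-- The reversal, as a homomorphism to the opposite algebra. -/
def revOp : 𝕋 →ₐ[K] 𝕋ᵐᵒᵖ :=
  TensorAlgebra.lift K ((MulOpposite.opLinearEquiv K).toLinearMap ∘ₗ TensorAlgebra.ι K)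

/-- The linear involution of the tensor algebra which reverses the order of factors. -/
def rev : 𝕋 →ₗ[K] 𝕋 := (MulOpposite.opLinearEquiv K).symm.toLinearMap ∘ₗ revOp.toLinearMap

@[simp] theorem rev_ι (v : V) : rev (𝕚 v) = 𝕚 v := by simp [rev, revOp]

theorem rev_mul (x y : 𝕋) : rev (x * y) = rev y * rev x := by simp [rev]

@[simp] theorem rev_algebraMap (r : K) : rev (algebraMap K 𝕋 r) = algebraMap K 𝕋 r := by
  simp [rev]

@[simp] theorem rev_rev (x : 𝕋) : rev (rev x) = x := by
  induction x using TensorAlgebra.induction with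
  | algebraMap r => simp
  | ι v => simp
  | mul x y hx hy => rw [rev_mul, rev_mul, hx, hy]
  | add x y hx hy => rw [map_add, map_add, hx, hy]

theorem rev_mem_deg {m : ℕ} {x : 𝕋} (hx : x ∈ deg K V m) : rev x ∈ deg K V m := by
  induction m generalizing x with
  | zero =>
    obtain ⟨r, rfl⟩ := mem_deg_zero.1 hx
    rw [rev_algebraMap]; exact hx
  | succ m ih =>
    refine mapsTo_deg_succ (fun v y hy => ?_) hx
    rw [rev_mul, rev_ι]
    exact snoc_mem_deg v (ih hy)

/-- The right contraction by a linear form `f`: the linear map which sends `x v` to `f(v) x`. -/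
def rc (f : Module.Dual K V) : 𝕋 →ₗ[K] 𝕋 := rev ∘ₗ lc f ∘ₗ rev

theorem rc_apply (f : Module.Dual K V) (x : 𝕋) : rc f x = rev (lc f (rev x)) := rfl

@[simp] theorem rc_snoc (f : Module.Dual K V) (v : V) (y : 𝕋) :
    rc f (y * 𝕚 v) = f v • y := by
  rw [rc_apply, rev_mul, rev_ι, lc_cons, map_smul, rev_rev]

theorem rc_algebraMap (f : Module.Dual K V) (r : K) : rc f (algebraMap K 𝕋 r) = 0 := by
  rw [rc_apply, rev_algebraMap, lc_algebraMap, map_zero]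

theorem rc_ι (f : Module.Dual K V) (v : V) : rc f (𝕚 v) = algebraMap K 𝕋 (f v) := by
  rw [rc_apply, rev_ι, lc_ι, rev_algebraMap]

theorem rc_mem_deg (f : Module.Dual K V) {m : ℕ} {x : 𝕋} (hx : x ∈ deg K V (m + 1)) :
    rc f x ∈ deg K V m :=
  rev_mem_deg (lc_mem_deg f (rev_mem_deg hx))

/-- Positive degree of `y` is essential: for a scalar `y` the contraction would consume `v` itself.
-/
theorem rc_cons (f : Module.Dual K V) (v : V) {m : ℕ} {y : 𝕋} (hy : y ∈ deg K V (m + 1)) :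
    rc f (𝕚 v * y) = 𝕚 v * rc f y :=
  eqOn_deg_succ' (φ := rc f ∘ₗ LinearMap.mulLeft K (𝕚 v))
    (χ := LinearMap.mulLeft K (𝕚 v) ∘ₗ rc f)
    (fun w y _ => by simp [← mul_assoc]) hy

theorem lc_rc_comm (f g : Module.Dual K V) {m : ℕ} {x : 𝕋} (hx : x ∈ deg K V (m + 2)) :
    lc f (rc g x) = rc g (lc f x) :=
  eqOn_deg_succ (φ := lc f ∘ₗ rc g) (χ := rc g ∘ₗ lc f)
    (fun v y hy => by simp [rc_cons g v hy]) hx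

theorem aug_of_mem_deg {m : ℕ} {x : 𝕋} (hx : x ∈ deg K V (m + 1)) : aug x = (0 : K) :=
  eqOn_deg_succ (φ := aug.toLinearMap) (χ := 0) (fun v y _ => by simp) hx

/-! ### The functorial action of linear maps -/

/-- The endomorphism of the tensor algebra given by a linear operator `χ` on `V`. -/
def mapT (χ : V →ₗ[K] V) : 𝕋 →ₐ[K] 𝕋 := TensorAlgebra.lift K (TensorAlgebra.ι K ∘ₗ χ)

@[simp] theorem mapT_ι (χ : V →ₗ[K] V) (v : V) : mapT χ (𝕚 v) = 𝕚 (χ v) := by simp [mapT]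

theorem mapT_comp (χ φ : V →ₗ[K] V) (x : 𝕋) : mapT (χ ∘ₗ φ) x = mapT χ (mapT φ x) := by
  rw [← AlgHom.comp_apply]
  congr 1
  ext v; simp

theorem mapT_id (x : 𝕋) : mapT LinearMap.id x = x := by
  rw [← AlgHom.id_apply (R := K) x, ← AlgHom.comp_apply, AlgHom.comp_id]
  congr 1
  ext v; simp

theorem mapT_mem_deg (χ : V →ₗ[K] V) {m : ℕ} {x : 𝕋} (hx : x ∈ deg K V m) :
    mapT χ x ∈ deg K V m := by
  induction m generalizing x with
  | zero =>
    obtain ⟨r, rfl⟩ := mem_deg_zero.1 hx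
    rw [AlgHom.commutes]; exact hx
  | succ m ih =>
    refine mapsTo_deg_succ (φ := (mapT χ).toLinearMap) (fun v y hy => ?_) hx
    simp only [AlgHom.toLinearMap_apply, map_mul, mapT_ι]
    exact cons_mem_deg _ (ih hy)

theorem rev_mapT (χ : V →ₗ[K] V) (x : 𝕋) : rev (mapT χ x) = mapT χ (rev x) := by
  induction x using TensorAlgebra.induction with
  | algebraMap r => simp
  | ι v => simp
  | mul x y hx hy => rw [map_mul (mapT χ), rev_mul, rev_mul, map_mul (mapT χ), hx, hy]
  | add x y hx hy => rw [map_add, map_add, map_add, map_add, hx, hy]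

/-! ### Expansions with respect to a basis -/

section Basis

variable [FiniteDimensional K V]

local notation "𝔢" => Module.finBasis K V

theorem ι_eq_sum (v : V) : 𝕚 v = ∑ a, Module.Basis.coord 𝔢 a v • 𝕚 (𝔢 a) := by
  simp only [← map_smul, ← map_sum, Module.Basis.coord_apply, Module.Basis.sum_repr]

theorem expand_left (x : 𝕋) :
    x = algebraMap K 𝕋 (aug x) + ∑ a, 𝕚 (𝔢 a) * lc (Module.Basis.coord 𝔢 a) x := by
  induction x using TensorAlgebra.induction with
  | algebraMap r => simp [lc_algebraMap]
  | ι v =>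
    conv_lhs => rw [ι_eq_sum]
    simp [lc_ι, ← Algebra.commutes, ← Algebra.smul_def]
  | mul x y hx hy =>
    conv_lhs => rw [hx, add_mul, ← Algebra.smul_def]
    conv_lhs => enter [1]; rw [hy]
    simp only [lc_mul, map_mul, mul_add, Finset.sum_add_distrib, smul_add, Finset.smul_sum,
      Finset.sum_mul, mul_assoc, mul_smul_comm, Algebra.smul_def (R := K) (aug x)
        (algebraMap K 𝕋 (aug y))]
    abel
  | add x y hx hy =>
    conv_lhs => rw [hx, hy]
    simp only [map_add, mul_add, Finset.sum_add_distrib]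
    abel

theorem expand_cons {m : ℕ} {x : 𝕋} (hx : x ∈ deg K V (m + 1)) :
    ∑ a, 𝕚 (𝔢 a) * lc (Module.Basis.coord 𝔢 a) x = x := by
  conv_rhs => rw [expand_left x, aug_of_mem_deg hx, map_zero, zero_add]

theorem expand_snoc {m : ℕ} {x : 𝕋} (hx : x ∈ deg K V (m + 1)) :
    ∑ a, rc (Module.Basis.coord 𝔢 a) x * 𝕚 (𝔢 a) = x := by
  have h := congrArg rev (expand_cons (rev_mem_deg hx))
  simpa [rev_mul, rc_apply] using h

/-- Two linear maps coincide if they coincide at `1` and at all products `v y`. -/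
theorem ext_cons {M : Type*} [AddCommGroup M] [Module K M] {φ χ : 𝕋 →ₗ[K] M}
    (h1 : φ 1 = χ 1) (h : ∀ v y, φ (𝕚 v * y) = χ (𝕚 v * y)) : φ = χ := by
  ext x
  rw [expand_left x, map_add, map_add, map_sum, map_sum, Algebra.algebraMap_eq_smul_one,
    map_smul, map_smul, h1]
  simp [h]

theorem lc_add (f g : Module.Dual K V) (x : 𝕋) : lc (f + g) x = lc f x + lc g x := by
  have : (lc (f + g) : 𝕋 →ₗ[K] 𝕋) = lc f + lc g :=
    ext_cons (by simp) fun v y => by simp [add_smul]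
  rw [this, LinearMap.add_apply]

theorem lc_smul (r : K) (f : Module.Dual K V) (x : 𝕋) : lc (r • f) x = r • lc f x := by
  have : (lc (r • f) : 𝕋 →ₗ[K] 𝕋) = r • lc f :=
    ext_cons (by simp) fun v y => by simp [mul_smul]
  rw [this, LinearMap.smul_apply]

theorem rc_add (f g : Module.Dual K V) (x : 𝕋) : rc (f + g) x = rc f x + rc g x := by
  simp [rc_apply, lc_add]

theorem rc_smul (r : K) (f : Module.Dual K V) (x : 𝕋) : rc (r • f) x = r • rc f x := by
  simp [rc_apply, lc_smul]

/-- An element of positive degree is zero if so are all its right contractions. -/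
theorem eq_zero_of_rc {m : ℕ} {x : 𝕋} (hx : x ∈ deg K V (m + 1)) (h : ∀ f, rc f x = 0) :
    x = 0 := by
  rw [← expand_snoc hx]; simp [h]

/-! ### Contraction of the first factors by a linear form on the tensor algebra -/

/-- The linear map which sends `x y`, with `x` of degree `m`, to `F(x) y`. -/
def ctr : ℕ → (𝕋 →ₗ[K] K) → 𝕋 →ₗ[K] 𝕋
  | 0, F => F 1 • LinearMap.id
  | m + 1, F =>
    ∑ a, ctr m (F ∘ₗ LinearMap.mulLeft K (𝕚 (𝔢 a))) ∘ₗ lc (Module.Basis.coord 𝔢 a)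

theorem ctr_mul {m : ℕ} (F : 𝕋 →ₗ[K] K) {x : 𝕋} (hx : x ∈ deg K V m) (y : 𝕋) :
    ctr m F (x * y) = F x • y := by
  induction m generalizing F x with
  | zero =>
    obtain ⟨r, rfl⟩ := mem_deg_zero.1 hx
    rw [Algebra.algebraMap_eq_smul_one, smul_mul_assoc, one_mul, map_smul]
    simp [ctr, smul_smul]
  | succ m ih =>
    refine eqOn_deg_succ (φ := ctr (m + 1) F ∘ₗ LinearMap.mulRight K y)
      (χ := LinearMap.smulRight F y) (fun v z hz => ?_) hx
    simp only [LinearMap.comp_apply, LinearMap.mulRight_apply, LinearMap.smulRight_apply, ctr,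
      LinearMap.sum_apply, mul_assoc, lc_cons, map_smul, ih _ hz, LinearMap.mulLeft_apply]
    have hv : F (𝕚 v * z) = ∑ a, Module.Basis.coord 𝔢 a v * F (𝕚 (𝔢 a) * z) := by
      conv_lhs => rw [ι_eq_sum]
      simp [Finset.sum_mul]
    simp [hv, Finset.sum_smul, smul_smul]

end Basis

/-! ### Tensor powers as homogeneous components -/

/-- The embedding of tensor powers in the tensor algebra. -/
abbrev toT {n : ℕ} : ⨂[K]^n V →ₗ[K] 𝕋 := TensorPower.toTensorAlgebra

/-- Composed with the isomorphism of the tensor algebra with the direct sum of tensor powers, `toT`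
becomes the inclusion of a summand. -/
theorem toT_injective (n : ℕ) : Function.Injective (toT : ⨂[K]^n V →ₗ[K] 𝕋) := by
  have h : (TensorAlgebra.equivDirectSum (R := K) (M := V)).toLinearMap ∘ₗ
      (toT : ⨂[K]^n V →ₗ[K] 𝕋) = DirectSum.lof K ℕ (fun n => ⨂[K]^n V) n := by
    ext v
    simp [-TensorAlgebra.tprod_apply, TensorAlgebra.toDirectSum_tensorPower_tprod,
      DirectSum.lof_eq_of]
  intro x y hxy
  apply DirectSum.of_injective (β := fun n => ⨂[K]^n V) n
  have hx := LinearMap.congr_fun h x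
  have hy := LinearMap.congr_fun h y
  rw [LinearMap.comp_apply, DirectSum.lof_eq_of] at hx hy
  rw [← hx, ← hy, hxy]

theorem toT_consMul {n : ℕ} (v : V) (x : ⨂[K]^n V) : toT (consMul v x) = 𝕚 v * toT x := by
  have : (toT : ⨂[K]^(n + 1) V →ₗ[K] 𝕋) ∘ₗ consMul v = LinearMap.mulLeft K (𝕚 v) ∘ₗ toT := by
    ext w
    simp [consMul_tprod, List.ofFn_succ]
  exact LinearMap.congr_fun this x

theorem toT_snocMul {n : ℕ} (v : V) (x : ⨂[K]^n V) : toT (snocMul x v) = toT x * 𝕚 v := by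
  have : (toT : ⨂[K]^(n + 1) V →ₗ[K] 𝕋) ∘ₗ snocMul.flip v =
      LinearMap.mulRight K (𝕚 v) ∘ₗ toT := by
    ext w
    simp only [LinearMap.compMultilinearMap_apply, LinearMap.comp_apply, LinearMap.flip_apply,
      snocMul_tprod, TensorPower.toTensorAlgebra_tprod, TensorAlgebra.tprod_apply,
      LinearMap.mulRight_apply, List.ofFn_succ', List.concat_eq_append, List.prod_append]
    simp
  exact LinearMap.congr_fun this x

theorem range_toT (n : ℕ) : LinearMap.range (toT : ⨂[K]^n V →ₗ[K] 𝕋) = deg K V n := by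
  apply le_antisymm
  · rintro _ ⟨x, rfl⟩
    induction x using PiTensorProduct.induction_on with
    | smul_tprod r w =>
      rw [map_smul]
      refine Submodule.smul_mem _ _ ?_
      rw [TensorPower.toTensorAlgebra_tprod]
      induction n with
      | zero => simpa using one_mem_deg
      | succ n ih =>
        have := ih (Fin.tail w)
        simp only [TensorAlgebra.tprod_apply, List.ofFn_succ, List.prod_cons] at this ⊢
        exact cons_mem_deg _ this
    | add x y hx hy => rw [map_add]; exact Submodule.add_mem _ hx hy
  · induction n with
    | zero =>
      intro x hx
      obtain ⟨r, rfl⟩ := mem_deg_zero.1 hx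
      refine ⟨r • PiTensorProduct.tprod K Fin.elim0, ?_⟩
      simp [Algebra.algebraMap_eq_smul_one]
    | succ n ih =>
      refine deg_succ_le fun v y hy => ?_
      obtain ⟨y, rfl⟩ := ih hy
      exact ⟨consMul v y, toT_consMul v y⟩

theorem toT_mem_deg {n : ℕ} (x : ⨂[K]^n V) : toT x ∈ deg K V n := by
  rw [← range_toT]; exact ⟨x, rfl⟩

theorem exists_toT_eq {n : ℕ} {x : 𝕋} (hx : x ∈ deg K V n) : ∃ y : ⨂[K]^n V, toT y = x := by
  rwa [← range_toT] at hx

theorem toT_tensorPow (χ : V →ₗ[K] V) {k : ℕ} (x : ⨂[K]^k V) :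
    toT (tensorPow χ k x) = mapT χ (toT x) := by
  have : (toT : ⨂[K]^k V →ₗ[K] 𝕋) ∘ₗ tensorPow χ k = (mapT χ).toLinearMap ∘ₗ toT := by
    ext w
    simp [tensorPow, map_list_prod, List.map_ofFn, Function.comp_def]
  exact LinearMap.congr_fun this x

end TensorAlg

/-! ### The Hecke generators as operators on the whole tensor algebra. -/

section Operators

variable {K V : Type*} [Field K] [AddCommGroup V] [Module K V]

local notation "𝕋" => TensorAlgebra K V
local notation "𝕚" => TensorAlgebra.ι K

/-- The multiplication map from `V ⊗ V` to the tensor algebra. -/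
def mulTwo (K V : Type*) [Field K] [AddCommGroup V] [Module K V] :
    V ⊗[K] V →ₗ[K] TensorAlgebra K V :=
  LinearMap.mul' K (TensorAlgebra K V) ∘ₗ
    TensorProduct.map (TensorAlgebra.ι K) (TensorAlgebra.ι K)

@[simp] theorem mulTwo_tmul (v w : V) : mulTwo K V (v ⊗ₜ w) = 𝕚 v * 𝕚 w := by simp [mulTwo]

theorem mulTwo_mem_deg (z : V ⊗[K] V) : mulTwo K V z ∈ deg K V 2 := by
  induction z using TensorProduct.induction_on with
  | zero => simp
  | tmul v w => rw [mulTwo_tmul]; exact mul_mem_deg (ι_mem_deg v) (ι_mem_deg w)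
  | add x y hx hy => rw [map_add]; exact Submodule.add_mem _ hx hy

theorem mulTwo_assoc (a : V) (z : V ⊗[K] V) :
    LinearMap.mul' K 𝕋 (TensorProduct.map (mulTwo K V) 𝕚
      ((TensorProduct.assoc K V V V).symm (a ⊗ₜ z))) = 𝕚 a * mulTwo K V z := by
  induction z using TensorProduct.induction_on with
  | zero => simp
  | tmul v w => simp [mul_assoc]
  | add x y hx hy => simp only [map_add, TensorProduct.tmul_add, mul_add, hx, hy]

variable [FiniteDimensional K V]

local notation "𝔢" => Module.finBasis K V

/-- The operator on the tensor algebra which applies `R` to the factors in the positions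
`i`, `i + 1` counted from `0`, and annihilates the components of degree less than `i + 2`. -/
def tau (R : V ⊗[K] V →ₗ[K] V ⊗[K] V) : ℕ → Module.End K 𝕋
  | 0 => ∑ a, ∑ b, LinearMap.mulLeft K (mulTwo K V (R (𝔢 a ⊗ₜ 𝔢 b))) ∘ₗ
      lc (Module.Basis.coord 𝔢 b) ∘ₗ lc (Module.Basis.coord 𝔢 a)
  | i + 1 => ∑ a, LinearMap.mulLeft K (𝕚 (𝔢 a)) ∘ₗ tau R i ∘ₗ lc (Module.Basis.coord 𝔢 a)

variable (R : V ⊗[K] V →ₗ[K] V ⊗[K] V)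

theorem tau_zero_tmul (v w : V) (y : 𝕋) :
    tau R 0 (𝕚 v * (𝕚 w * y)) = mulTwo K V (R (v ⊗ₜ w)) * y := by
  have h : v ⊗ₜ[K] w = ∑ a, ∑ b, (Module.Basis.coord 𝔢 a v * Module.Basis.coord 𝔢 b w) •
      (𝔢 a ⊗ₜ[K] 𝔢 b) := by
    conv_lhs => rw [← Module.Basis.sum_repr 𝔢 v, ← Module.Basis.sum_repr 𝔢 w]
    simp only [TensorProduct.sum_tmul, TensorProduct.tmul_sum, TensorProduct.smul_tmul_smul,
      Module.Basis.coord_apply]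
    exact Finset.sum_comm
  rw [h]
  simp [tau, Finset.sum_mul, smul_smul]

theorem tau_zero_mulTwo (z : V ⊗[K] V) (y : 𝕋) :
    tau R 0 (mulTwo K V z * y) = mulTwo K V (R z) * y := by
  induction z using TensorProduct.induction_on with
  | zero => simp
  | tmul v w => rw [mulTwo_tmul, mul_assoc, tau_zero_tmul]
  | add x y hx hy => simp only [map_add, add_mul, hx, hy]

theorem tau_succ_cons (i : ℕ) (v : V) (y : 𝕋) :
    tau R (i + 1) (𝕚 v * y) = 𝕚 v * tau R i y := by
  simp only [tau, LinearMap.sum_apply, LinearMap.comp_apply, lc_cons, map_smul,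
    LinearMap.mulLeft_apply]
  conv_rhs => rw [ι_eq_sum]
  simp [Finset.sum_mul]

@[simp] theorem tau_one (i : ℕ) : tau R i 1 = 0 := by
  cases i <;> simp [tau]

@[simp] theorem tau_zero_ι (v : V) : tau R 0 (𝕚 v) = 0 := by
  simp [tau, lc_ι, lc_algebraMap]

theorem tau_mul_left {a : ℕ} (i : ℕ) {x : 𝕋} (hx : x ∈ deg K V a) (y : 𝕋) :
    tau R (a + i) (x * y) = x * tau R i y := by
  induction a generalizing x with
  | zero =>
    obtain ⟨r, rfl⟩ := mem_deg_zero.1 hx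
    rw [zero_add, ← Algebra.smul_def, ← Algebra.smul_def, map_smul]
  | succ a ih =>
    refine eqOn_deg_succ (φ := tau R (a + 1 + i) ∘ₗ LinearMap.mulRight K y)
      (χ := LinearMap.mulRight K (tau R i y)) (fun v z hz => ?_) hx
    simp only [LinearMap.comp_apply, LinearMap.mulRight_apply, mul_assoc]
    rw [add_right_comm, tau_succ_cons, ih hz]

theorem tau_mul_right {m : ℕ} (i : ℕ) (hi : i + 1 < m) {x : 𝕋} (hx : x ∈ deg K V m) (y : 𝕋) :
    tau R i (x * y) = tau R i x * y := by
  induction i generalizing m x with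
  | zero =>
    obtain ⟨m, rfl⟩ : ∃ m', m = m' + 1 + 1 := ⟨m - 2, by omega⟩
    refine eqOn_deg_succ (φ := tau R 0 ∘ₗ LinearMap.mulRight K y)
      (χ := LinearMap.mulRight K y ∘ₗ tau R 0) (fun v z hz => ?_) hx
    refine eqOn_deg_succ (φ := tau R 0 ∘ₗ LinearMap.mulRight K y ∘ₗ LinearMap.mulLeft K (𝕚 v))
      (χ := LinearMap.mulRight K y ∘ₗ tau R 0 ∘ₗ LinearMap.mulLeft K (𝕚 v))
      (fun w z hz => ?_) hz
    simp [mul_assoc, tau_zero_tmul]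
  | succ i ih =>
    obtain ⟨m, rfl⟩ : ∃ m', m = m' + 1 := ⟨m - 1, by omega⟩
    refine eqOn_deg_succ (φ := tau R (i + 1) ∘ₗ LinearMap.mulRight K y)
      (χ := LinearMap.mulRight K y ∘ₗ tau R (i + 1)) (fun v z hz => ?_) hx
    simp [mul_assoc, tau_succ_cons, ih (by omega) hz]

theorem tau_mem_deg {m : ℕ} (i : ℕ) {x : 𝕋} (hx : x ∈ deg K V m) : tau R i x ∈ deg K V m := by
  induction i generalizing m x with
  | zero =>
    rcases m with _ | _ | m
    · obtain ⟨r, rfl⟩ := mem_deg_zero.1 hx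
      rw [Algebra.algebraMap_eq_smul_one, map_smul, tau_one, smul_zero]
      exact Submodule.zero_mem _
    · obtain ⟨v, rfl⟩ := mem_deg_one.1 hx
      rw [tau_zero_ι]
      exact Submodule.zero_mem _
    · refine mapsTo_deg_succ (m := m + 1) (fun v y hy => ?_) hx
      refine mapsTo_deg_succ (φ := tau R 0 ∘ₗ LinearMap.mulLeft K (𝕚 v)) (fun w y hy => ?_) hy
      simp only [LinearMap.comp_apply, LinearMap.mulLeft_apply, tau_zero_tmul]
      rw [show m + 1 + 1 = 2 + m by omega]
      exact mul_mem_deg (mulTwo_mem_deg _) hy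
  | succ i ih =>
    rcases m with _ | m
    · obtain ⟨r, rfl⟩ := mem_deg_zero.1 hx
      rw [Algebra.algebraMap_eq_smul_one, map_smul, tau_one, smul_zero]
      exact Submodule.zero_mem _
    · refine mapsTo_deg_succ (fun v y hy => ?_) hx
      rw [tau_succ_cons]
      exact cons_mem_deg v (ih hy)

theorem lc_tau (f : Module.Dual K V) (i : ℕ) (x : 𝕋) :
    lc f (tau R (i + 1) x) = tau R i (lc f x) := by
  have : lc f ∘ₗ tau R (i + 1) = tau R i ∘ₗ lc f :=
    ext_cons (by simp) fun v y => by simp [tau_succ_cons]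
  exact LinearMap.congr_fun this x

theorem rc_tau (f : Module.Dual K V) {m : ℕ} (i : ℕ) (hi : i + 1 < m) {x : 𝕋}
    (hx : x ∈ deg K V (m + 1)) : rc f (tau R i x) = tau R i (rc f x) := by
  refine eqOn_deg_succ' (φ := rc f ∘ₗ tau R i) (χ := tau R i ∘ₗ rc f) (fun v y hy => ?_) hx
  simp [tau_mul_right R i hi hy]

/-- The form of the Hecke symmetry axioms for operators on the tensor algebra. -/
structure IsHecke (q : K) (R : V ⊗[K] V →ₗ[K] V ⊗[K] V) : Prop where
  ne_zero : q ≠ 0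
  braid : ∀ x ∈ deg K V 3,
    tau R 0 (tau R 1 (tau R 0 x)) = tau R 1 (tau R 0 (tau R 1 x))
  hecke : ∀ z, R (R z) = (q - 1) • R z + q • z

theorem IsHeckeSymmetry.isHecke {q : K} {R : V ⊗[K] V →ₗ[K] V ⊗[K] V}
    (hR : IsHeckeSymmetry q R) : IsHecke q R where
  ne_zero := hR.ne_zero
  hecke z := by
    have := LinearMap.congr_fun hR.hecke z
    simp only [LinearMap.comp_apply, LinearMap.add_apply, LinearMap.sub_apply,
      LinearMap.smul_apply, LinearMap.id_apply, LinearMap.zero_apply, map_add] at this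
    rw [← sub_eq_zero, ← this]
    module
  braid x hx := by
    set μ : (V ⊗[K] V) ⊗[K] V →ₗ[K] 𝕋 :=
      LinearMap.mul' K 𝕋 ∘ₗ TensorProduct.map (mulTwo K V) 𝕚 with hμ
    have h0 : ∀ z, tau R 0 (μ z) = μ (R.rTensor V z) := fun z => by
      induction z using TensorProduct.induction_on with
      | zero => simp
      | tmul z v => simp [hμ, tau_zero_mulTwo]
      | add x y hx hy => simp only [map_add, hx, hy]
    have h1 : ∀ z, tau R 1 (μ z) = μ (idTensor R z) := fun z => by
      induction z using TensorProduct.induction_on with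
      | zero => simp
      | tmul z c =>
        induction z using TensorProduct.induction_on with
        | zero => simp
        | tmul a b =>
          have := tau_succ_cons R 0 a (𝕚 b * (𝕚 c * 1))
          rw [tau_zero_tmul, mul_one, mul_one] at this
          simpa [hμ, idTensor, mulTwo_assoc, mul_assoc] using this
        | add x y hx hy => simp only [TensorProduct.add_tmul, map_add, hx, hy]
      | add x y hx hy => simp only [map_add, hx, hy]
    -- Surjectivity of `μ` onto degree 3 suffices to transport the braid relation.
    have h3 : deg K V 3 ≤ LinearMap.range μ := by
      refine deg_succ_le (m := 2) fun a y hy => ?_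
      refine deg_succ_le (m := 1) (S := (LinearMap.range μ).comap (LinearMap.mulLeft K (𝕚 a)))
        (fun b y hy => ?_) hy
      obtain ⟨c, rfl⟩ := mem_deg_one.1 hy
      exact ⟨(a ⊗ₜ b) ⊗ₜ c, by simp [hμ, mul_assoc]⟩
    obtain ⟨z, rfl⟩ := h3 hx
    simp only [h0, h1]
    exact congrArg μ (LinearMap.congr_fun hR.braid z)

/-! ### The normalized generators -/

/-- The operator `-q⁻¹ T_(i+1)` on the tensor algebra. -/
def gen (q : K) (R : V ⊗[K] V →ₗ[K] V ⊗[K] V) (i : ℕ) : Module.End K 𝕋 := (-q⁻¹) • tau R i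

variable {R} {q : K}

theorem gen_apply (i : ℕ) (x : 𝕋) : gen q R i x = (-q⁻¹) • tau R i x := rfl

theorem gen_mem_deg {m : ℕ} (i : ℕ) {x : 𝕋} (hx : x ∈ deg K V m) : gen q R i x ∈ deg K V m :=
  Submodule.smul_mem _ _ (tau_mem_deg R i hx)

theorem gen_succ_cons (i : ℕ) (v : V) (y : 𝕋) :
    gen q R (i + 1) (𝕚 v * y) = 𝕚 v * gen q R i y := by
  rw [gen_apply, tau_succ_cons, gen_apply, mul_smul_comm]

theorem gen_mul_left {a : ℕ} (i : ℕ) {x : 𝕋} (hx : x ∈ deg K V a) (y : 𝕋) :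
    gen q R (a + i) (x * y) = x * gen q R i y := by
  rw [gen_apply, tau_mul_left R i hx, gen_apply, mul_smul_comm]

theorem gen_mul_right {m : ℕ} (i : ℕ) (hi : i + 1 < m) {x : 𝕋} (hx : x ∈ deg K V m) (y : 𝕋) :
    gen q R i (x * y) = gen q R i x * y := by
  rw [gen_apply, tau_mul_right R i hi hx, gen_apply, smul_mul_assoc]

theorem lc_gen (f : Module.Dual K V) (i : ℕ) (x : 𝕋) :
    lc f (gen q R (i + 1) x) = gen q R i (lc f x) := by
  rw [gen_apply, map_smul, lc_tau, gen_apply]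

theorem rc_gen (f : Module.Dual K V) {m : ℕ} (i : ℕ) (hi : i + 1 < m) {x : 𝕋}
    (hx : x ∈ deg K V (m + 1)) : rc f (gen q R i x) = gen q R i (rc f x) := by
  rw [gen_apply, map_smul, rc_tau R f i hi hx, gen_apply]

/-- The degree bound cannot be dropped: in lower degrees `tau` vanishes, while the term `q • x` does
not. -/
theorem IsHecke.tau_tau (hR : IsHecke q R) {m : ℕ} (i : ℕ) (hi : i + 1 < m) {x : 𝕋}
    (hx : x ∈ deg K V m) : tau R i (tau R i x) = (q - 1) • tau R i x + q • x := by
  obtain ⟨b, rfl⟩ : ∃ b, m = i + (b + 1 + 1) := ⟨m - (i + 2), by omega⟩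
  refine eqOn_deg_add (φ := tau R i ∘ₗ tau R i) (χ := (q - 1) • tau R i + q • LinearMap.id)
    (fun y hy z hz => ?_) hx
  have hi' := fun w => tau_mul_left R 0 hy w
  rw [add_zero] at hi'
  refine eqOn_deg_succ (φ := (tau R i ∘ₗ tau R i) ∘ₗ LinearMap.mulLeft K y)
    (χ := ((q - 1) • tau R i + q • LinearMap.id) ∘ₗ LinearMap.mulLeft K y)
    (fun v w hw => ?_) hz
  refine eqOn_deg_succ
    (φ := (tau R i ∘ₗ tau R i) ∘ₗ LinearMap.mulLeft K y ∘ₗ LinearMap.mulLeft K (𝕚 v))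
    (χ := ((q - 1) • tau R i + q • LinearMap.id) ∘ₗ LinearMap.mulLeft K y ∘ₗ
      LinearMap.mulLeft K (𝕚 v))
    (fun w u hu => ?_) hw
  simp only [LinearMap.comp_apply, LinearMap.mulLeft_apply, hi', tau_zero_tmul, tau_zero_mulTwo,
    hR.hecke, LinearMap.add_apply, LinearMap.smul_apply, LinearMap.id_apply, map_add, map_smul,
    mulTwo_tmul, add_mul, mul_add, smul_mul_assoc, mul_smul_comm, mul_assoc]

theorem IsHecke.gen_gen (hR : IsHecke q R) {m : ℕ} (i : ℕ) (hi : i + 1 < m) {x : 𝕋}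
    (hx : x ∈ deg K V m) :
    gen q R i (gen q R i x) = (q⁻¹ - 1) • gen q R i x + q⁻¹ • x := by
  have hq := hR.ne_zero
  simp only [gen_apply, map_smul, hR.tau_tau i hi hx, smul_add, smul_smul]
  congr 2 <;> field_simp
  ring

/-- Unlike the quadratic relation, the braid relations hold in all degrees, because both sides
vanish when there are too few factors. Above that, only the first factors matter, and an increase of
the index amounts to peeling off a first factor. -/
theorem IsHecke.braided (hR : IsHecke q R) : Braided (gen q R) := by
  constructor
  · intro i
    suffices h : tau R i * tau R (i + 1) * tau R i = tau R (i + 1) * tau R i * tau R (i + 1) by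
      simp only [gen, smul_mul_smul_comm, h]
    induction i with
    | zero =>
      refine ext_cons (by simp) fun u y => ?_
      refine LinearMap.congr_fun (f := (tau R 0 * tau R 1 * tau R 0) ∘ₗ LinearMap.mulLeft K (𝕚 u))
        (g := (tau R 1 * tau R 0 * tau R 1) ∘ₗ LinearMap.mulLeft K (𝕚 u)) ?_ y
      refine ext_cons ?_ fun v y => ?_
      · simp [show tau R 1 (𝕚 u) = 0 by simpa using tau_succ_cons R 0 u 1]
      refine LinearMap.congr_fun (f := (tau R 0 * tau R 1 * tau R 0) ∘ₗ
          LinearMap.mulLeft K (𝕚 u) ∘ₗ LinearMap.mulLeft K (𝕚 v))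
        (g := (tau R 1 * tau R 0 * tau R 1) ∘ₗ
          LinearMap.mulLeft K (𝕚 u) ∘ₗ LinearMap.mulLeft K (𝕚 v)) ?_ y
      refine ext_cons ?_ fun w y => ?_
      · have h2 : ∀ z : V ⊗[K] V, tau R 1 (mulTwo K V z) = 0 := fun z => by
          induction z using TensorProduct.induction_on with
          | zero => simp
          | tmul v w => simpa using tau_succ_cons R 0 v (𝕚 w)
          | add x y hx hy => simp [hx, hy]
        have h3 := h2 (u ⊗ₜ v)
        have h4 := tau_zero_tmul R u v 1
        rw [mulTwo_tmul] at h3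
        rw [mul_one, mul_one] at h4
        simp [h3, h4, h2]
      have h3 : 𝕚 u * (𝕚 v * 𝕚 w) ∈ deg K V 3 :=
        cons_mem_deg u (cons_mem_deg v (ι_mem_deg w))
      have e0 : ∀ x ∈ deg K V 3, tau R 0 (x * y) = tau R 0 x * y := fun x hx =>
        tau_mul_right R 0 (by omega) hx y
      have e1 : ∀ x ∈ deg K V 3, tau R 1 (x * y) = tau R 1 x * y := fun x hx =>
        tau_mul_right R 1 (by omega) hx y
      have d0 : ∀ x ∈ deg K V 3, tau R 0 x ∈ deg K V 3 := fun x hx => tau_mem_deg R 0 hx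
      have d1 : ∀ x ∈ deg K V 3, tau R 1 x ∈ deg K V 3 := fun x hx => tau_mem_deg R 1 hx
      simp only [LinearMap.comp_apply, LinearMap.mulLeft_apply, Module.End.mul_apply]
      rw [show 𝕚 u * (𝕚 v * (𝕚 w * y)) = 𝕚 u * (𝕚 v * 𝕚 w) * y by simp only [mul_assoc],
        e0 _ h3, e1 _ (d0 _ h3), e0 _ (d1 _ (d0 _ h3)), e1 _ h3, e0 _ (d1 _ h3),
        e1 _ (d0 _ (d1 _ h3)), hR.braid _ h3]
    | succ i ih =>
      refine ext_cons (by simp) fun v y => ?_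
      have := LinearMap.congr_fun ih y
      simp only [Module.End.mul_apply] at this
      simp only [Module.End.mul_apply, tau_succ_cons, this]
  · intro i j hij
    suffices h : Commute (tau R i) (tau R j) from (h.smul_left _).smul_right _
    obtain ⟨j, rfl⟩ := Nat.exists_eq_add_of_le' hij
    induction i with
    | zero =>
      refine ext_cons (by simp) fun u y => ?_
      refine LinearMap.congr_fun (f := (tau R 0 * tau R (j + 2)) ∘ₗ LinearMap.mulLeft K (𝕚 u))
        (g := (tau R (j + 2) * tau R 0) ∘ₗ LinearMap.mulLeft K (𝕚 u)) ?_ y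
      refine ext_cons ?_ fun v y => ?_
      · simp [show tau R (j + 2) (𝕚 u) = 0 by simpa using tau_succ_cons R (j + 1) u 1]
      have h := fun z => tau_mul_left R j (mulTwo_mem_deg (K := K) (V := V) z) y
      simp only [add_comm 2 j] at h
      simp [tau_succ_cons, tau_zero_tmul, h]
    | succ i ih =>
      refine ext_cons (by simp) fun v y => ?_
      have := LinearMap.congr_fun (ih (by omega)).eq y
      simp only [Module.End.mul_apply] at this
      simp only [Module.End.mul_apply, show j + (i + 1 + 2) = j + (i + 2) + 1 by omega,
        tau_succ_cons, this]

end Operators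

/-! ### The spaces Υ, the action of shuffles on them, and moving a block past Υ^(n). -/

section Segments

variable {K V : Type*} [Field K] [AddCommGroup V] [Module K V] [FiniteDimensional K V]

local notation "𝕋" => TensorAlgebra K V
local notation "𝕚" => TensorAlgebra.ι K
local notation "𝔢" => Module.finBasis K V

variable {q : K} {R : V ⊗[K] V →ₗ[K] V ⊗[K] V}

/-- The image of the component of degree `m` under the operator `1 + gen i`, which is
proportional to `T_(i+1) - q`. -/
def img (q : K) (R : V ⊗[K] V →ₗ[K] V ⊗[K] V) (m i : ℕ) : Submodule K 𝕋 :=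
  (deg K V m).map (1 + gen q R i)

theorem mem_img {m i : ℕ} {x : 𝕋} : x ∈ img q R m i ↔ ∃ z ∈ deg K V m, z + gen q R i z = x := by
  simp [img]

/-- The basic tool for membership in Υ: intertwiners carry images to images. Images of 1 + g, rather
than eigenspaces of g, are used throughout, since for q = -1 the two may differ. -/
theorem map_mem_img {g : 𝕋 →ₗ[K] 𝕋} {m m' i j : ℕ} (hg : ∀ x ∈ deg K V m, g x ∈ deg K V m')
    (hc : ∀ x ∈ deg K V m, g (gen q R i x) = gen q R j (g x)) {x : 𝕋} (hx : x ∈ img q R m i) :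
    g x ∈ img q R m' j := by
  obtain ⟨z, hz, rfl⟩ := mem_img.1 hx
  exact mem_img.2 ⟨g z, hg z hz, by rw [map_add, hc z hz]⟩

theorem IsHecke.gen_of_mem_img (hR : IsHecke q R) {m i : ℕ} (hi : i + 1 < m) {x : 𝕋}
    (hx : x ∈ img q R m i) : gen q R i x = q⁻¹ • x := by
  obtain ⟨z, hz, rfl⟩ := mem_img.1 hx
  rw [map_add, hR.gen_gen i hi hz]
  module

/-- The tensors of degree `m` which lie in the images of `T_(i+1) - q` for all pairs of adjacent
positions `i`, `i + 1` in the segment `s, ..., s + k - 1`. -/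
def seg (q : K) (R : V ⊗[K] V →ₗ[K] V ⊗[K] V) (m s k : ℕ) : Submodule K 𝕋 :=
  deg K V m ⊓ ⨅ (i : ℕ) (_ : s ≤ i ∧ i + 1 < s + k), img q R m i

theorem mem_seg {m s k : ℕ} {x : 𝕋} :
    x ∈ seg q R m s k ↔ x ∈ deg K V m ∧ ∀ i, s ≤ i → i + 1 < s + k → x ∈ img q R m i := by
  simp [seg, Submodule.mem_iInf]

/-- The image of `Υ^(m)` in the tensor algebra. -/
def ups (q : K) (R : V ⊗[K] V →ₗ[K] V ⊗[K] V) (m : ℕ) : Submodule K 𝕋 := seg q R m 0 m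

theorem mem_ups {m : ℕ} {x : 𝕋} :
    x ∈ ups q R m ↔ x ∈ deg K V m ∧ ∀ i, i + 1 < m → x ∈ img q R m i := by
  simp [ups, mem_seg]

theorem ups_le_deg (m : ℕ) : ups q R m ≤ deg K V m := fun _ hx => (mem_ups.1 hx).1

theorem seg_mono {m s k s' k' : ℕ} (hs : s' ≤ s) (hk : s + k ≤ s' + k') :
    seg q R m s' k' ≤ seg q R m s k := fun x hx => by
  rw [mem_seg] at hx ⊢
  exact ⟨hx.1, fun i hi hi' => hx.2 i (by omega) (by omega)⟩

theorem map_mem_seg {g : 𝕋 →ₗ[K] 𝕋} {m m' s s' k : ℕ} (hg : ∀ x ∈ deg K V m, g x ∈ deg K V m')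
    (hc : ∀ i, i + 1 < k → ∀ x ∈ deg K V m, g (gen q R (s + i) x) = gen q R (s' + i) (g x))
    {x : 𝕋} (hx : x ∈ seg q R m s k) : g x ∈ seg q R m' s' k := by
  rw [mem_seg] at hx ⊢
  refine ⟨hg x hx.1, fun i hi hi' => ?_⟩
  obtain ⟨i, rfl⟩ := Nat.exists_eq_add_of_le hi
  exact map_mem_img hg (hc i (by omega)) (hx.2 _ (by omega) (by omega))

theorem lc_mem_seg (f : Module.Dual K V) {m s k : ℕ} {x : 𝕋}
    (hx : x ∈ seg q R (m + 1) (s + 1) k) : lc f x ∈ seg q R m s k :=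
  map_mem_seg (g := lc f) (fun _ => lc_mem_deg f)
    (fun i _ y _ => by rw [add_right_comm, lc_gen]) hx

theorem rc_mem_seg (f : Module.Dual K V) {m s k : ℕ} (hk : s + k ≤ m) {x : 𝕋}
    (hx : x ∈ seg q R (m + 1) s k) : rc f x ∈ seg q R m s k :=
  map_mem_seg (g := rc f) (fun _ => rc_mem_deg f)
    (fun i hi _ hy => by rw [rc_gen f _ (by omega) hy]) hx

theorem mul_mem_seg_left {a b k : ℕ} (hk : k ≤ a) {x y : 𝕋} (hx : x ∈ seg q R a 0 k)
    (hy : y ∈ deg K V b) : x * y ∈ seg q R (a + b) 0 k :=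
  map_mem_seg (g := LinearMap.mulRight K y) (fun _ hx => mul_mem_deg hx hy)
    (fun i hi x hx => by simp [gen_mul_right i (by omega) hx y]) hx

theorem mul_mem_seg_right {a b s k : ℕ} {x y : 𝕋} (hx : x ∈ deg K V a)
    (hy : y ∈ seg q R b s k) : x * y ∈ seg q R (a + b) (a + s) k :=
  map_mem_seg (g := LinearMap.mulLeft K x) (fun _ hy => mul_mem_deg hx hy)
    (fun i hi y hy => by simp [add_assoc, gen_mul_left _ hx y]) hy

theorem lc_mem_ups (f : Module.Dual K V) {m : ℕ} {x : 𝕋} (hx : x ∈ ups q R (m + 1)) :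
    lc f x ∈ ups q R m :=
  lc_mem_seg f (seg_mono (by omega) (by omega) hx)

theorem rc_mem_ups (f : Module.Dual K V) {m : ℕ} {x : 𝕋} (hx : x ∈ ups q R (m + 1)) :
    rc f x ∈ ups q R m :=
  rc_mem_seg f (by omega) (seg_mono (by omega) (by omega) hx)

/-- Right contractions remove the `b` factors outside the segment and leave an element of Υ^(r). -/
theorem seg_eq_bot_of_ups_eq_bot {r : ℕ} (h : ups q R r = ⊥) (b : ℕ) :
    seg q R (r + b) 0 r = ⊥ := by
  induction b with
  | zero => exact h
  | succ b ih =>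
    rw [eq_bot_iff]
    intro x hx
    refine eq_zero_of_rc (m := r + b) (mem_seg.1 hx).1 fun f => ?_
    have := rc_mem_seg f (m := r + b) (by omega) hx
    rwa [ih] at this

/-! ### Action of shuffles -/

theorem moveRight_mem_deg {m : ℕ} (s j : ℕ) {x : 𝕋} (hx : x ∈ deg K V m) :
    moveRight (gen q R) s j x ∈ deg K V m :=
  moveRight_induction (fun g : Module.End K 𝕋 => ∀ x ∈ deg K V m, g x ∈ deg K V m)
    (fun _ hx => hx) (fun _ _ ha hb x hx => ha _ (hb x hx)) s j
    (fun i _ _ _ hx => gen_mem_deg i hx) x hx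

theorem shuffleSum_mem_deg {m : ℕ} (s k l : ℕ) {x : 𝕋} (hx : x ∈ deg K V m) :
    shuffleSum (gen q R) s k l x ∈ deg K V m :=
  shuffleSum_induction (fun g : Module.End K 𝕋 => ∀ x ∈ deg K V m, g x ∈ deg K V m)
    (fun _ hx => hx) (fun _ _ ha hb x hx => ha _ (hb x hx))
    (fun _ _ ha hb x hx => Submodule.add_mem _ (ha x hx) (hb x hx)) s k l
    (fun i _ _ _ hx => gen_mem_deg i hx) x hx

theorem moveRight_mul_right {m : ℕ} (s j : ℕ) (h : s + j < m) {x : 𝕋} (hx : x ∈ deg K V m)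
    (y : 𝕋) : moveRight (gen q R) s j (x * y) = moveRight (gen q R) s j x * y :=
  (moveRight_induction (fun g : Module.End K 𝕋 => ∀ x ∈ deg K V m, g x ∈ deg K V m ∧
      g (x * y) = g x * y)
    (fun _ hx => ⟨hx, rfl⟩) (fun a b ha hb x hx => ⟨(ha _ (hb x hx).1).1, by
      rw [Module.End.mul_apply, (hb x hx).2, (ha _ (hb x hx).1).2, Module.End.mul_apply]⟩) s j
    (fun i _ _ _ hx => ⟨gen_mem_deg i hx, gen_mul_right i (by omega) hx y⟩) x hx).2

theorem shuffleSum_mul_right {m : ℕ} (s k l : ℕ) (h : s + k + l ≤ m) {x : 𝕋}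
    (hx : x ∈ deg K V m) (y : 𝕋) :
    shuffleSum (gen q R) s k l (x * y) = shuffleSum (gen q R) s k l x * y :=
  (shuffleSum_induction (fun g : Module.End K 𝕋 => ∀ x ∈ deg K V m, g x ∈ deg K V m ∧
      g (x * y) = g x * y)
    (fun _ hx => ⟨hx, rfl⟩) (fun a b ha hb x hx => ⟨(ha _ (hb x hx).1).1, by
      rw [Module.End.mul_apply, (hb x hx).2, (ha _ (hb x hx).1).2, Module.End.mul_apply]⟩)
    (fun a b ha hb x hx => ⟨Submodule.add_mem _ (ha x hx).1 (hb x hx).1, by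
      rw [LinearMap.add_apply, (ha x hx).2, (hb x hx).2, LinearMap.add_apply, add_mul]⟩) s k l
    (fun i _ _ _ hx => ⟨gen_mem_deg i hx, gen_mul_right i (by omega) hx y⟩) x hx).2

theorem moveRight_succ_cons (s j : ℕ) (v : V) (x : 𝕋) :
    moveRight (gen q R) (s + 1) j (𝕚 v * x) = 𝕚 v * moveRight (gen q R) s j x := by
  induction j with
  | zero => simp
  | succ j ih =>
    rw [moveRight_succ, moveRight_succ, Module.End.mul_apply, ih, add_right_comm, gen_succ_cons,
      Module.End.mul_apply]

theorem shuffleSum_succ_cons (s k l : ℕ) (v : V) (x : 𝕋) :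
    shuffleSum (gen q R) (s + 1) k l (𝕚 v * x) = 𝕚 v * shuffleSum (gen q R) s k l x := by
  induction hm : k + l using Nat.strong_induction_on generalizing k l x with
  | _ m ih =>
    rcases k with _ | k
    · simp
    rcases l with _ | l
    · simp
    rw [shuffleSum_succ_succ, shuffleSum_succ_succ, LinearMap.add_apply, LinearMap.add_apply,
      ih _ (by omega) _ _ _ rfl, Module.End.mul_apply, add_right_comm s 1 k, moveRight_succ_cons,
      ih _ (by omega) _ _ _ rfl, Module.End.mul_apply, mul_add]

theorem end_apply_of_commute {M : Type*} [AddCommGroup M] [Module K M] {A B : Module.End K M}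
    (h : Commute A B) (x : M) :
    A (B x) = B (A x) := LinearMap.congr_fun h.eq x

/-- Shuffles map `Υ^(k) ⊗ Υ^(l)` to `Υ^(k+l)`. -/
theorem IsHecke.shuffleSum_mem_seg (hR : IsHecke q R) {m s k l : ℕ} (h : s + k + l ≤ m)
    {x : 𝕋} (hx : x ∈ seg q R m s k) (hx' : x ∈ seg q R m (s + k) l) :
    shuffleSum (gen q R) s k l x ∈ seg q R m s (k + l) := by
  have hb := hR.braided
  induction hn : k + l using Nat.strong_induction_on generalizing k l x with
  | _ n ih =>
    subst hn
    rcases k with _ | k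
    · simpa using hx'
    rcases l with _ | l
    · simpa using hx
    -- The last factor of the first block is carried to the end; `y` then consists of blocks of
    -- lengths `k` and `l + 1` followed by that factor.
    set y := moveRight (gen q R) (s + k) (l + 1) x with hy
    have hxd : x ∈ deg K V m := (mem_seg.1 hx).1
    have hy1 : y ∈ seg q R m s k :=
      map_mem_seg (g := moveRight (gen q R) (s + k) (l + 1)) (fun _ => moveRight_mem_deg _ _)
        (fun i hi z _ => (end_apply_of_commute (Commute.moveRight_right _ _
          fun j hj _ => hb.comm' _ _ (by omega)) z).symm)
        (seg_mono (k := k) le_rfl (by omega) hx)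
    have hy2 : y ∈ seg q R m (s + k) (l + 1) :=
      map_mem_seg (g := moveRight (gen q R) (s + k) (l + 1)) (fun _ => moveRight_mem_deg _ _)
        (fun i hi z _ => by
          have := hb.moveRight_mul_gen (s + k) (l + 1) (s + k + i) (by omega) (by omega)
          rw [show s + (k + 1) + i = s + k + i + 1 by omega]
          exact LinearMap.congr_fun this z) hx'
    have e : shuffleSum (gen q R) s (k + 1) (l + 1) x =
        shuffleSum (gen q R) s (k + 1) l x + shuffleSum (gen q R) s k (l + 1) y := by
      rw [shuffleSum_succ_succ]; rfl
    have m1 := ih _ (by omega) (by omega) hx (seg_mono (k := l) le_rfl (by omega) hx') rfl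
    have m2 := ih _ (by omega) (by omega) hy1 hy2 rfl
    refine mem_seg.2 ⟨shuffleSum_mem_deg _ _ _ hxd, fun i hi hi' => ?_⟩
    rcases Nat.lt_or_ge i (s + k + l) with hlt | hge
    · rw [e]
      exact Submodule.add_mem _ ((mem_seg.1 m1).2 i hi (by omega))
        ((mem_seg.1 m2).2 i hi (by omega))
    -- Induction settles all pairs of positions but the last one. There the shuffles are sorted by
    -- the blocks that occupy the last two places: if both come from the same block, the terms `w`
    -- lie in the image; the two mixed cases differ by the generator `N` and pair up to the image of
    -- 1 + g.
    obtain rfl : i = s + k + l := by omega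
    set N := s + k + l with hN
    have hA1 : ∃ w ∈ img q R m N, shuffleSum (gen q R) s (k + 1) l x =
        w + shuffleSum (gen q R) s k l (moveRight (gen q R) (s + k) l x) := by
      rcases l with _ | l
      · exact ⟨0, Submodule.zero_mem _, by simp⟩
      · refine ⟨shuffleSum (gen q R) s (k + 1) l x, ?_, by rw [shuffleSum_succ_succ]; rfl⟩
        exact map_mem_img (g := shuffleSum (gen q R) s (k + 1) l)
          (fun _ => shuffleSum_mem_deg _ _ _)
          (fun z _ => (end_apply_of_commute (Commute.shuffleSum_right _ _ _
            fun j _ hj => hb.comm' _ _ (by omega)) z).symm)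
          ((mem_seg.1 hx').2 _ (by omega) (by omega))
    have hA2 : ∃ w ∈ img q R m N, shuffleSum (gen q R) s k (l + 1) y =
        w + shuffleSum (gen q R) s k l y := by
      rcases k with _ | k
      · exact ⟨0, Submodule.zero_mem _, by simp⟩
      · refine ⟨shuffleSum (gen q R) s k (l + 1) (moveRight (gen q R) (s + k) (l + 1) y), ?_, by
          rw [shuffleSum_succ_succ, add_comm]; rfl⟩
        -- Both last factors of the first block travel to the end together, which carries the
        -- generator at `s + k` to the one at `N`.
        refine map_mem_img (g := shuffleSum (gen q R) s k (l + 1) *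
            (moveRight (gen q R) (s + k) (l + 1) * moveRight (gen q R) (s + k + 1) (l + 1)))
          (i := s + k) (fun _ h => by
            simp only [Module.End.mul_apply]
            exact shuffleSum_mem_deg _ _ _ (moveRight_mem_deg _ _ (moveRight_mem_deg _ _ h)))
          (fun z _ => ?_)
          ((mem_seg.1 hx).2 _ (by omega) (by omega))
        have h1 := hb.moveRight_mul_moveRight_mul_gen (s + k) (l + 1)
        have h2 : Commute (gen q R (s + k + (l + 1))) (shuffleSum (gen q R) s k (l + 1)) :=
          Commute.shuffleSum_right _ _ _ fun j _ hj => hb.comm' _ _ (by omega)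
        rw [show N = s + k + (l + 1) by omega, ← Module.End.mul_apply, mul_assoc, h1,
          ← mul_assoc, ← h2.eq, mul_assoc, Module.End.mul_apply]
    obtain ⟨w1, hw1, e1⟩ := hA1
    obtain ⟨w2, hw2, e2⟩ := hA2
    have hcomm : Commute (gen q R N) (shuffleSum (gen q R) s k l) :=
      Commute.shuffleSum_right _ _ _ fun j _ hj => hb.comm' _ _ (by omega)
    have hw3 : shuffleSum (gen q R) s k l (moveRight (gen q R) (s + k) l x) +
        shuffleSum (gen q R) s k l y ∈ img q R m N := by
      refine mem_img.2 ⟨shuffleSum (gen q R) s k l (moveRight (gen q R) (s + k) l x),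
        shuffleSum_mem_deg _ _ _ (moveRight_mem_deg _ _ hxd), ?_⟩
      rw [end_apply_of_commute hcomm, hy, moveRight_succ, Module.End.mul_apply]
    rw [e, e1, e2, show ∀ a b c d : 𝕋, a + b + (c + d) = a + c + (b + d) from
      fun a b c d => by abel]
    exact Submodule.add_mem _ (Submodule.add_mem _ hw1 hw2) hw3

/-- The sum of `p ^ length` over all `(k, l)`-shuffles. -/
def shuffleCount (p : K) : ℕ → ℕ → K
  | 0, _ => 1
  | _ + 1, 0 => 1
  | k + 1, l + 1 => shuffleCount p (k + 1) l + p ^ (l + 1) * shuffleCount p k (l + 1)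
  termination_by k l => k + l

@[simp] theorem shuffleCount_zero_left (p : K) (l : ℕ) : shuffleCount p 0 l = 1 := by
  simp [shuffleCount]

@[simp] theorem shuffleCount_zero_right (p : K) (k : ℕ) : shuffleCount p k 0 = 1 := by
  cases k <;> simp [shuffleCount]

theorem shuffleCount_succ_succ (p : K) (k l : ℕ) :
    shuffleCount p (k + 1) (l + 1) =
      shuffleCount p (k + 1) l + p ^ (l + 1) * shuffleCount p k (l + 1) := by
  rw [shuffleCount]

theorem IsHecke.gen_of_mem_seg (hR : IsHecke q R) {m s k i : ℕ} (h : s + k ≤ m) {x : 𝕋}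
    (hx : x ∈ seg q R m s k) (hs : s ≤ i) (hi : i + 1 < s + k) :
    gen q R i x = q⁻¹ • x :=
  hR.gen_of_mem_img (by omega) ((mem_seg.1 hx).2 i hs hi)

theorem moveRight_of_eigen {x : 𝕋} {p : K} {s j : ℕ}
    (h : ∀ i, s ≤ i → i < s + j → gen q R i x = p • x) :
    moveRight (gen q R) s j x = p ^ j • x := by
  induction j with
  | zero => simp
  | succ j ih =>
    rw [moveRight_succ, Module.End.mul_apply, ih fun i hi hi' => h i hi (by omega), map_smul,
      h _ (by omega) (by omega), smul_smul, pow_succ]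

/-- Each generator acts by q⁻¹, so a shuffle acts by q⁻¹ to the power of its length. -/
theorem IsHecke.shuffleSum_of_mem_seg (hR : IsHecke q R) {m s k l : ℕ} (h : s + (k + l) ≤ m)
    {x : 𝕋} (hx : x ∈ seg q R m s (k + l)) :
    shuffleSum (gen q R) s k l x = shuffleCount q⁻¹ k l • x := by
  induction hn : k + l using Nat.strong_induction_on generalizing k l with
  | _ n ih =>
    rcases k with _ | k
    · simp
    rcases l with _ | l
    · simp
    rw [shuffleSum_succ_succ, shuffleCount_succ_succ, LinearMap.add_apply, Module.End.mul_apply,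
      moveRight_of_eigen fun i hi hi' => hR.gen_of_mem_seg h hx (by omega) (by omega), map_smul,
      ih _ (by omega) (by omega) (seg_mono le_rfl (by omega) hx) rfl,
      ih _ (by omega) (by omega) (seg_mono le_rfl (by omega) hx) rfl, smul_smul, add_smul]

/-- The product of operators which moves a block of `k` factors past a block of `n` factors. -/
def moveBlock (q : K) (R : V ⊗[K] V →ₗ[K] V ⊗[K] V) (n : ℕ) : ℕ → ℕ → Module.End K 𝕋
  | _, 0 => 1
  | s, k + 1 => moveRight (gen q R) s n * moveBlock q R n (s + 1) k

theorem moveBlock_succ_cons (n s k : ℕ) (v : V) (x : 𝕋) :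
    moveBlock q R n (s + 1) k (𝕚 v * x) = 𝕚 v * moveBlock q R n s k x := by
  induction k generalizing s x with
  | zero => simp [moveBlock]
  | succ k ih =>
    rw [moveBlock, moveBlock, Module.End.mul_apply, ih, moveRight_succ_cons,
      Module.End.mul_apply]

/-- The sign and the power of `q⁻¹` by which the antipode acts. -/
def blockCoeff (p : K) : ℕ → K
  | 0 => 1
  | k + 1 => -(blockCoeff p k * p ^ k)

/-- If `Υ^(n+1) = 0` then moving a factor in `Υ^(k)` past a factor in `Υ^(n)` is proportional
to the action of shuffles on the first `n` positions. -/
theorem IsHecke.moveBlock_eq_shuffleSum (hR : IsHecke q R) {n : ℕ} (hv : ups q R (n + 1) = ⊥)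
    {k l : ℕ} (hk : k + l = n) {x : 𝕋} (hx : x ∈ seg q R (n + k) 0 k)
    (hx' : x ∈ seg q R (n + k) k n) :
    moveBlock q R n 0 k x = blockCoeff q⁻¹ k • shuffleSum (gen q R) 0 k l x := by
  have hb := hR.braided
  induction k generalizing l x with
  | zero => simp [moveBlock, blockCoeff]
  | succ k ih =>
    -- The source of all cancellations: a tensor of type Υ^(n+1) on its first n + 1 places is zero.
    have hvan : ∀ z ∈ seg q R (n + (k + 1)) 0 (n + 1), z = 0 := fun z hz => by
      have := seg_eq_bot_of_ups_eq_bot hv k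
      rw [show n + 1 + k = n + (k + 1) by omega] at this
      rwa [this] at hz
    have hxd : x ∈ deg K V (n + k + 1) := (mem_seg.1 hx).1
    have step1 : moveBlock q R n 1 k x =
        blockCoeff q⁻¹ k • shuffleSum (gen q R) 1 k (l + 1) x := by
      conv_lhs => rw [← expand_cons hxd]
      conv_rhs => rw [← expand_cons hxd]
      rw [map_sum, map_sum, Finset.smul_sum]
      refine Finset.sum_congr rfl fun a _ => ?_
      rw [show (1 : ℕ) = 0 + 1 from rfl, moveBlock_succ_cons, shuffleSum_succ_cons,
        ih (l := l + 1) (by omega) (lc_mem_seg _ (seg_mono (by omega) (by omega) hx))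
          (lc_mem_seg _ hx'), mul_smul_comm]
    set z := shuffleSum (gen q R) 1 k (l + 1) x with hz
    have hzs : z ∈ seg q R (n + (k + 1)) 1 n := by
      have := hR.shuffleSum_mem_seg (m := n + (k + 1)) (s := 1) (k := k) (l := l + 1) (by omega)
        (seg_mono (by omega) (by omega) hx) (seg_mono (by omega) (by omega) hx')
      rwa [show k + (l + 1) = n by omega] at this
    have hzd : z ∈ deg K V (n + (k + 1)) := (mem_seg.1 hzs).1
    -- The (1, n)-shuffle sum of `z` vanishes by `hvan`; its longest term is the full move, so this
    -- equals minus the rest.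
    have step2 : moveRight (gen q R) 0 n z = -shuffleSum (gen q R) 0 1 (k + l) z := by
      have h1 := hvan _ (by
        have := hR.shuffleSum_mem_seg (m := n + (k + 1)) (s := 0) (k := 1) (l := n) (by omega)
          (mem_seg.2 ⟨hzd, fun i _ hi => absurd hi (by omega)⟩) (by simpa using hzs)
        rwa [add_comm 1 n] at this)
      obtain rfl : n = k + l + 1 := by omega
      rw [shuffleSum_one_succ, LinearMap.add_apply] at h1
      exact eq_neg_of_add_eq_zero_right h1
    -- Expand `z` by the recursion and apply associativity to both terms. The vanishing shuffle sum
    -- `hzero` makes them opposite up to the scalars 1 + p + ⋯ + p^k and 1 + p + ⋯ + p^(k-1), where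
    -- p = q⁻¹; only the difference p^k survives.
    have step3 : shuffleSum (gen q R) 0 1 (k + l) z =
        (q⁻¹) ^ k • shuffleSum (gen q R) 0 (k + 1) l x := by
      rcases k with _ | k
      · simp [hz]
      have hassoc1 := LinearMap.congr_fun (hb.shuffleSum_assoc 0 (k + 1) l) x
      have hassoc2 := LinearMap.congr_fun (hb.shuffleSum_assoc 0 k (l + 1))
        (moveRight (gen q R) (k + 1) (l + 1) x)
      have hcomm : Commute (shuffleSum (gen q R) 0 1 k)
          (moveRight (gen q R) (k + 1) (l + 1)) :=
        Commute.moveRight_right _ _ fun i hi _ =>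
          (Commute.shuffleSum_right _ _ _ fun j _ hj => hb.comm' _ _ (by omega)).symm
      have hzero := hvan _ (by
        have := hR.shuffleSum_mem_seg (m := n + (k + 1 + 1)) (s := 0) (k := k + 1 + 1)
          (l := l + 1) (by omega) hx (seg_mono (by omega) (by omega) hx')
        rwa [show k + 1 + 1 + (l + 1) = n + 1 by omega] at this)
      have s1 := hR.shuffleSum_of_mem_seg (m := n + (k + 1 + 1)) (s := 0) (k := 1) (l := k + 1)
        (by omega) (seg_mono (by omega) (by omega) hx)
      have s2 := hR.shuffleSum_of_mem_seg (m := n + (k + 1 + 1)) (s := 0) (k := 1) (l := k)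
        (by omega) (seg_mono (by omega) (by omega) hx)
      have hzexp : z = shuffleSum (gen q R) (0 + 1) (k + 1) l x +
          shuffleSum (gen q R) (0 + 1) k (l + 1) (moveRight (gen q R) (k + 1) (l + 1) x) := by
        rw [hz, shuffleSum_succ_succ, LinearMap.add_apply, Module.End.mul_apply, add_comm 1 k]
      rw [shuffleSum_succ_succ, LinearMap.add_apply, Module.End.mul_apply, zero_add] at hzero
      simp only [Module.End.mul_apply] at hassoc1 hassoc2
      rw [hzexp, map_add, hassoc1, show k + 1 + l = k + (l + 1) by omega, hassoc2,
        end_apply_of_commute hcomm, s1, s2, map_smul, map_smul, map_smul,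
        eq_neg_of_add_eq_zero_right hzero, shuffleCount_succ_succ, shuffleCount_zero_left]
      module
    rw [moveBlock, Module.End.mul_apply, zero_add, step1, map_smul, step2, step3, blockCoeff,
      neg_smul, mul_smul, smul_neg]

/-- The factors of `u` cross `t` one after another, beginning with the last, and each is changed by
`χ`. -/
theorem moveBlock_mul {n k : ℕ} {t : 𝕋} (ht : t ∈ deg K V n) {χ : V →ₗ[K] V}
    (hχ : ∀ v, moveRight (gen q R) 0 n (𝕚 v * t) = t * 𝕚 (χ v)) {u : 𝕋} (hu : u ∈ deg K V k) :
    moveBlock q R n 0 k (u * t) = t * mapT χ u := by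
  induction k generalizing u with
  | zero =>
    obtain ⟨r, rfl⟩ := mem_deg_zero.1 hu
    simp [moveBlock, Algebra.commutes]
  | succ k ih =>
    refine eqOn_deg_succ (φ := moveBlock q R n 0 (k + 1) ∘ₗ LinearMap.mulRight K t)
      (χ := LinearMap.mulLeft K t ∘ₗ (mapT χ).toLinearMap) (fun v y hy => ?_) hu
    simp only [LinearMap.comp_apply, LinearMap.mulRight_apply, LinearMap.mulLeft_apply,
      AlgHom.toLinearMap_apply, map_mul, mapT_ι, moveBlock, Module.End.mul_apply, mul_assoc]
    rw [moveBlock_succ_cons, ih hy, ← mul_assoc,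
      moveRight_mul_right 0 n (by omega) (cons_mem_deg v ht), hχ, mul_assoc]

end Segments

/-! ### Evaluation of the scalars. -/

section Arithmetic

variable {K : Type*} [Field K]

theorem qBinom_eq_zero (q : K) (n j : ℕ) : qBinom q n (n + j + 1) = 0 := by
  induction n generalizing j with
  | zero => simp [qBinom]
  | succ n ih =>
    rw [qBinom, show n + 1 + j = n + (j + 1) by omega, ih (j + 1),
      show n + j.succ = n + j + 1 by omega, ih j]
    simp

@[simp] theorem qBinom_zero_right (q : K) (n : ℕ) : qBinom q n 0 = 1 := by
  cases n <;> simp [qBinom]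

@[simp] theorem qBinom_self (q : K) (n : ℕ) : qBinom q n n = 1 := by
  induction n with
  | zero => simp
  | succ n ih => rw [qBinom, ih, qBinom_eq_zero q n 0, mul_zero, add_zero]

theorem qBinom_one_right (q : K) (n : ℕ) : qBinom q n 1 = qInt q n := by
  induction n with
  | zero => simp [qBinom, qInt]
  | succ n ih =>
    rw [qBinom, zero_add, ih, qBinom_zero_right, qInt, qInt, Finset.sum_range_succ',
      Finset.mul_sum]
    simp [pow_succ', add_comm]

/-- The longest (k,l)-shuffle has length kl, so the factor q^(kl) replaces negative exponents by
complementary lengths, and the recursion becomes the q-Pascal rule. -/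
theorem pow_mul_shuffleCount {q : K} (hq : q ≠ 0) (k l : ℕ) :
    q ^ (k * l) * shuffleCount q⁻¹ k l = qBinom q (k + l) k := by
  induction hn : k + l using Nat.strong_induction_on generalizing k l with
  | _ n ih =>
    subst hn
    rcases k with _ | k
    · simp
    rcases l with _ | l
    · simp
    have h1 := ih _ (by omega) (k + 1) l rfl
    have h2 := ih _ (by omega) k (l + 1) rfl
    rw [show k + 1 + (l + 1) = k + (l + 1) + 1 by omega, qBinom, ← h2,
      show k + (l + 1) = k + 1 + l by omega, ← h1, shuffleCount_succ_succ, inv_pow]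
    field_simp
    ring

/-- `blockCoeff q⁻¹ k` equals (-1)^k q^(-k(k-1)/2), and k² - k(k-1)/2 = k(k+1)/2. -/
theorem blockCoeff_mul_pow {q : K} (hq : q ≠ 0) (k : ℕ) :
    blockCoeff q⁻¹ k * q ^ (k * k) = (-1) ^ k * q ^ (k * (k + 1) / 2) := by
  induction k with
  | zero => simp [blockCoeff]
  | succ k ih =>
    have h : (k + 1) * (k + 1 + 1) / 2 = k * (k + 1) / 2 + (k + 1) := by
      rw [show (k + 1) * (k + 1 + 1) = k * (k + 1) + (k + 1) * 2 by ring]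
      omega
    rw [h]
    calc blockCoeff q⁻¹ (k + 1) * q ^ ((k + 1) * (k + 1))
        = -(blockCoeff q⁻¹ k * q ^ (k * k)) * q ^ (k + 1) := by
          rw [blockCoeff, inv_pow]
          field_simp
          ring
      _ = _ := by rw [ih]; ring

/-- The power q^(nk) splits as q^(k²) q^(kl), one part for each of the two preceding evaluations.
Positivity of `n` makes the natural subtraction `k * n - k` exact. -/
theorem trace_value {q : K} (hq : q ≠ 0) {n k l : ℕ} (hn : 0 < n) (h : k + l = n) :
    ((-q) ^ n) ^ k * (blockCoeff q⁻¹ k * shuffleCount q⁻¹ k l) =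
      (-1) ^ (k * n - k) * q ^ (k * (k + 1) / 2) * qBinom q n k := by
  have h1 := pow_mul_shuffleCount hq k l
  have h2 := blockCoeff_mul_pow hq k
  have hs : ((-1 : K) ^ (k * n)) * (-1) ^ k = (-1) ^ (k * n - k) := by
    have hkn : k ≤ k * n := Nat.le_mul_of_pos_right k hn
    obtain ⟨m, hm⟩ := Nat.exists_eq_add_of_le hkn
    rw [hm, Nat.add_sub_cancel_left, pow_add, mul_right_comm, ← mul_pow]
    simp
  rw [h] at h1
  rw [← h1, ← hs, mul_assoc, mul_assoc, mul_left_comm ((-1) ^ k) _ _ |>.symm]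
  calc ((-q) ^ n) ^ k * (blockCoeff q⁻¹ k * shuffleCount q⁻¹ k l)
      = (-1) ^ (k * n) * (blockCoeff q⁻¹ k * q ^ (k * k)) *
          (q ^ (k * l) * shuffleCount q⁻¹ k l) := by
        subst h
        rw [← pow_mul, neg_pow]
        ring
    _ = _ := by rw [h2]; ring

end Arithmetic

/-! ### The generator t of Υ^(n), the operators θ and ψ, and the trace formula. -/

section Volume

variable {K V : Type*} [Field K] [AddCommGroup V] [Module K V]

local notation "𝕋" => TensorAlgebra K V
local notation "𝕚" => TensorAlgebra.ι K

theorem exists_sum_of_mem_mul {A B : Submodule K 𝕋} {z : 𝕋} (hz : z ∈ A * B) :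
    ∃ (J : Type) (_ : Fintype J) (x y : J → 𝕋), (∀ j, x j ∈ A) ∧ (∀ j, y j ∈ B) ∧
      ∑ j, x j * y j = z := by
  induction hz using Submodule.mul_induction_on' with
  | mem_mul_mem x hx y hy =>
    exact ⟨Unit, inferInstance, fun _ => x, fun _ => y, fun _ => hx, fun _ => hy, by simp⟩
  | add x _ y _ hx hy =>
    obtain ⟨J, _, x, y, h1, h2, rfl⟩ := hx
    obtain ⟨J', _, x', y', h1', h2', rfl⟩ := hy
    refine ⟨J ⊕ J', inferInstance, Sum.elim x x', Sum.elim y y', ?_, ?_, by simp⟩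
    · rintro (j | j)
      exacts [h1 j, h1' j]
    · rintro (j | j)
      exacts [h2 j, h2' j]

theorem mapT_smul (r : K) (χ : V →ₗ[K] V) {k : ℕ} {x : 𝕋} (hx : x ∈ deg K V k) :
    mapT (r • χ) x = r ^ k • mapT χ x := by
  induction k generalizing x with
  | zero =>
    obtain ⟨r, rfl⟩ := mem_deg_zero.1 hx
    simp
  | succ k ih =>
    refine eqOn_deg_succ (φ := (mapT (r • χ)).toLinearMap)
      (χ := r ^ (k + 1) • (mapT χ).toLinearMap) (fun v y hy => ?_) hx
    simp only [AlgHom.toLinearMap_apply, LinearMap.smul_apply, map_mul, mapT_ι, ih hy, map_smul,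
      smul_mul_smul_comm, pow_succ']

theorem mapT_symm_apply (χ : V ≃ₗ[K] V) (x : 𝕋) :
    mapT χ.symm.toLinearMap (mapT χ.toLinearMap x) = x := by
  rw [← mapT_comp, LinearEquiv.symm_comp, mapT_id]

theorem mapT_apply_symm (χ : V ≃ₗ[K] V) (x : 𝕋) :
    mapT χ.toLinearMap (mapT χ.symm.toLinearMap x) = x := by
  rw [← mapT_comp, LinearEquiv.comp_symm, mapT_id]

theorem moveRight_smul (r : K) (c : ℕ → Module.End K 𝕋) (s j : ℕ) :
    moveRight (fun i => r • c i) s j = r ^ j • moveRight c s j := by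
  induction j with
  | zero => simp
  | succ j ih => rw [moveRight_succ, moveRight_succ, ih, smul_mul_smul_comm, pow_succ']

variable [FiniteDimensional K V]

local notation "𝔢" => Module.finBasis K V

instance finiteDimensional_deg (m : ℕ) : FiniteDimensional K (deg K V m) := by
  rw [deg]
  exact Module.Finite.iff_fg.2 (Submodule.FG.pow (Module.Finite.iff_fg.1 inferInstance) m)

variable {q : K} {R : V ⊗[K] V →ₗ[K] V ⊗[K] V} {n : ℕ} {t : TensorAlgebra K V}

instance finiteDimensional_ups (m : ℕ) : FiniteDimensional K (ups q R m) :=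
  Submodule.finiteDimensional_of_le (ups_le_deg m)

theorem seg_le_mul (l k : ℕ) : seg q R (l + k) l k ≤ deg K V l * ups q R k := by
  induction l with
  | zero =>
    intro x hx
    rw [zero_add] at hx
    rw [deg, pow_zero, one_mul]
    exact hx
  | succ l ih =>
    intro x hx
    rw [add_right_comm] at hx
    rw [← expand_cons (mem_seg.1 hx).1]
    refine Submodule.sum_mem _ fun a _ => ?_
    rw [deg, pow_succ', mul_assoc]
    exact Submodule.mul_mem_mul ⟨_, rfl⟩ (ih (lc_mem_seg _ hx))

theorem ctr_mem_deg {m k : ℕ} (F : 𝕋 →ₗ[K] K) {x : 𝕋} (hx : x ∈ deg K V (m + k)) :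
    ctr m F x ∈ deg K V k := by
  refine deg_add_le (S := (deg K V k).comap (ctr m F)) (fun y hy z hz => ?_) hx
  rw [Submodule.mem_comap, ctr_mul F hy]
  exact Submodule.smul_mem _ _ hz

theorem ctr_gen {m k : ℕ} (F : 𝕋 →ₗ[K] K) (i : ℕ) {x : 𝕋} (hx : x ∈ deg K V (m + k)) :
    ctr m F (gen q R (m + i) x) = gen q R i (ctr m F x) := by
  refine eqOn_deg_add (φ := ctr m F ∘ₗ gen q R (m + i)) (χ := gen q R i ∘ₗ ctr m F)
    (fun y hy z hz => ?_) hx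
  simp [gen_mul_left i hy, ctr_mul F hy]

/-- Contraction of the first `m` factors intertwines the generators on the remaining ones. -/
theorem ctr_mem_ups {m k : ℕ} (F : 𝕋 →ₗ[K] K) {x : 𝕋} (hx : x ∈ seg q R (m + k) m k) :
    ctr m F x ∈ ups q R k :=
  map_mem_seg (g := ctr m F) (fun _ => ctr_mem_deg F)
    (fun i _ _ hx => by rw [zero_add, ctr_gen F i hx]) hx

theorem rc_shuffleSum {m s k l : ℕ} (h : s + k + l ≤ m) (f : Module.Dual K V) {x : 𝕋}
    (hx : x ∈ deg K V (m + 1)) :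
    rc f (shuffleSum (gen q R) s k l x) = shuffleSum (gen q R) s k l (rc f x) := by
  refine eqOn_deg_succ' (φ := rc f ∘ₗ shuffleSum (gen q R) s k l)
    (χ := shuffleSum (gen q R) s k l ∘ₗ rc f) (fun v y hy => ?_) hx
  simp [shuffleSum_mul_right s k l h hy]

/-- `Υ^(n)` is spanned by a nonzero tensor `t`, and `Υ^(n+1) = 0`. -/
structure IsVolume (q : K) (R : V ⊗[K] V →ₗ[K] V ⊗[K] V) (n : ℕ) (t : TensorAlgebra K V) :
    Prop where
  ne_zero : t ≠ 0
  ups_eq : ups q R n = Submodule.span K {t}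
  vanish : ups q R (n + 1) = ⊥

theorem IsVolume.mem (ht : IsVolume q R n t) : t ∈ ups q R n := by
  rw [ht.ups_eq]; exact Submodule.mem_span_singleton_self t

theorem IsVolume.mem_deg (ht : IsVolume q R n t) : t ∈ deg K V n := ups_le_deg n ht.mem

theorem IsVolume.exists_dual (ht : IsVolume q R n t) : ∃ F : 𝕋 →ₗ[K] K, F t = 1 := by
  have h : ¬ ∀ F : Module.Dual K 𝕋, F t = 0 := fun h =>
    ht.ne_zero ((Module.forall_dual_apply_eq_zero_iff K t).1 h)
  push Not at h
  obtain ⟨F, hF⟩ := h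
  exact ⟨(F t)⁻¹ • F, by simp [hF]⟩

theorem IsVolume.mul_left_cancel (ht : IsVolume q R n t) {x y : 𝕋} (h : t * x = t * y) :
    x = y := by
  obtain ⟨F, hF⟩ := ht.exists_dual
  have := congrArg (ctr n F) h
  simpa [ctr_mul F ht.mem_deg, hF] using this

/-! ### The operator `θ` -/

theorem IsHecke.gen_injOn (hR : IsHecke q R) {m i : ℕ} (hi : i + 1 < m) {x : 𝕋}
    (hx : x ∈ deg K V m) (h : gen q R i x = 0) : x = 0 := by
  have := hR.gen_gen i hi hx
  rw [h, map_zero, smul_zero, zero_add] at this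
  exact (smul_eq_zero.1 this.symm).resolve_left (inv_ne_zero hR.ne_zero)

theorem IsHecke.moveRight_injOn (hR : IsHecke q R) {m s j : ℕ} (h : s + j < m) {x : 𝕋}
    (hx : x ∈ deg K V m) (h0 : moveRight (gen q R) s j x = 0) : x = 0 := by
  induction j with
  | zero => simpa using h0
  | succ j ih =>
    rw [moveRight_succ, Module.End.mul_apply] at h0
    exact ih (by omega) (hR.gen_injOn (by omega) (moveRight_mem_deg _ _ hx) h0)

theorem IsHecke.moveRight_cons_mem_seg (hR : IsHecke q R) (ht : t ∈ ups q R n) (v : V) :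
    moveRight (gen q R) 0 n (𝕚 v * t) ∈ seg q R (n + 1) 0 n := by
  have h1 : 𝕚 v * t ∈ seg q R (n + 1) 1 n := by
    have := mul_mem_seg_right (ι_mem_deg v) ht
    rwa [add_comm 1 n] at this
  refine map_mem_seg (g := moveRight (gen q R) 0 n) (fun _ => moveRight_mem_deg _ _)
    (fun i hi z _ => ?_) h1
  have := hR.braided.moveRight_mul_gen 0 n i (by omega) (by omega)
  rw [add_comm 1 i, zero_add]
  exact LinearMap.congr_fun this z

/-- Moving `v` across shifts the segment of `t` to the front, so every right contraction of the
result lies in Υ^(n) = K t and the result in t V. Injectivity holds since the generators are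
injective in the relevant degree. -/
theorem IsVolume.exists_theta (ht : IsVolume q R n t) (hR : IsHecke q R) :
    ∃ ϑ : V ≃ₗ[K] V, ∀ v, moveRight (gen q R) 0 n (𝕚 v * t) = t * 𝕚 (ϑ v) := by
  have hex : ∀ v, ∃ w, moveRight (gen q R) 0 n (𝕚 v * t) = t * 𝕚 w := fun v => by
    have h1 := hR.moveRight_cons_mem_seg ht.mem v
    have h2 : ∀ a, ∃ r : K, r • t =
        rc (Module.Basis.coord 𝔢 a) (moveRight (gen q R) 0 n (𝕚 v * t)) := fun a => by
      have := rc_mem_seg (Module.Basis.coord 𝔢 a) (by omega) h1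
      change _ ∈ ups q R n at this
      rwa [ht.ups_eq, Submodule.mem_span_singleton] at this
    choose r hr using h2
    refine ⟨∑ a, r a • 𝔢 a, ?_⟩
    rw [← expand_snoc (mem_seg.1 h1).1]
    simp [← hr, Finset.mul_sum]
  choose w hw using hex
  let ϑ : V →ₗ[K] V :=
    { toFun := w
      map_add' := fun v v' => by
        have := ht.mul_left_cancel (x := 𝕚 (w (v + v'))) (y := 𝕚 (w v + w v'))
          (by rw [← hw, map_add, map_add, add_mul, map_add, hw, hw, mul_add])
        exact (TensorAlgebra.ι_inj K _ _).1 this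
      map_smul' := fun r v => by
        have := ht.mul_left_cancel (x := 𝕚 (w (r • v))) (y := 𝕚 (r • w v))
          (by rw [← hw, map_smul, map_smul, smul_mul_assoc, map_smul, hw, mul_smul_comm])
        exact (TensorAlgebra.ι_inj K _ _).1 this }
  have hinj : Function.Injective ϑ := by
    rw [← LinearMap.ker_eq_bot, LinearMap.ker_eq_bot']
    intro v hv
    have h1 : moveRight (gen q R) 0 n (𝕚 v * t) = 0 := by
      rw [hw, show w v = 0 from hv, map_zero, mul_zero]
    have h2 := hR.moveRight_injOn (by omega) (cons_mem_deg v ht.mem_deg) h1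
    by_contra hv0
    obtain ⟨f, hf⟩ : ∃ f : Module.Dual K V, f v ≠ 0 := by
      by_contra h
      push Not at h
      exact hv0 ((Module.forall_dual_apply_eq_zero_iff K v).1 h)
    have h3 := congrArg (lc f) h2
    rw [lc_cons, map_zero, smul_eq_zero] at h3
    exact h3.elim hf ht.ne_zero
  exact ⟨LinearEquiv.ofInjectiveEndo ϑ hinj, hw⟩

theorem IsVolume.mul_mem_seg (ht : IsVolume q R n t) {k : ℕ} {u : 𝕋} (hu : u ∈ ups q R k) :
    u * t ∈ seg q R (n + k) 0 k ∧ u * t ∈ seg q R (n + k) k n := by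
  rw [add_comm n k]
  exact ⟨mul_mem_seg_left le_rfl hu ht.mem_deg,
    mul_mem_seg_right (s := 0) (ups_le_deg k hu) ht.mem⟩

/-- The central identity: two evaluations of the move of `u` past `t`. -/
theorem IsVolume.mul_mapT (ht : IsVolume q R n t) (hR : IsHecke q R) {ϑ : V →ₗ[K] V}
    (hϑ : ∀ v, moveRight (gen q R) 0 n (𝕚 v * t) = t * 𝕚 (ϑ v)) {k l : ℕ} (hkl : k + l = n)
    {u : 𝕋} (hu : u ∈ ups q R k) :
    t * mapT ϑ u = blockCoeff q⁻¹ k • shuffleSum (gen q R) 0 k l (u * t) := by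
  rw [← moveBlock_mul ht.mem_deg hϑ (ups_le_deg k hu)]
  exact hR.moveBlock_eq_shuffleSum ht.vanish hkl (ht.mul_mem_seg hu).1 (ht.mul_mem_seg hu).2

theorem IsVolume.mapT_eq_ctr (ht : IsVolume q R n t) (hR : IsHecke q R) {ϑ : V →ₗ[K] V}
    (hϑ : ∀ v, moveRight (gen q R) 0 n (𝕚 v * t) = t * 𝕚 (ϑ v)) {k l : ℕ} (hkl : k + l = n)
    {F : 𝕋 →ₗ[K] K} (hF : F t = 1) {u : 𝕋} (hu : u ∈ ups q R k) :
    mapT ϑ u = blockCoeff q⁻¹ k • ctr n F (shuffleSum (gen q R) 0 k l (u * t)) := by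
  rw [← map_smul, ← ht.mul_mapT hR hϑ hkl hu, ctr_mul F ht.mem_deg, hF, one_smul]

/-- In the contraction formula the shuffles touch only the first `n` places of `u * t`, and the last
`k` places keep the type Υ^(k). -/
theorem IsVolume.mapT_theta_mem (ht : IsVolume q R n t) (hR : IsHecke q R) {ϑ : V →ₗ[K] V}
    (hϑ : ∀ v, moveRight (gen q R) 0 n (𝕚 v * t) = t * 𝕚 (ϑ v)) {k l : ℕ} (hkl : k + l = n)
    {u : 𝕋} (hu : u ∈ ups q R k) : mapT ϑ u ∈ ups q R k := by
  obtain ⟨F, hF⟩ := ht.exists_dual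
  rw [ht.mapT_eq_ctr hR hϑ hkl hF hu]
  refine Submodule.smul_mem _ _ (ctr_mem_ups F ?_)
  refine map_mem_seg (g := shuffleSum (gen q R) 0 k l) (s := n)
    (fun _ => shuffleSum_mem_deg _ _ _) (fun i _ z _ => ?_)
    (seg_mono (by omega) (by omega) (ht.mul_mem_seg hu).2)
  exact (end_apply_of_commute (Commute.shuffleSum_right _ _ _
    fun j _ hj => hR.braided.comm' _ _ (by omega)) z).symm

theorem ctr_shuffleSum (F : 𝕋 →ₗ[K] K) {k l : ℕ} {u : 𝕋} (hu : u ∈ deg K V k) {x : 𝕋}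
    (hx : x ∈ deg K V l) (y : 𝕋) :
    ctr (k + l) F (shuffleSum (gen q R) 0 k l (u * (x * y))) =
      F (shuffleSum (gen q R) 0 k l (u * x)) • y := by
  rw [← mul_assoc, shuffleSum_mul_right 0 k l (by omega) (mul_mem_deg hu hx),
    ctr_mul F (shuffleSum_mem_deg _ _ _ (mul_mem_deg hu hx))]

/-- Every element of `Υ^(k)` is a contraction of `t`. -/
theorem IsVolume.exists_ctr_eq (ht : IsVolume q R n t) (hR : IsHecke q R) {k l : ℕ}
    (hkl : k + l = n) {u : 𝕋} (hu : u ∈ ups q R k) : ∃ G : 𝕋 →ₗ[K] K, ctr l G t = u := by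
  obtain ⟨ϑ, hϑ⟩ := ht.exists_theta hR
  obtain ⟨F, hF⟩ := ht.exists_dual
  let Θ : ups q R k →ₗ[K] ups q R k :=
    (mapT ϑ.toLinearMap).toLinearMap.restrict fun u hu => ht.mapT_theta_mem hR hϑ hkl hu
  -- As Υ^(k) is finite dimensional, injectivity makes `Θ` onto, so `u` is the image of some `u'`,
  -- to which the contraction formula applies.
  have hinj : Function.Injective Θ := fun x y hxy => by
    have h : mapT ϑ.toLinearMap x.1 = mapT ϑ.toLinearMap y.1 := congrArg Subtype.val hxy
    have h' := congrArg (mapT ϑ.symm.toLinearMap) h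
    rw [mapT_symm_apply, mapT_symm_apply] at h'
    exact Subtype.ext h'
  obtain ⟨⟨u', hu'⟩, h⟩ := LinearMap.injective_iff_surjective.1 hinj ⟨u, hu⟩
  have h' : mapT ϑ.toLinearMap u' = u := congrArg Subtype.val h
  refine ⟨blockCoeff q⁻¹ k • F ∘ₗ shuffleSum (gen q R) 0 k l ∘ₗ LinearMap.mulLeft K u', ?_⟩
  rw [← h', ht.mapT_eq_ctr hR hϑ hkl hF hu']
  subst hkl
  refine eqOn_deg_add (a := l) (b := k) (χ := blockCoeff q⁻¹ k • ctr (k + l) F ∘ₗ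
    shuffleSum (gen q R) 0 k l ∘ₗ LinearMap.mulLeft K u') (fun x hx y _ => ?_)
    (by rw [add_comm]; exact ht.mem_deg)
  rw [ctr_mul _ hx]
  simp [ctr_shuffleSum F (ups_le_deg k hu') hx, smul_smul]

theorem mapT_ctr (χ : V ≃ₗ[K] V) {l k : ℕ} (G : 𝕋 →ₗ[K] K) {z : 𝕋} (hz : z ∈ deg K V (l + k)) :
    mapT χ.toLinearMap (ctr l G z) =
      ctr l (G ∘ₗ (mapT χ.symm.toLinearMap).toLinearMap) (mapT χ.toLinearMap z) := by
  refine eqOn_deg_add (φ := (mapT χ.toLinearMap).toLinearMap ∘ₗ ctr l G)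
    (χ := ctr l (G ∘ₗ (mapT χ.symm.toLinearMap).toLinearMap) ∘ₗ (mapT χ.toLinearMap).toLinearMap)
    (fun x hx y _ => ?_) hz
  simp [ctr_mul _ hx, ctr_mul _ (mapT_mem_deg _ hx), mapT_symm_apply]

/-- An operator fixing `t` permutes the contractions of `t`, and these exhaust Υ^(k). No
compatibility of `χ` with `R` has to be assumed. -/
theorem IsVolume.mapT_mem_ups (ht : IsVolume q R n t) (hR : IsHecke q R) {χ : V ≃ₗ[K] V}
    (hχ : mapT χ.toLinearMap t = t) {k l : ℕ} (hkl : k + l = n) {u : 𝕋} (hu : u ∈ ups q R k) :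
    mapT χ.toLinearMap u ∈ ups q R k := by
  obtain ⟨G, rfl⟩ := ht.exists_ctr_eq hR hkl hu
  obtain rfl : l + k = n := by omega
  rw [mapT_ctr χ G ht.mem_deg, hχ]
  exact ctr_mem_ups _ (seg_mono (by omega) (by omega) ht.mem)

/-! ### The operator `ψ` -/

/-- The property of the operator `ψ` in terms of contractions of `t`: moving the last factor of
`t` to the front amounts to the action of `ψ` on the first factor. -/
def IsRot (t : TensorAlgebra K V) (ψ : V ≃ₗ[K] V) : Prop :=
  ∀ f : Module.Dual K V, rc f t = lc (ψ.toLinearMap.dualMap f) t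

/-- The linear map which sends `x v` to `φ(v) x`. -/
def rho (φ : V →ₗ[K] V) : Module.End K 𝕋 :=
  ∑ a, LinearMap.mulLeft K (𝕚 (φ (𝔢 a))) ∘ₗ rc (Module.Basis.coord 𝔢 a)

theorem ι_apply_eq_sum (φ : V →ₗ[K] V) (v : V) :
    𝕚 (φ v) = ∑ a, Module.Basis.coord 𝔢 a v • 𝕚 (φ (𝔢 a)) := by
  simp only [← map_smul, ← map_sum, Module.Basis.coord_apply, Module.Basis.sum_repr]

theorem rho_snoc (φ : V →ₗ[K] V) (v : V) (x : 𝕋) : rho φ (x * 𝕚 v) = 𝕚 (φ v) * x := by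
  rw [ι_apply_eq_sum]
  simp [rho, Finset.sum_mul]

theorem rho_pow_mul (φ : V →ₗ[K] V) {k : ℕ} (x : 𝕋) {y : 𝕋} (hy : y ∈ deg K V k) :
    (rho φ ^ k) (x * y) = mapT φ y * x := by
  induction k generalizing x y with
  | zero =>
    obtain ⟨r, rfl⟩ := mem_deg_zero.1 hy
    simp [Algebra.commutes]
  | succ k ih =>
    refine eqOn_deg_succ' (φ := (rho φ ^ (k + 1)) ∘ₗ LinearMap.mulLeft K x)
      (χ := LinearMap.mulRight K x ∘ₗ (mapT φ).toLinearMap) (fun v z hz => ?_) hy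
    simp only [LinearMap.comp_apply, LinearMap.mulLeft_apply, LinearMap.mulRight_apply,
      AlgHom.toLinearMap_apply, map_mul, mapT_ι, pow_succ, Module.End.mul_apply]
    rw [← mul_assoc, rho_snoc, ← mul_assoc, ih _ hz, mul_assoc]

/-- The rotation property trades the right contractions in `rho` for left ones, and the sum becomes
the expansion of `t` by its first factor. -/
theorem IsRot.rho_eq {ψ : V ≃ₗ[K] V} (h : IsRot t ψ) (hn : 0 < n) (ht : t ∈ deg K V n) :
    rho ψ.symm.toLinearMap t = t := by
  obtain ⟨m, rfl⟩ : ∃ m, n = m + 1 := ⟨n - 1, by omega⟩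
  have h1 : rho ψ.symm.toLinearMap t = (∑ a, LinearMap.mulLeft K (𝕚 (ψ.symm (𝔢 a))) ∘ₗ
      lc (ψ.toLinearMap.dualMap (Module.Basis.coord 𝔢 a)) : 𝕋 →ₗ[K] 𝕋) t := by
    simp [rho, h _]
  rw [h1]
  refine eqOn_deg_succ (χ := LinearMap.id) (fun v y _ => ?_) ht
  have h2 := ι_apply_eq_sum ψ.symm.toLinearMap (ψ v)
  simp only [LinearEquiv.coe_coe, LinearEquiv.symm_apply_apply] at h2
  rw [LinearMap.id_apply]
  conv_rhs => rw [h2]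
  simp [Finset.sum_mul]

theorem IsRot.rho_pow_eq {ψ : V ≃ₗ[K] V} (h : IsRot t ψ) (hn : 0 < n) (ht : t ∈ deg K V n)
    (k : ℕ) : (rho ψ.symm.toLinearMap ^ k) t = t := by
  induction k with
  | zero => rfl
  | succ k ih => rw [pow_succ, Module.End.mul_apply, h.rho_eq hn ht, ih]

/-- After `n` rotations each factor is back in its place, having met ψ⁻¹ exactly once. -/
theorem IsRot.mapT_symm_eq {ψ : V ≃ₗ[K] V} (h : IsRot t ψ) (hn : 0 < n) (ht : t ∈ deg K V n) :
    mapT ψ.symm.toLinearMap t = t := by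
  have := rho_pow_mul ψ.symm.toLinearMap 1 ht
  rwa [one_mul, mul_one, h.rho_pow_eq hn ht, eq_comm] at this

theorem IsRot.mapT_eq {ψ : V ≃ₗ[K] V} (h : IsRot t ψ) (hn : 0 < n) (ht : t ∈ deg K V n) :
    mapT ψ.toLinearMap t = t := by
  conv_lhs => rw [← h.mapT_symm_eq hn ht, mapT_apply_symm]

/-- The linear map `f ↦ lc f t`. -/
def lcAt (t : TensorAlgebra K V) : Module.Dual K V →ₗ[K] 𝕋 where
  toFun f := lc f t
  map_add' f g := lc_add f g t
  map_smul' r f := lc_smul r f t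

/-- The linear map `f ↦ rc f t`. -/
def rcAt (t : TensorAlgebra K V) : Module.Dual K V →ₗ[K] 𝕋 where
  toFun f := rc f t
  map_add' f g := rc_add f g t
  map_smul' r f := rc_smul r f t

/-- Contract the central identity for k = 1 by `f`: the shuffles do not touch the last factor, so
`rc f t = 0` forces f(ϑ(v)) t = 0 for all v. -/
theorem IsVolume.rc_injective (ht : IsVolume q R n t) (hR : IsHecke q R) (hn : 0 < n) :
    Function.Injective (rcAt t) := by
  rw [← LinearMap.ker_eq_bot, LinearMap.ker_eq_bot']
  intro f hf
  obtain ⟨m, rfl⟩ : ∃ m, n = 1 + m := ⟨n - 1, by omega⟩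
  obtain ⟨ϑ, hϑ⟩ := ht.exists_theta hR
  have htd : t ∈ deg K V (m + 1) := by rw [add_comm]; exact ht.mem_deg
  have hf0 : ∀ v, f (ϑ v) = 0 := fun v => by
    have hv : 𝕚 v ∈ ups q R 1 := mem_ups.2 ⟨ι_mem_deg v, fun i hi => absurd hi (by omega)⟩
    have h := congrArg (rc f) (ht.mul_mapT hR hϑ rfl hv)
    rw [mapT_ι, map_smul, rc_shuffleSum (m := 1 + m) (by omega) f (cons_mem_deg v ht.mem_deg),
      rc_cons f v htd, show rc f t = 0 from hf, mul_zero, map_zero, smul_zero, rc_snoc,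
      smul_eq_zero] at h
    exact h.resolve_right ht.ne_zero
  ext v
  simpa using hf0 (ϑ.symm v)

theorem IsVolume.exists_lc_eq (ht : IsVolume q R (n + 1) t) (hR : IsHecke q R) {u : 𝕋}
    (hu : u ∈ ups q R n) : ∃ f : Module.Dual K V, lc f t = u := by
  obtain ⟨G, rfl⟩ := ht.exists_ctr_eq hR (l := 1) rfl hu
  refine ⟨∑ a, G (𝕚 (𝔢 a)) • Module.Basis.coord 𝔢 a, ?_⟩
  change lcAt t _ = _
  simp [ctr, lcAt]

/-- Right contraction of `t` embeds V* in Υ^(n-1) and left contraction maps V* onto it, so both are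
bijective and ψ* is the transition map. -/
theorem IsVolume.exists_rot (ht : IsVolume q R n t) (hR : IsHecke q R) (hn : 0 < n) :
    Function.Injective (lcAt t) ∧ ∃ ψ : V ≃ₗ[K] V, IsRot t ψ := by
  have hrinj := ht.rc_injective hR hn
  obtain ⟨m, rfl⟩ : ∃ m, n = m + 1 := ⟨n - 1, by omega⟩
  let l : Module.Dual K V →ₗ[K] ups q R m := (lcAt t).codRestrict _ fun f => lc_mem_ups f ht.mem
  let r : Module.Dual K V →ₗ[K] ups q R m := (rcAt t).codRestrict _ fun f => rc_mem_ups f ht.mem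
  have hr : Function.Injective r := fun f g hfg => hrinj (congrArg Subtype.val hfg)
  have hl : Function.Surjective l := fun ⟨u, hu⟩ => by
    obtain ⟨f, hf⟩ := ht.exists_lc_eq hR hu
    exact ⟨f, Subtype.ext hf⟩
  have hdim : Module.finrank K (Module.Dual K V) = Module.finrank K (ups q R m) :=
    le_antisymm (LinearMap.finrank_le_finrank_of_injective hr)
      (LinearMap.finrank_le_finrank_of_surjective hl)
  have hl' : Function.Injective l :=
    (LinearMap.injective_iff_surjective_of_finrank_eq_finrank hdim).2 hl
  have hr' : Function.Surjective r :=
    (LinearMap.injective_iff_surjective_of_finrank_eq_finrank hdim).1 hr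
  refine ⟨fun f g hfg => hl' (Subtype.ext hfg), ?_⟩
  let σ : Module.Dual K V ≃ₗ[K] Module.Dual K V :=
    (LinearEquiv.ofBijective r ⟨hr, hr'⟩).trans (LinearEquiv.ofBijective l ⟨hl', hl⟩).symm
  -- Biduality produces the operator on V whose dual is `σ`.
  refine ⟨((Module.evalEquiv K V).trans σ.dualMap).trans (Module.evalEquiv K V).symm,
    fun f => ?_⟩
  have h1 : (((Module.evalEquiv K V).trans σ.dualMap).trans
      (Module.evalEquiv K V).symm).toLinearMap.dualMap f = σ f := by
    ext v
    simp [Module.apply_evalEquiv_symm_apply]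
  rw [h1]
  exact (congrArg Subtype.val
    ((LinearEquiv.ofBijective l ⟨hl', hl⟩).apply_symm_apply (r f))).symm

/-! ### The trace formula -/

/-- The operator `(ψ⁻¹ ϑ)^(⊗k)` on `Υ^(k)` as a sum of operators of rank one. -/
theorem IsVolume.exists_rank_one_sum (ht : IsVolume q R n t) (hR : IsHecke q R) (hn : 0 < n)
    {ϑ : V →ₗ[K] V} (hϑ : ∀ v, moveRight (gen q R) 0 n (𝕚 v * t) = t * 𝕚 (ϑ v))
    {ψ : V ≃ₗ[K] V} (hψ : IsRot t ψ) {k l : ℕ} (hkl : k + l = n) :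
    ∃ (J : Type) (_ : Fintype J) (f : J → 𝕋 →ₗ[K] K) (z : J → 𝕋), (∀ j, z j ∈ ups q R k) ∧
      (∀ u ∈ ups q R k, mapT (ψ.symm.toLinearMap ∘ₗ ϑ) u = ∑ j, f j u • z j) ∧
      ∑ j, f j (z j) = blockCoeff q⁻¹ k * shuffleCount q⁻¹ k l := by
  obtain ⟨F, hF⟩ := ht.exists_dual
  -- Only the right factors need to lie in Υ^(k); the left ones may be arbitrary tensors.
  have hts : t ∈ deg K V l * ups q R k := by
    refine seg_le_mul l k ?_
    rw [add_comm, hkl]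
    exact seg_mono (by omega) (by omega) ht.mem
  obtain ⟨J, _, x, y, hx, hy, hxy⟩ := exists_sum_of_mem_mul hts
  refine ⟨J, inferInstance, fun j => blockCoeff q⁻¹ k •
    (F ∘ₗ shuffleSum (gen q R) 0 k l ∘ₗ LinearMap.mulRight K (x j)),
    fun j => mapT ψ.symm.toLinearMap (y j), fun j => ?_, fun u hu => ?_, ?_⟩
  · exact ht.mapT_mem_ups hR (hψ.mapT_symm_eq hn ht.mem_deg) hkl (hy j)
  · rw [mapT_comp, ht.mapT_eq_ctr hR hϑ hkl hF hu, ← hxy, ← hkl]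
    simp [Finset.mul_sum, ctr_shuffleSum F (ups_le_deg k hu) (hx _), Finset.smul_sum, smul_smul]
  -- This is `t` rotated `k` times: its last `k` factors come to the front through ψ⁻¹.
  · have h1 : ∑ j, mapT ψ.symm.toLinearMap (y j) * x j = t := by
      conv_rhs => rw [← hψ.rho_pow_eq hn ht.mem_deg k, ← hxy, map_sum]
      exact Finset.sum_congr rfl fun j _ => (rho_pow_mul _ _ (ups_le_deg k (hy j))).symm
    have h2 := hR.shuffleSum_of_mem_seg (m := n) (s := 0) (k := k) (l := l) (by omega)
      (seg_mono (by omega) (by omega) ht.mem)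
    calc _ = blockCoeff q⁻¹ k * F (shuffleSum (gen q R) 0 k l
          (∑ j, mapT ψ.symm.toLinearMap (y j) * x j)) := by
          simp [Finset.mul_sum]
      _ = _ := by rw [h1, h2, map_smul, hF, smul_eq_mul, mul_one]

theorem IsHecke.moveRight_tau (hR : IsHecke q R) (s j : ℕ) :
    moveRight (tau R) s j = (-q) ^ j • moveRight (gen q R) s j := by
  rw [← moveRight_smul]
  congr 1
  ext1 i
  rw [gen, smul_smul, neg_mul_neg, mul_inv_cancel₀ hR.ne_zero, one_smul]

/-- The property `T_n ⋯ T_1 (v t) = t θ(v)` in the tensor algebra. -/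
def IsThetaT (R : V ⊗[K] V →ₗ[K] V ⊗[K] V) (n : ℕ) (t : TensorAlgebra K V) (θ : V ≃ₗ[K] V) :
    Prop :=
  ∀ v, moveRight (tau R) 0 n (𝕚 v * t) = t * 𝕚 (θ v)

theorem IsVolume.existsUnique_thetaT (ht : IsVolume q R n t) (hR : IsHecke q R) :
    ∃! θ : V ≃ₗ[K] V, IsThetaT R n t θ := by
  obtain ⟨ϑ, hϑ⟩ := ht.exists_theta hR
  have hq : (-q) ^ n ≠ 0 := pow_ne_zero _ (neg_ne_zero.2 hR.ne_zero)
  refine ⟨ϑ.trans (LinearEquiv.smulOfNeZero K V _ hq), fun v => ?_, fun θ hθ => ?_⟩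
  · simp [hR.moveRight_tau, hϑ]
  · ext v
    have := (hθ v).symm
    rw [hR.moveRight_tau, LinearMap.smul_apply, hϑ, ← mul_smul_comm, ← map_smul] at this
    exact (TensorAlgebra.ι_inj K _ _).1 (ht.mul_left_cancel this)

theorem IsVolume.exists_rank_one_sum_theta (ht : IsVolume q R n t) (hR : IsHecke q R)
    (hn : 0 < n) {θ : V ≃ₗ[K] V} (hθ : IsThetaT R n t θ) {ψ : V ≃ₗ[K] V} (hψ : IsRot t ψ)
    {k : ℕ} (hk : k ≤ n) :
    ∃ (J : Type) (_ : Fintype J) (f : J → 𝕋 →ₗ[K] K) (z : J → 𝕋), (∀ j, z j ∈ ups q R k) ∧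
      (∀ u ∈ ups q R k,
        mapT (ψ.symm.toLinearMap ∘ₗ θ.toLinearMap) u = ∑ j, f j u • z j) ∧
      ∑ j, f j (z j) = (-1) ^ (k * n - k) * q ^ (k * (k + 1) / 2) * qBinom q n k := by
  obtain ⟨l, hkl⟩ := Nat.exists_eq_add_of_le hk
  have hq : (-q) ^ n ≠ 0 := pow_ne_zero _ (neg_ne_zero.2 hR.ne_zero)
  have hϑ : ∀ v, moveRight (gen q R) 0 n (𝕚 v * t) =
      t * 𝕚 ((((-q) ^ n)⁻¹ • θ.toLinearMap) v) := fun v => by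
    have := hθ v
    rw [hR.moveRight_tau, LinearMap.smul_apply] at this
    rw [LinearMap.smul_apply, map_smul, mul_smul_comm, LinearEquiv.coe_coe, ← this, smul_smul,
      inv_mul_cancel₀ hq, one_smul]
  obtain ⟨J, _, f, z, hz, h1, h2⟩ := ht.exists_rank_one_sum hR hn hϑ hψ hkl.symm
  -- The normalized operator is (-q)⁻ⁿ θ, and the scalar enters once for each of the `k` tensor
  -- factors.
  refine ⟨J, inferInstance, fun j => ((-q) ^ n) ^ k • f j, z, hz, fun u hu => ?_, ?_⟩
  · have h3 := h1 u hu
    rw [LinearMap.comp_smul, mapT_smul _ _ (ups_le_deg k hu)] at h3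
    have h4 := congrArg (fun w => ((-q) ^ n) ^ k • w) h3
    simp only [smul_smul, ← mul_pow, mul_inv_cancel₀ hq, one_pow, one_smul,
      Finset.smul_sum] at h4
    rw [h4]
    simp
  · rw [← trace_value hR.ne_zero hn hkl.symm, ← h2]
    simp [Finset.mul_sum]

end Volume

/-! ### Reversal of tensor factors, which exchanges the two theta operators. -/

section Mirror

variable {K V : Type*} [Field K] [AddCommGroup V] [Module K V]

local notation "𝕋" => TensorAlgebra K V
local notation "𝕚" => TensorAlgebra.ι K

variable {n : ℕ} {t : TensorAlgebra K V}

/-- The operator obtained from `R` by reversing the order of tensor factors. -/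
def mirror (R : V ⊗[K] V →ₗ[K] V ⊗[K] V) : V ⊗[K] V →ₗ[K] V ⊗[K] V :=
  (TensorProduct.comm K V V).toLinearMap ∘ₗ R ∘ₗ (TensorProduct.comm K V V).toLinearMap

theorem mirror_apply (R : V ⊗[K] V →ₗ[K] V ⊗[K] V) (z : V ⊗[K] V) :
    mirror R z = TensorProduct.comm K V V (R (TensorProduct.comm K V V z)) := rfl

theorem comm_comm_apply (z : V ⊗[K] V) :
    TensorProduct.comm K V V (TensorProduct.comm K V V z) = z :=
  (TensorProduct.comm K V V).symm_apply_apply z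

theorem mirror_mirror (R : V ⊗[K] V →ₗ[K] V ⊗[K] V) : mirror (mirror R) = R := by
  ext v w
  simp only [TensorProduct.AlgebraTensorModule.curry_apply, TensorProduct.curry_apply,
    LinearMap.coe_restrictScalars, mirror_apply, comm_comm_apply]

theorem rev_mulTwo (z : V ⊗[K] V) :
    rev (mulTwo K V z) = mulTwo K V (TensorProduct.comm K V V z) := by
  induction z using TensorProduct.induction_on with
  | zero => simp
  | tmul v w => simp [rev_mul]
  | add x y hx hy => simp only [map_add, hx, hy]

/-- Reversal interchanges left and right contractions, hence inverts the rotation. This is why ψ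
occurs with opposite exponents in the two trace formulas. -/
theorem IsRot.mirror {ψ : V ≃ₗ[K] V} (h : IsRot t ψ) : IsRot (rev t) ψ.symm := by
  intro f
  have h1 := h (ψ.symm.toLinearMap.dualMap f)
  have h2 : ψ.toLinearMap.dualMap (ψ.symm.toLinearMap.dualMap f) = f := by
    ext v; simp
  rw [h2, rc_apply] at h1
  rw [rc_apply, rev_rev, ← h1, rev_rev]

variable [FiniteDimensional K V] {q : K} {R : V ⊗[K] V →ₗ[K] V ⊗[K] V}

theorem rev_tau (R : V ⊗[K] V →ₗ[K] V ⊗[K] V) {i j m : ℕ} (h : i + 2 + j = m) {x : 𝕋}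
    (hx : x ∈ deg K V m) : rev (tau R i x) = tau (mirror R) j (rev x) := by
  subst h
  rw [add_assoc, show 2 + j = j + 1 + 1 by omega] at hx
  refine eqOn_deg_add (φ := rev ∘ₗ tau R i) (χ := tau (mirror R) j ∘ₗ rev)
    (fun y hy z hz => ?_) hx
  refine eqOn_deg_succ (φ := (rev ∘ₗ tau R i) ∘ₗ LinearMap.mulLeft K y)
    (χ := (tau (mirror R) j ∘ₗ rev) ∘ₗ LinearMap.mulLeft K y) (fun v w hw => ?_) hz
  refine eqOn_deg_succ
    (φ := (rev ∘ₗ tau R i) ∘ₗ LinearMap.mulLeft K y ∘ₗ LinearMap.mulLeft K (𝕚 v))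
    (χ := (tau (mirror R) j ∘ₗ rev) ∘ₗ LinearMap.mulLeft K y ∘ₗ LinearMap.mulLeft K (𝕚 v))
    (fun w u hu => ?_) hw
  have h1 := tau_mul_left R 0 hy (𝕚 v * (𝕚 w * u))
  have h2 := tau_mul_left (mirror R) 0 (rev_mem_deg hu) (𝕚 w * (𝕚 v * rev y))
  rw [add_zero, tau_zero_tmul] at h1 h2
  simp only [LinearMap.comp_apply, LinearMap.mulLeft_apply, h1, rev_mul, rev_ι, rev_mulTwo]
  simp only [mul_assoc] at h2 ⊢
  rw [h2, mirror_apply, TensorProduct.comm_tmul]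

theorem rev_gen {i j m : ℕ} (h : i + 2 + j = m) {x : 𝕋}
    (hx : x ∈ deg K V m) : rev (gen q R i x) = gen q (mirror R) j (rev x) := by
  rw [gen_apply, map_smul, rev_tau R h hx, gen_apply]

theorem IsHecke.mirror (hR : IsHecke q R) : IsHecke q (mirror R) where
  ne_zero := hR.ne_zero
  hecke z := by
    simp only [mirror_apply, comm_comm_apply, hR.hecke, map_add, map_smul]
  braid x hx := by
    have h0 : ∀ y ∈ deg K V 3, tau (HeckeSym.mirror R) 0 (rev y) = rev (tau R 1 y) := fun y hy =>
      (rev_tau R (by norm_num) hy).symm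
    have h1 : ∀ y ∈ deg K V 3, tau (HeckeSym.mirror R) 1 (rev y) = rev (tau R 0 y) := fun y hy =>
      (rev_tau R (by norm_num) hy).symm
    have d : ∀ i, ∀ y ∈ deg K V 3, tau R i y ∈ deg K V 3 := fun i y hy => tau_mem_deg R i hy
    obtain ⟨y, hy, rfl⟩ : ∃ y ∈ deg K V 3, rev y = x := ⟨rev x, rev_mem_deg hx, rev_rev x⟩
    rw [h0 _ hy, h1 _ (d _ _ hy), h0 _ (d _ _ (d _ _ hy)), h1 _ hy, h0 _ (d _ _ hy),
      h1 _ (d _ _ (d _ _ hy)), hR.braid y hy]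

theorem rev_mem_ups {m : ℕ} {x : 𝕋} (hx : x ∈ ups q R m) : rev x ∈ ups q (mirror R) m := by
  rw [mem_ups] at hx ⊢
  refine ⟨rev_mem_deg hx.1, fun i hi => ?_⟩
  obtain ⟨j, hj⟩ : ∃ j, j + 2 + i = m := ⟨m - (i + 2), by omega⟩
  have h : ∀ z ∈ deg K V m, rev (gen q R j z) = gen q (mirror R) i (rev z) := fun z hz =>
    rev_gen hj hz
  obtain ⟨z, hz, rfl⟩ := mem_img.1 (hx.2 j (by omega))
  exact mem_img.2 ⟨rev z, rev_mem_deg hz, by rw [map_add, h z hz]⟩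

theorem rev_mem_ups' {m : ℕ} {x : 𝕋} (hx : x ∈ ups q (mirror R) m) : rev x ∈ ups q R m := by
  have := rev_mem_ups hx
  rwa [mirror_mirror] at this

theorem IsVolume.mirror (ht : IsVolume q R n t) : IsVolume q (mirror R) n (rev t) where
  ne_zero h := ht.ne_zero (by rw [← rev_rev t, h, map_zero])
  ups_eq := by
    apply le_antisymm
    · intro x hx
      have := rev_mem_ups' hx
      rw [ht.ups_eq, Submodule.mem_span_singleton] at this
      obtain ⟨r, hr⟩ := this
      rw [← rev_rev x, ← hr, map_smul]
      exact Submodule.smul_mem _ _ (Submodule.mem_span_singleton_self _)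
    · rw [Submodule.span_singleton_le_iff_mem]
      exact rev_mem_ups ht.mem
  vanish := by
    rw [eq_bot_iff]
    intro x hx
    have := rev_mem_ups' hx
    rw [ht.vanish, Submodule.mem_bot] at this
    rw [Submodule.mem_bot, ← rev_rev x, this, map_zero]

/-- The product `c_0 c_1 ⋯ c_(j-1)`. -/
def moveLeft {E : Type*} [Ring E] (c : ℕ → E) : ℕ → E
  | 0 => 1
  | j + 1 => moveLeft c j * c j

theorem rev_moveLeft {j s : ℕ} {x : 𝕋} (hx : x ∈ deg K V (s + j + 1)) :
    rev (moveLeft (tau R) j x) = moveRight (tau (mirror R)) s j (rev x) := by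
  induction j generalizing s x with
  | zero => rfl
  | succ j ih =>
    rw [moveLeft, Module.End.mul_apply, moveRight_succ', Module.End.mul_apply,
      ← rev_tau R (i := j) (by omega) hx]
    refine ih ?_
    rw [show s + 1 + j + 1 = s + (j + 1) + 1 by omega]
    exact tau_mem_deg R j hx

/-- The property `T_1 ⋯ T_n (t v) = θ'(v) t` in the tensor algebra. -/
def IsThetaBarT (R : V ⊗[K] V →ₗ[K] V ⊗[K] V) (n : ℕ) (t : TensorAlgebra K V) (θ : V ≃ₗ[K] V) :
    Prop :=
  ∀ v, moveLeft (tau R) n (t * 𝕚 v) = 𝕚 (θ v) * t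

theorem isThetaBarT_iff (ht : t ∈ deg K V n) {θ : V ≃ₗ[K] V} :
    IsThetaBarT R n t θ ↔ IsThetaT (mirror R) n (rev t) θ := by
  refine forall_congr' fun v => ?_
  have h1 : rev (moveLeft (tau R) n (t * 𝕚 v)) =
      moveRight (tau (mirror R)) 0 n (𝕚 v * rev t) := by
    rw [rev_moveLeft (s := 0) (by rw [zero_add]; exact snoc_mem_deg v ht), rev_mul, rev_ι]
  rw [← h1]
  constructor
  · intro h
    rw [h, rev_mul, rev_ι]
  · intro h
    have := congrArg rev h
    rwa [rev_rev, rev_mul, rev_rev, rev_ι] at this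

theorem IsVolume.existsUnique_thetaBarT (ht : IsVolume q R n t) (hR : IsHecke q R) :
    ∃! θ : V ≃ₗ[K] V, IsThetaBarT R n t θ := by
  simp only [isThetaBarT_iff ht.mem_deg]
  exact ht.mirror.existsUnique_thetaT hR.mirror

theorem IsVolume.exists_rank_one_sum_thetaBar (ht : IsVolume q R n t) (hR : IsHecke q R)
    (hn : 0 < n) {θ : V ≃ₗ[K] V} (hθ : IsThetaBarT R n t θ) {ψ : V ≃ₗ[K] V} (hψ : IsRot t ψ)
    {k : ℕ} (hk : k ≤ n) :
    ∃ (J : Type) (_ : Fintype J) (f : J → 𝕋 →ₗ[K] K) (z : J → 𝕋), (∀ j, z j ∈ ups q R k) ∧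
      (∀ u ∈ ups q R k,
        mapT (ψ.toLinearMap ∘ₗ θ.toLinearMap) u = ∑ j, f j u • z j) ∧
      ∑ j, f j (z j) = (-1) ^ (k * n - k) * q ^ (k * (k + 1) / 2) * qBinom q n k := by
  obtain ⟨J, _, f, z, hz, h1, h2⟩ := ht.mirror.exists_rank_one_sum_theta hR.mirror hn
    ((isThetaBarT_iff ht.mem_deg).1 hθ) hψ.mirror hk
  refine ⟨J, inferInstance, fun j => f j ∘ₗ rev, fun j => rev (z j),
    fun j => rev_mem_ups' (hz j), fun u hu => ?_, by simpa using h2⟩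
  have h3 := congrArg rev (h1 (rev u) (rev_mem_ups hu))
  rw [rev_mapT, rev_rev] at h3
  simpa using h3

end Mirror

/-! ### The quadratic dual, its action by contractions, and the Nakayama automorphism. -/

section QuadraticDual

variable {K V : Type*} [Field K] [AddCommGroup V] [Module K V]

local notation "𝕋" => TensorAlgebra K V
local notation "𝔻" => TensorAlgebra K (Module.Dual K V)
local notation "𝕚" => TensorAlgebra.ι K

/-! ### Quadratic algebras -/

section QuadAlg

variable (W : Submodule K (V ⊗[K] V))

/-- The projection of the tensor algebra onto a quadratic algebra. -/
def quadMk : 𝕋 →ₐ[K] QuadAlg W := RingQuot.mkAlgHom K (QuadRel W)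

@[simp] theorem quadMk_ι (v : V) : quadMk W (𝕚 v) = QuadAlg.gen W v := rfl

theorem quadMk_mulTwo {w : V ⊗[K] V} (hw : w ∈ W) : quadMk W (mulTwo K V w) = 0 := by
  have := RingQuot.mkAlgHom_rel K (QuadRel.of w hw)
  rwa [map_zero] at this

theorem quadMk_mulTwo_eq (z : V ⊗[K] V) :
    quadMk W (mulTwo K V z) = LinearMap.mul' K (QuadAlg W)
      (TensorProduct.map (QuadAlg.gen W) (QuadAlg.gen W) z) := by
  induction z using TensorProduct.induction_on with
  | zero => simp
  | tmul v w => simp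
  | add x y hx hy => simp only [map_add, hx, hy]

theorem component_eq_map (k : ℕ) :
    QuadAlg.component W k = (deg K V k).map (quadMk W).toLinearMap := by
  rw [QuadAlg.component, deg, Submodule.map_pow, ← LinearMap.range_comp]
  rfl

theorem mem_component {k : ℕ} {a : QuadAlg W} :
    a ∈ QuadAlg.component W k ↔ ∃ x ∈ deg K V k, quadMk W x = a := by
  rw [component_eq_map]; simp

theorem component_mul {a b : ℕ} {x y : QuadAlg W} (hx : x ∈ QuadAlg.component W a)
    (hy : y ∈ QuadAlg.component W b) : x * y ∈ QuadAlg.component W (a + b) := by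
  rw [QuadAlg.component, pow_add]
  exact Submodule.mul_mem_mul hx hy

theorem gen_mem_component (v : V) : QuadAlg.gen W v ∈ QuadAlg.component W 1 := by
  rw [QuadAlg.component, pow_one]
  exact ⟨v, rfl⟩

variable {W}

theorem quadAlg_hom_ext {B : Type*} [Ring B] [Algebra K B] {φ χ : QuadAlg W →ₐ[K] B}
    (h : ∀ v, φ (QuadAlg.gen W v) = χ (QuadAlg.gen W v)) : φ = χ := by
  refine RingQuot.ringQuot_ext' K _ _ (TensorAlgebra.hom_ext ?_)
  ext v
  exact h v

theorem lift_mulTwo {B : Type*} [Ring B] [Algebra K B] (g : V →ₗ[K] B) (z : V ⊗[K] V) :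
    TensorAlgebra.lift K g (mulTwo K V z) =
      LinearMap.mul' K B (TensorProduct.map g g z) := by
  induction z using TensorProduct.induction_on with
  | zero => simp
  | tmul v w => simp
  | add x y hx hy => simp only [map_add, hx, hy]

/-- The homomorphism from a quadratic algebra given by a linear map compatible with the
relations. -/
def quadLift {B : Type*} [Ring B] [Algebra K B] (g : V →ₗ[K] B)
    (h : ∀ w ∈ W, LinearMap.mul' K B (TensorProduct.map g g w) = 0) : QuadAlg W →ₐ[K] B :=
  RingQuot.liftAlgHom K ⟨TensorAlgebra.lift K g, fun x y hxy => by
    obtain ⟨w, hw⟩ := hxy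
    rw [map_zero]
    exact (lift_mulTwo g w).trans (h w hw)⟩

theorem quadLift_mk {B : Type*} [Ring B] [Algebra K B] (g : V →ₗ[K] B)
    (h : ∀ w ∈ W, LinearMap.mul' K B (TensorProduct.map g g w) = 0) (x : 𝕋) :
    quadLift g h (quadMk W x) = TensorAlgebra.lift K g x := by
  rw [quadLift, quadMk, RingQuot.liftAlgHom_mkAlgHom_apply]

theorem quadLift_gen {B : Type*} [Ring B] [Algebra K B] (g : V →ₗ[K] B)
    (h : ∀ w ∈ W, LinearMap.mul' K B (TensorProduct.map g g w) = 0) (v : V) :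
    quadLift g h (QuadAlg.gen W v) = g v := by
  rw [← quadMk_ι, quadLift_mk, TensorAlgebra.lift_ι_apply]

theorem map_component {φ : QuadAlg W →ₐ[K] QuadAlg W}
    (h : ∀ v, φ (QuadAlg.gen W v) ∈ QuadAlg.component W 1) {k : ℕ} {a : QuadAlg W}
    (ha : a ∈ QuadAlg.component W k) : φ a ∈ QuadAlg.component W k := by
  obtain ⟨x, hx, rfl⟩ := (mem_component W).1 ha
  induction k generalizing x with
  | zero =>
    obtain ⟨r, rfl⟩ := mem_deg_zero.1 hx
    simpa using ha
  | succ k ih =>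
    refine deg_succ_le (S := (QuadAlg.component W (k + 1)).comap
      (φ.toLinearMap ∘ₗ (quadMk W).toLinearMap)) (fun v y hy => ?_) hx
    simp only [Submodule.mem_comap, LinearMap.comp_apply, AlgHom.toLinearMap_apply, map_mul,
      quadMk_ι]
    rw [add_comm]
    exact component_mul W (h v) (ih y hy ((mem_component W).2 ⟨y, hy, rfl⟩))

end QuadAlg

theorem mulTwo_surjOn {x : 𝕋} (hx : x ∈ deg K V 2) : ∃ z, mulTwo K V z = x := by
  have h : deg K V (1 + 1) ≤ LinearMap.range (mulTwo K V) := by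
    refine deg_succ_le fun v y hy => ?_
    obtain ⟨w, rfl⟩ := mem_deg_one.1 hy
    exact ⟨v ⊗ₜ w, mulTwo_tmul v w⟩
  exact h hx

theorem mem_dualRelations {W : Submodule K (V ⊗[K] V)}
    {w : Module.Dual K V ⊗[K] Module.Dual K V} :
    w ∈ dualRelations W ↔ ∀ z ∈ W, TensorProduct.dualDistrib K V V w z = 0 := by
  rw [dualRelations, Submodule.mem_comap, Submodule.mem_dualAnnihilator]

theorem dualDistrib_map (χ : V →ₗ[K] V) (w : Module.Dual K V ⊗[K] Module.Dual K V)
    (z : V ⊗[K] V) :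
    TensorProduct.dualDistrib K V V (TensorProduct.map χ.dualMap χ.dualMap w) z =
      TensorProduct.dualDistrib K V V w (TensorProduct.map χ χ z) := by
  induction w using TensorProduct.induction_on with
  | zero => simp
  | add w w' h h' => simp only [map_add, LinearMap.add_apply, h, h']
  | tmul f g =>
    induction z using TensorProduct.induction_on with
    | zero => simp
    | add z z' h h' => simp only [map_add, h, h']
    | tmul v w => simp

theorem mapT_mulTwo (χ : V →ₗ[K] V) (z : V ⊗[K] V) :
    mapT χ (mulTwo K V z) = mulTwo K V (TensorProduct.map χ χ z) := by
  induction z using TensorProduct.induction_on with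
  | zero => simp
  | tmul v w => simp
  | add x y hx hy => simp only [map_add, hx, hy]

/-- The endomorphism of the quadratic dual given by the operator dual to `χ`. -/
def quadDualMap (W : Submodule K (V ⊗[K] V)) (χ : V →ₗ[K] V)
    (h : ∀ z ∈ W, TensorProduct.map χ χ z ∈ W) :
    QuadAlg (dualRelations W) →ₐ[K] QuadAlg (dualRelations W) :=
  quadLift (QuadAlg.gen (dualRelations W) ∘ₗ χ.dualMap) fun w hw => by
    rw [TensorProduct.map_comp, LinearMap.comp_apply, ← quadMk_mulTwo_eq]
    refine quadMk_mulTwo (dualRelations W) (mem_dualRelations.2 fun z hz => ?_)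
    rw [dualDistrib_map]
    exact mem_dualRelations.1 hw _ (h z hz)

theorem quadDualMap_gen {W : Submodule K (V ⊗[K] V)} {χ : V →ₗ[K] V}
    (h : ∀ z ∈ W, TensorProduct.map χ χ z ∈ W) (f : Module.Dual K V) :
    quadDualMap W χ h (QuadAlg.gen _ f) = QuadAlg.gen _ (χ.dualMap f) := by
  rw [quadDualMap, quadLift_gen, LinearMap.comp_apply]

/-- The automorphism of the quadratic dual given by the operator dual to `χ`. -/
def quadDualEquiv (W : Submodule K (V ⊗[K] V)) (χ : V ≃ₗ[K] V)
    (h : ∀ z ∈ W, TensorProduct.map χ.toLinearMap χ.toLinearMap z ∈ W)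
    (h' : ∀ z ∈ W, TensorProduct.map χ.symm.toLinearMap χ.symm.toLinearMap z ∈ W) :
    QuadAlg (dualRelations W) ≃ₐ[K] QuadAlg (dualRelations W) :=
  AlgEquiv.ofAlgHom (quadDualMap W χ.toLinearMap h) (quadDualMap W χ.symm.toLinearMap h')
    (quadAlg_hom_ext fun f => by
      rw [AlgHom.comp_apply, quadDualMap_gen, quadDualMap_gen, AlgHom.id_apply]
      congr 1
      ext v; simp)
    (quadAlg_hom_ext fun f => by
      rw [AlgHom.comp_apply, quadDualMap_gen, quadDualMap_gen, AlgHom.id_apply]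
      congr 1
      ext v; simp)

variable [FiniteDimensional K V] {q : K} {R : V ⊗[K] V →ₗ[K] V ⊗[K] V}

local notation "𝔢" => Module.finBasis K V

/-! ### The action of the tensor algebra of the dual space by right contractions -/

/-- The right contraction as a linear map in the linear form. -/
def rcHom : Module.Dual K V →ₗ[K] Module.End K 𝕋 where
  toFun := rc
  map_add' f g := by ext1 x; exact rc_add f g x
  map_smul' r f := by ext1 x; exact rc_smul r f x

theorem rcHom_apply (f : Module.Dual K V) : (rcHom f : Module.End K 𝕋) = rc f := rfl

/-- The action of the tensor algebra of `V*` by right contractions. -/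
def contr : 𝔻 →ₐ[K] Module.End K 𝕋 := TensorAlgebra.lift K rcHom

@[simp] theorem contr_ι (f : Module.Dual K V) : contr (𝕚 f) = (rc f : Module.End K 𝕋) := by
  rw [contr, TensorAlgebra.lift_ι_apply, rcHom_apply]

theorem contr_mul_apply (a b : 𝔻) (x : 𝕋) : contr (a * b) x = contr a (contr b x) := by
  rw [map_mul, Module.End.mul_apply]

theorem contr_mem_deg {m k : ℕ} {a : 𝔻} (ha : a ∈ deg K (Module.Dual K V) m) {x : 𝕋}
    (hx : x ∈ deg K V (k + m)) : contr a x ∈ deg K V k := by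
  induction m generalizing a x with
  | zero =>
    obtain ⟨r, rfl⟩ := mem_deg_zero.1 ha
    simpa [Module.algebraMap_end_apply] using Submodule.smul_mem _ r hx
  | succ m ih =>
    refine deg_succ_le' (S := (deg K V k).comap (LinearMap.applyₗ x ∘ₗ contr.toLinearMap))
      (fun f b hb => ?_) ha
    simp only [Submodule.mem_comap, LinearMap.comp_apply, AlgHom.toLinearMap_apply,
      LinearMap.applyₗ_apply_apply, contr_mul_apply, contr_ι]
    exact ih hb (rc_mem_deg f hx)

/-- Contractions from opposite ends commute; the degree leaves at least one factor for `lc f`. -/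
theorem contr_lc {m k : ℕ} (f : Module.Dual K V) {a : 𝔻} (ha : a ∈ deg K (Module.Dual K V) m)
    {x : 𝕋} (hx : x ∈ deg K V (k + 1 + m)) : contr a (lc f x) = lc f (contr a x) := by
  induction m generalizing a x with
  | zero =>
    obtain ⟨r, rfl⟩ := mem_deg_zero.1 ha
    simp [Module.algebraMap_end_apply]
  | succ m ih =>
    refine eqOn_deg_succ' (φ := LinearMap.applyₗ (lc f x) ∘ₗ contr.toLinearMap)
      (χ := lc f ∘ₗ LinearMap.applyₗ x ∘ₗ contr.toLinearMap) (fun g b hb => ?_) ha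
    simp only [LinearMap.comp_apply, AlgHom.toLinearMap_apply,
      LinearMap.applyₗ_apply_apply, contr_mul_apply, contr_ι]
    rw [← lc_rc_comm f g (m := k + m) (by
      rwa [show k + 1 + (m + 1) = k + m + 2 by omega] at hx), ih hb (rc_mem_deg g hx)]

theorem eq_zero_of_contr {m : ℕ} {x : 𝕋} (hx : x ∈ deg K V m)
    (h : ∀ a ∈ deg K (Module.Dual K V) m, contr a x = 0) : x = 0 := by
  induction m generalizing x with
  | zero => simpa using h 1 one_mem_deg
  | succ m ih =>
    refine eq_zero_of_rc hx fun f => ih (rc_mem_deg f hx) fun a ha => ?_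
    have := h (a * 𝕚 f) (snoc_mem_deg f ha)
    rwa [contr_mul_apply, contr_ι] at this

/-- In a product the right-hand form acts first and meets the last factor, so right contractions
agree with the pairing f(v) g(w). -/
theorem contr_mulTwo {x : 𝕋} (w : Module.Dual K V ⊗[K] Module.Dual K V) (z : V ⊗[K] V) :
    contr (mulTwo K (Module.Dual K V) w) (x * mulTwo K V z) =
      TensorProduct.dualDistrib K V V w z • x := by
  induction w using TensorProduct.induction_on with
  | zero => simp
  | add w w' h h' => simp only [map_add, LinearMap.add_apply, add_smul, h, h']
  | tmul f g =>
    induction z using TensorProduct.induction_on with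
    | zero => simp
    | add z z' h h' => simp only [map_add, mul_add, add_smul, h, h']
    | tmul v w =>
      rw [mulTwo_tmul, mulTwo_tmul, contr_mul_apply, contr_ι, contr_ι, ← mul_assoc, rc_snoc,
        map_smul, rc_snoc, smul_smul, TensorProduct.dualDistrib_apply, mul_comm]

theorem dualDistrib_surjective :
    Function.Surjective (TensorProduct.dualDistrib K V V) := fun φ => by
  obtain ⟨w, hw⟩ := (TensorProduct.dualDistribEquiv K V V).surjective φ
  exact ⟨w, hw⟩

theorem mulTwo_injective : Function.Injective (mulTwo K V) := by
  rw [← LinearMap.ker_eq_bot, LinearMap.ker_eq_bot']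
  intro z hz
  rw [← Module.forall_dual_apply_eq_zero_iff K]
  intro φ
  obtain ⟨w, rfl⟩ := dualDistrib_surjective φ
  have := contr_mulTwo (x := (1 : 𝕋)) w z
  rw [hz, mul_zero, map_zero] at this
  exact (smul_eq_zero.1 this.symm).resolve_right one_ne_zero

theorem mulTwo_mem_ups_iff (hq : q ≠ 0) {z : V ⊗[K] V} :
    mulTwo K V z ∈ ups q R 2 ↔ z ∈ symRelations q R := by
  have h1 : ∀ z, gen q R 0 (mulTwo K V z) = (-q⁻¹) • mulTwo K V (R z) := fun z => by
    have := tau_zero_mulTwo R z 1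
    rw [mul_one, mul_one] at this
    rw [gen_apply, this]
  rw [mem_ups]
  constructor
  · rintro ⟨-, h⟩
    obtain ⟨y, hy, h⟩ := mem_img.1 (h 0 (by omega))
    obtain ⟨y, rfl⟩ := mulTwo_surjOn hy
    rw [h1, ← map_smul, ← map_add] at h
    rw [← mulTwo_injective h]
    refine ⟨(-q⁻¹) • y, ?_⟩
    simp [smul_smul, hq, add_comm]
  · rintro ⟨y, rfl⟩
    refine ⟨mulTwo_mem_deg _, fun i hi => mem_img.2 ⟨mulTwo K V ((-q) • y), mulTwo_mem_deg _, ?_⟩⟩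
    obtain rfl : i = 0 := by omega
    rw [h1]
    simp [smul_smul, hq]
    abel

/-- The double annihilator property, valid because in finite dimension every form on V ⊗ V comes
from V* ⊗ V*. -/
theorem mem_of_dualRelations {W : Submodule K (V ⊗[K] V)} {z : V ⊗[K] V}
    (h : ∀ w ∈ dualRelations W, TensorProduct.dualDistrib K V V w z = 0) : z ∈ W := by
  by_contra hz
  obtain ⟨φ, hφ, hW⟩ := Submodule.exists_le_ker_of_notMem hz
  obtain ⟨w, rfl⟩ := dualDistrib_surjective φ
  exact hφ (h w (mem_dualRelations.2 fun z hz => hW hz))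

theorem contr_mulTwo_of_low (w : Module.Dual K V ⊗[K] Module.Dual K V) {x : 𝕋}
    (hx : ∀ f g : Module.Dual K V, rc f (rc g x) = 0) :
    contr (mulTwo K (Module.Dual K V) w) x = 0 := by
  induction w using TensorProduct.induction_on with
  | zero => simp
  | tmul f g => rw [mulTwo_tmul, contr_mul_apply, contr_ι, contr_ι, hx]
  | add w w' h h' => rw [map_add, map_add, LinearMap.add_apply, h, h', add_zero]

/-- The last two factors of an element of Υ^(j) form a tensor in Im(R - q), which the relations of
the quadratic dual annihilate. -/
theorem contr_mulTwo_ups (hq : q ≠ 0) {w : Module.Dual K V ⊗[K] Module.Dual K V}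
    (hw : w ∈ dualRelations (symRelations q R)) {j : ℕ} {x : 𝕋} (hx : x ∈ ups q R j) :
    contr (mulTwo K (Module.Dual K V) w) x = 0 := by
  rcases j with _ | _ | j
  · obtain ⟨r, rfl⟩ := mem_deg_zero.1 (ups_le_deg 0 hx)
    exact contr_mulTwo_of_low w fun f g => by rw [rc_algebraMap, map_zero]
  · obtain ⟨v, rfl⟩ := mem_deg_one.1 (ups_le_deg 1 hx)
    exact contr_mulTwo_of_low w fun f g => by rw [rc_ι, rc_algebraMap]
  · have h := seg_le_mul (q := q) (R := R) j 2 (seg_mono (by omega) (by omega) hx)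
    suffices hle : deg K V j * ups q R 2 ≤
        LinearMap.ker (contr (mulTwo K (Module.Dual K V) w)) from hle h
    refine Submodule.mul_le.2 fun y hy z hz => ?_
    obtain ⟨z, rfl⟩ := mulTwo_surjOn (ups_le_deg 2 hz)
    rw [LinearMap.mem_ker, contr_mulTwo,
      mem_dualRelations.1 hw z ((mulTwo_mem_ups_iff hq).1 hz), zero_smul]

/-- The sum of all spaces `Υ^(j)`. -/
def upsTotal (q : K) (R : V ⊗[K] V →ₗ[K] V ⊗[K] V) : Submodule K 𝕋 := ⨆ j, ups q R j

theorem ups_le_upsTotal (j : ℕ) : ups q R j ≤ upsTotal q R := le_iSup (ups q R) j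

theorem rc_mem_upsTotal (f : Module.Dual K V) {x : 𝕋} (hx : x ∈ upsTotal q R) :
    rc f x ∈ upsTotal q R := by
  suffices h : upsTotal q R ≤ (upsTotal q R).comap (rc f) from h hx
  refine iSup_le fun j x hx => ?_
  rcases j with _ | j
  · obtain ⟨r, rfl⟩ := mem_deg_zero.1 (ups_le_deg 0 hx)
    rw [Submodule.mem_comap, rc_algebraMap]
    exact Submodule.zero_mem _
  · exact ups_le_upsTotal j (rc_mem_ups f hx)

/-- The action of `V*` by right contractions on the sum of all `Υ^(j)`. -/
def rcTotal (q : K) (R : V ⊗[K] V →ₗ[K] V ⊗[K] V) :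
    Module.Dual K V →ₗ[K] Module.End K (upsTotal q R) where
  toFun f := (rc f).restrict fun _ hx => rc_mem_upsTotal f hx
  map_add' f g := by ext x; exact rc_add f g x.1
  map_smul' r f := by ext x; exact rc_smul r f x.1

theorem lift_rcTotal (a : 𝔻) (x : upsTotal q R) :
    (TensorAlgebra.lift K (rcTotal q R) a x : 𝕋) = contr a x := by
  induction a using TensorAlgebra.induction generalizing x with
  | algebraMap r => simp [Module.algebraMap_end_apply]
  | ι f => simp only [TensorAlgebra.lift_ι_apply, contr_ι]; rfl
  | mul a b ha hb => rw [map_mul, Module.End.mul_apply, ha, hb, contr_mul_apply]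
  | add a b ha hb =>
    rw [map_add, map_add, LinearMap.add_apply, LinearMap.add_apply, ← ha, ← hb]; rfl

/-- The action of the quadratic dual algebra on the sum of all `Υ^(j)`. -/
def quadAct (hq : q ≠ 0) (R : V ⊗[K] V →ₗ[K] V ⊗[K] V) :
    QuadAlg (dualRelations (symRelations q R)) →ₐ[K] Module.End K (upsTotal q R) :=
  quadLift (B := Module.End K (upsTotal q R)) (rcTotal q R) fun w hw => by
    rw [← lift_mulTwo (B := Module.End K (upsTotal q R))]
    have h : upsTotal q R ≤ LinearMap.ker (contr (mulTwo K (Module.Dual K V) w)) :=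
      iSup_le fun j x hx => contr_mulTwo_ups hq hw hx
    ext x
    rw [lift_rcTotal]
    exact h x.2

/-- If two elements of the tensor algebra of `V*` coincide in the quadratic dual, then they act
in the same way on `Υ^(j)`. -/
theorem contr_eq_of_quadMk_eq (hq : q ≠ 0) {a b : 𝔻}
    (h : quadMk (dualRelations (symRelations q R)) a =
      quadMk (dualRelations (symRelations q R)) b) {j : ℕ} {x : 𝕋} (hx : x ∈ ups q R j) :
    contr a x = contr b x := by
  have h1 := congrArg (fun y => ((quadAct hq R y ⟨x, ups_le_upsTotal j hx⟩ : upsTotal q R) : 𝕋)) h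
  simpa only [quadAct, quadLift_mk, lift_rcTotal] using h1

/-! ### Linear forms on the quadratic dual as elements of `Υ^(n)` -/

/-- The element `s` of `V^(⊗m)` such that `⟨a, s⟩ = φ(a)` for all `a` of degree `m`. -/
def dualElt : ℕ → Module.Dual K 𝔻 →ₗ[K] 𝕋
  | 0 => (LinearMap.applyₗ (1 : 𝔻)).smulRight (1 : 𝕋)
  | m + 1 => ∑ b, LinearMap.mulLeft K (𝕚 (𝔢 b)) ∘ₗ dualElt m ∘ₗ
      (LinearMap.mulLeft K (𝕚 (Module.Basis.coord 𝔢 b))).dualMap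

theorem dualElt_zero (φ : Module.Dual K 𝔻) : dualElt 0 φ = φ 1 • (1 : 𝕋) := rfl

theorem dualElt_succ (m : ℕ) (φ : Module.Dual K 𝔻) :
    (dualElt (m + 1) φ : 𝕋) = ∑ b, 𝕚 (𝔢 b) *
      dualElt m ((LinearMap.mulLeft K (𝕚 (Module.Basis.coord 𝔢 b))).dualMap φ) := by
  simp [dualElt]

theorem dualElt_mem_deg (m : ℕ) (φ : Module.Dual K 𝔻) :
    (dualElt m φ : 𝕋) ∈ deg K V m := by
  induction m generalizing φ with
  | zero => exact Submodule.smul_mem _ _ one_mem_deg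
  | succ m ih =>
    rw [dualElt_succ]
    exact Submodule.sum_mem _ fun b _ => cons_mem_deg _ (ih _)

theorem coord_expand (f : Module.Dual K V) :
    f = ∑ b, f (𝔢 b) • Module.Basis.coord 𝔢 b := by
  refine Module.Basis.ext 𝔢 fun a => ?_
  simp

theorem ι_dual_expand (f : Module.Dual K V) :
    𝕚 f = ∑ b, f (𝔢 b) • 𝕚 (Module.Basis.coord 𝔢 b) := by
  refine (congrArg 𝕚 (coord_expand f)).trans ?_
  rw [map_sum]
  simp only [map_smul]

/-- Right contraction by `f` is the transpose of right multiplication by `f`, although the recursion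
in `dualElt` runs from the left. -/
theorem rc_dualElt (m : ℕ) (f : Module.Dual K V) (φ : Module.Dual K 𝔻) :
    rc f (dualElt (m + 1) φ : 𝕋) = dualElt m ((LinearMap.mulRight K (𝕚 f)).dualMap φ) := by
  induction m generalizing φ with
  | zero =>
    have h : φ (𝕚 f) = ∑ b, φ (𝕚 (Module.Basis.coord 𝔢 b)) * f (𝔢 b) := by
      rw [ι_dual_expand f, map_sum]
      simp only [map_smul, smul_eq_mul, mul_comm]
    rw [dualElt_succ, dualElt_zero]
    simp [dualElt_zero, rc_ι, h, Finset.sum_smul, mul_smul,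
      Algebra.algebraMap_eq_smul_one]
  | succ m ih =>
    rw [dualElt_succ, dualElt_succ, map_sum]
    refine Finset.sum_congr rfl fun b _ => ?_
    rw [rc_cons f _ (dualElt_mem_deg _ _), ih]
    congr 2
    ext x
    simp [mul_assoc]

theorem contr_dualElt {m : ℕ} (φ : Module.Dual K 𝔻) {a : 𝔻}
    (ha : a ∈ deg K (Module.Dual K V) m) : contr a (dualElt m φ : 𝕋) = φ a • (1 : 𝕋) := by
  induction m generalizing φ a with
  | zero =>
    obtain ⟨r, rfl⟩ := mem_deg_zero.1 ha
    rw [AlgHom.commutes, Module.algebraMap_end_apply, dualElt_zero,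
      Algebra.algebraMap_eq_smul_one, map_smul, smul_smul, smul_eq_mul]
  | succ m ih =>
    refine eqOn_deg_succ' (φ := LinearMap.applyₗ (dualElt (m + 1) φ : 𝕋) ∘ₗ contr.toLinearMap)
      (χ := φ.smulRight (1 : 𝕋)) (fun f b hb => ?_) ha
    simp only [LinearMap.comp_apply, AlgHom.toLinearMap_apply,
      LinearMap.applyₗ_apply_apply, contr_mul_apply, contr_ι, rc_dualElt, ih _ hb]
    simp

theorem mulTwo_dual_expand (φ : Module.Dual K 𝔻) (w : Module.Dual K V ⊗[K] Module.Dual K V) :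
    TensorProduct.dualDistrib K V V w (∑ a, ∑ b,
      φ (𝕚 (Module.Basis.coord 𝔢 a) * 𝕚 (Module.Basis.coord 𝔢 b)) • (𝔢 a ⊗ₜ[K] 𝔢 b)) =
      φ (mulTwo K (Module.Dual K V) w) := by
  induction w using TensorProduct.induction_on with
  | zero => simp
  | add w w' h h' => rw [map_add, map_add, map_add, LinearMap.add_apply, h, h']
  | tmul f g =>
    rw [mulTwo_tmul, ι_dual_expand f, ι_dual_expand g, Finset.sum_mul_sum]
    simp only [map_sum, map_smul, smul_mul_smul_comm, TensorProduct.dualDistrib_apply,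
      smul_eq_mul]
    exact Finset.sum_congr rfl fun a _ => Finset.sum_congr rfl fun b _ => mul_comm _ _

/-- A linear form vanishing on the ideal of relations corresponds to an element of `Υ^(m)`. -/
theorem dualElt_mem_ups (hq : q ≠ 0) {φ : Module.Dual K 𝔻}
    (hφ : ∀ w ∈ dualRelations (symRelations q R), ∀ x y,
      φ (x * mulTwo K (Module.Dual K V) w * y) = 0) (m : ℕ) :
    (dualElt m φ : 𝕋) ∈ ups q R m := by
  refine mem_ups.2 ⟨dualElt_mem_deg _ _, fun i hi => ?_⟩
  induction i generalizing m φ with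
  -- At the first pair of positions, right contractions lower the degree to 2, where the double
  -- annihilator applies. Multiplying by a form on either side keeps `φ` zero on the ideal.
  | zero =>
    obtain ⟨m, rfl⟩ : ∃ m', m = m' + 2 := ⟨m - 2, by omega⟩
    induction m generalizing φ with
    | zero =>
      have h1 : (dualElt 2 φ : 𝕋) = mulTwo K V (∑ a, ∑ b,
          φ (𝕚 (Module.Basis.coord 𝔢 a) * 𝕚 (Module.Basis.coord 𝔢 b)) • (𝔢 a ⊗ₜ[K] 𝔢 b)) := by
        simp [dualElt_succ, dualElt_zero, Finset.mul_sum]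
      have h2 : (dualElt 2 φ : 𝕋) ∈ ups q R 2 := by
        rw [h1, mulTwo_mem_ups_iff hq]
        refine mem_of_dualRelations fun w hw => ?_
        rw [mulTwo_dual_expand]
        simpa using hφ w hw 1 1
      exact (mem_ups.1 h2).2 0 hi
    | succ m ih =>
      rw [← expand_snoc (dualElt_mem_deg (m + 1 + 2) φ)]
      refine Submodule.sum_mem _ fun a _ => ?_
      rw [show m + 1 + 2 = (m + 2) + 1 by omega, rc_dualElt]
      refine map_mem_img (g := LinearMap.mulRight K (𝕚 (𝔢 a))) (fun _ => snoc_mem_deg _)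
        (fun x hx => by simp [gen_mul_right (m := m + 2) 0 (by omega) hx])
        (ih (fun w hw x y => ?_) (by omega))
      simpa [mul_assoc] using hφ w hw x (y * 𝕚 (Module.Basis.coord 𝔢 a))
  | succ i ih =>
    obtain ⟨m, rfl⟩ : ∃ m', m = m' + 1 := ⟨m - 1, by omega⟩
    rw [dualElt_succ]
    refine Submodule.sum_mem _ fun b _ => ?_
    refine map_mem_img (g := LinearMap.mulLeft K (𝕚 (𝔢 b))) (fun _ => cons_mem_deg _)
      (fun x _ => by simp [gen_succ_cons]) (ih (fun w hw x y => ?_) m (by omega))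
    simpa [mul_assoc] using hφ w hw (𝕚 (Module.Basis.coord 𝔢 b) * x) y

variable {n : ℕ} {t : TensorAlgebra K V}

/-- Every linear form on the quadratic dual gives, in degree `n`, an element of Υ^(n) = K t, so its
value at `a` is a multiple of the pairing of `a` with `t`. -/
theorem IsVolume.quadMk_eq_zero (ht : IsVolume q R n t) (hq : q ≠ 0) {a : 𝔻}
    (ha : a ∈ deg K (Module.Dual K V) n) (h : contr a t = 0) :
    quadMk (dualRelations (symRelations q R)) a = 0 := by
  rw [← Module.forall_dual_apply_eq_zero_iff K]
  intro ψ
  set φ : Module.Dual K 𝔻 := ψ ∘ₗ (quadMk (dualRelations (symRelations q R))).toLinearMap with hφ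
  have h1 : (dualElt n φ : 𝕋) ∈ ups q R n := dualElt_mem_ups hq (fun w hw x y => by
    simp [hφ, quadMk_mulTwo _ hw]) n
  rw [ht.ups_eq, Submodule.mem_span_singleton] at h1
  obtain ⟨r, hr⟩ := h1
  have h2 := contr_dualElt φ ha
  rw [← hr, map_smul, h, smul_zero] at h2
  exact (smul_eq_zero.1 h2.symm).resolve_right one_ne_zero

/-! ### The Nakayama automorphism -/

/-- Let a f = ψ*(f) a act on `t` for `a` of degree n - 1. What remains after `a` has acted is a
vector, on which left and right contractions agree, so both sides become the action of `a` on
contractions of `t`. -/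
theorem IsVolume.isRot_of_isPsi (ht : IsVolume q R n t) (hq : q ≠ 0) (hn : 0 < n)
    {ψ : V ≃ₗ[K] V} (h : IsPsi q R n ψ) : IsRot t ψ := by
  obtain ⟨ν, hν, hψ⟩ := h
  obtain ⟨m, rfl⟩ : ∃ m, n = m + 1 := ⟨n - 1, by omega⟩
  intro f
  have htd := ht.mem_deg
  rw [← sub_eq_zero]
  refine eq_zero_of_contr (m := m)
    (Submodule.sub_mem _ (rc_mem_deg _ htd) (lc_mem_deg _ htd)) fun a ha => ?_
  have h1 := hν.mul_eq 1 (by omega) _ (gen_mem_component _ f)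
    (quadMk (dualRelations (symRelations q R)) a) ((mem_component _).2 ⟨a, by simpa using ha, rfl⟩)
  rw [hψ, ← quadMk_ι, ← quadMk_ι, ← map_mul, ← map_mul] at h1
  have h2 := contr_eq_of_quadMk_eq hq h1 ht.mem
  rw [contr_mul_apply, contr_mul_apply, contr_ι, contr_ι] at h2
  have htd' : t ∈ deg K V (0 + 1 + m) := by rwa [zero_add, add_comm]
  rw [map_sub, h2, contr_lc _ ha htd']
  obtain ⟨v, hv⟩ := mem_deg_one.1 (contr_mem_deg (k := 1) ha (by rwa [zero_add] at htd'))
  rw [← hv, rc_ι, lc_ι, sub_self]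

/-- The relations are Υ^(2), so they are preserved as contractions of `t`; for n = 1 they are zero.
-/
theorem IsVolume.map_mem_symRelations (ht : IsVolume q R n t) (hR : IsHecke q R) (hn : 0 < n)
    {χ : V ≃ₗ[K] V} (hχ : mapT χ.toLinearMap t = t) (z : V ⊗[K] V)
    (hz : z ∈ symRelations q R) :
    TensorProduct.map χ.toLinearMap χ.toLinearMap z ∈ symRelations q R := by
  rw [← mulTwo_mem_ups_iff hR.ne_zero] at hz ⊢
  rw [← mapT_mulTwo]
  obtain rfl | h2 : n = 1 ∨ 2 ≤ n := by omega
  · rw [ht.vanish, Submodule.mem_bot] at hz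
    rw [hz, map_zero]
    exact Submodule.zero_mem _
  · obtain ⟨l, rfl⟩ := Nat.exists_eq_add_of_le h2
    exact ht.mapT_mem_ups hR hχ rfl hz

theorem IsVolume.isPsi_of_isRot (ht : IsVolume q R n t) (hR : IsHecke q R) (hn : 0 < n)
    {ψ : V ≃ₗ[K] V} (h : IsRot t ψ) : IsPsi q R n ψ := by
  have hq := hR.ne_zero
  set W := symRelations q R with hW
  let ν := quadDualEquiv W ψ (ht.map_mem_symRelations hR hn (h.mapT_eq hn ht.mem_deg))
    (ht.map_mem_symRelations hR hn (χ := ψ.symm) (h.mapT_symm_eq hn ht.mem_deg))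
  have hν : ∀ f, ν (QuadAlg.gen _ f) = QuadAlg.gen _ (ψ.toLinearMap.dualMap f) := fun f =>
    quadDualMap_gen (ht.map_mem_symRelations hR hn (h.mapT_eq hn ht.mem_deg)) f
  -- Both sides have degree `n`, so it suffices to compare their actions on `t`, where the rotation
  -- property applies.
  have base : ∀ f, ∀ b ∈ QuadAlg.component (dualRelations W) (n - 1),
      b * QuadAlg.gen _ f = QuadAlg.gen _ (ψ.toLinearMap.dualMap f) * b := by
    intro f b hb
    obtain ⟨a, ha, rfl⟩ := (mem_component _).1 hb
    obtain ⟨m, rfl⟩ : ∃ m, n = m + 1 := ⟨n - 1, by omega⟩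
    rw [Nat.add_sub_cancel] at ha
    rw [← sub_eq_zero, ← quadMk_ι, ← quadMk_ι, ← map_mul, ← map_mul, ← map_sub]
    refine ht.quadMk_eq_zero hq (Submodule.sub_mem _ (snoc_mem_deg _ ha) (cons_mem_deg _ ha)) ?_
    have htd : t ∈ deg K V (0 + 1 + m) := by rw [zero_add, add_comm]; exact ht.mem_deg
    obtain ⟨v, hv⟩ := mem_deg_one.1 (contr_mem_deg (k := 1) ha (by rwa [zero_add] at htd))
    rw [map_sub, LinearMap.sub_apply, contr_mul_apply, contr_mul_apply, contr_ι, contr_ι, h f,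
      contr_lc _ ha htd, ← hv, rc_ι, lc_ι, sub_self]
  refine ⟨ν, ⟨fun k a ha => ?_, fun k => ?_⟩, hν⟩
  · refine map_component (φ := ν.toAlgHom) (fun f => ?_) ha
    change ν (QuadAlg.gen _ f) ∈ _
    rw [hν]
    exact gen_mem_component _ _
  · induction k with
    | zero =>
      intro _ a ha b _
      obtain ⟨x, hx, rfl⟩ := (mem_component _).1 ha
      obtain ⟨r, rfl⟩ := mem_deg_zero.1 hx
      rw [AlgHom.commutes, AlgEquiv.commutes, Algebra.commutes]
    | succ k ih =>
      intro hk a ha b hb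
      have hle : QuadAlg.component (dualRelations W) (k + 1) ≤
          LinearMap.eqLocus (LinearMap.mulLeft K b)
            (LinearMap.mulRight K b ∘ₗ ν.toLinearMap) := by
        rw [QuadAlg.component, pow_succ]
        -- For a product a f: the base case moves `f` around b a to the front as ψ*f, and the
        -- induction hypothesis then moves `a` around ψ*(f) b.
        refine Submodule.mul_le.2 fun a ha y hy => ?_
        obtain ⟨f, rfl⟩ := hy
        have h1 := base f (b * a) (by
          rw [show n - 1 = n - (k + 1) + k by omega]
          exact component_mul _ hb ha)
        have h2 := ih (by omega) a ha (QuadAlg.gen _ (ψ.toLinearMap.dualMap f) * b) (by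
          rw [show n - k = 1 + (n - (k + 1)) by omega]
          exact component_mul _ (gen_mem_component _ _) hb)
        change b * (a * _) = ν (a * _) * b
        rw [← mul_assoc, h1, map_mul, hν, ← mul_assoc, h2, mul_assoc]
      exact hle ha

theorem IsVolume.isPsi_iff (ht : IsVolume q R n t) (hR : IsHecke q R) (hn : 0 < n)
    {ψ : V ≃ₗ[K] V} : IsPsi q R n ψ ↔ IsRot t ψ :=
  ⟨ht.isRot_of_isPsi hR.ne_zero hn, ht.isPsi_of_isRot hR hn⟩

/-- Uniqueness comes from the injectivity of f ↦ `lc f t`, which determines ψ*. -/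
theorem IsVolume.existsUnique_psi (ht : IsVolume q R n t) (hR : IsHecke q R) (hn : 0 < n) :
    ∃! ψ : V ≃ₗ[K] V, IsPsi q R n ψ := by
  obtain ⟨hinj, ψ, hψ⟩ := ht.exists_rot hR hn
  simp only [ht.isPsi_iff hR hn]
  refine ⟨ψ, hψ, fun χ hχ => ?_⟩
  have h1 : ∀ f : Module.Dual K V, χ.toLinearMap.dualMap f = ψ.toLinearMap.dualMap f := fun f =>
    hinj ((hχ f).symm.trans (hψ f))
  ext v
  rw [← sub_eq_zero, ← Module.forall_dual_apply_eq_zero_iff K]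
  intro f
  have := LinearMap.congr_fun (h1 f) v
  simpa [sub_eq_zero] using this

end QuadraticDual

/-! ### Transfer from the tensor algebra back to tensor powers, and traces. -/

section Bridge

variable {K V : Type*} [Field K] [AddCommGroup V] [Module K V]

local notation "𝕋" => TensorAlgebra K V
local notation "𝕚" => TensorAlgebra.ι K

theorem toT_tprod_succ {n : ℕ} (w : Fin (n + 1) → V) :
    toT (PiTensorProduct.tprod K w) = 𝕚 (w 0) * toT (PiTensorProduct.tprod K (Fin.tail w)) := by
  rw [← toT_consMul, consMul_tprod, Fin.cons_self_tail]

theorem toT_placeAt_zero {n : ℕ} (w : Fin (n + 2) → V) (z : V ⊗[K] V) :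
    toT (placeAt 0 1 (by simp) w z) =
      mulTwo K V z * toT (PiTensorProduct.tprod K (Fin.tail (Fin.tail w))) := by
  induction z using TensorProduct.induction_on with
  | zero => simp
  | add x y hx hy => rw [map_add, map_add, hx, hy, map_add, add_mul]
  | tmul a b =>
    rw [placeAt_tmul, toT_tprod_succ, toT_tprod_succ, mulTwo_tmul, mul_assoc]
    congr 2

theorem toT_placeAt_succ {n : ℕ} (i j : Fin n) (hij : i ≠ j) (w : Fin (n + 1) → V)
    (z : V ⊗[K] V) :
    toT (placeAt i.succ j.succ (by simpa using hij) w z) =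
      𝕚 (w 0) * toT (placeAt i j hij (Fin.tail w) z) := by
  induction z using TensorProduct.induction_on with
  | zero => simp
  | add x y hx hy => simp only [map_add, hx, hy, mul_add]
  | tmul a b =>
    rw [placeAt_tmul, toT_tprod_succ, placeAt_tmul, Fin.tail_update_succ, Fin.tail_update_succ]
    congr 2

variable [FiniteDimensional K V] (R : V ⊗[K] V →ₗ[K] V ⊗[K] V)

theorem toT_heckeT {n i : ℕ} (hi : i + 1 < n) (x : ⨂[K]^n V) :
    toT (heckeT R n i hi x) = tau R i (toT x) := by
  suffices h : (toT : ⨂[K]^n V →ₗ[K] 𝕋) ∘ₗ heckeT R n i hi = tau R i ∘ₗ toT from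
    LinearMap.congr_fun h x
  clear x
  ext w
  simp only [LinearMap.compMultilinearMap_apply, LinearMap.comp_apply, heckeT, actAt_tprod]
  induction i generalizing n with
  | zero =>
    obtain ⟨n, rfl⟩ : ∃ m, n = m + 2 := ⟨n - 2, by omega⟩
    rw [toT_tprod_succ, toT_tprod_succ, tau_zero_tmul]
    exact toT_placeAt_zero w _
  | succ i ih =>
    obtain ⟨n, rfl⟩ : ∃ m, n = m + 1 := ⟨n - 1, by omega⟩
    rw [toT_tprod_succ, tau_succ_cons, ← ih (by omega) (Fin.tail w)]
    exact toT_placeAt_succ ⟨i, by omega⟩ ⟨i + 1, by omega⟩ (by simp) w _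

variable {R} {q : K}

theorem toT_mem_ups_iff (hq : q ≠ 0) {n : ℕ} {x : ⨂[K]^n V} :
    toT x ∈ ups q R n ↔ x ∈ Upsilon q R n := by
  simp only [Upsilon, Submodule.mem_iInf, mem_ups, toT_mem_deg, true_and]
  refine forall₂_congr fun i hi => ?_
  rw [mem_img]
  constructor
  · rintro ⟨z, hz, h⟩
    obtain ⟨y, rfl⟩ := exists_toT_eq hz
    -- The scalar comes from 1 + g = (T - q)(-q⁻¹); the converse uses its inverse -q.
    refine ⟨(-q⁻¹) • y, toT_injective n ?_⟩
    rw [← h, LinearMap.sub_apply, map_sub, toT_heckeT, gen_apply]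
    simp [smul_smul, hq, add_comm]
  · rintro ⟨y, rfl⟩
    refine ⟨toT ((-q) • y), toT_mem_deg _, ?_⟩
    rw [LinearMap.sub_apply, map_sub, toT_heckeT, gen_apply]
    simp [smul_smul, hq]
    abel

theorem exists_toT_eq_of_mem_ups (hq : q ≠ 0) {n : ℕ} {x : 𝕋} (hx : x ∈ ups q R n) :
    ∃ y ∈ Upsilon q R n, toT y = x := by
  obtain ⟨y, rfl⟩ := exists_toT_eq (ups_le_deg n hx)
  exact ⟨y, (toT_mem_ups_iff hq).1 hx, rfl⟩

theorem isVolume_toT (hq : q ≠ 0) {n : ℕ} (hdim : Module.finrank K (Upsilon q R n) = 1)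
    (hvanish : Upsilon q R (n + 1) = ⊥) {t : ⨂[K]^n V} (ht : t ∈ Upsilon q R n) (ht0 : t ≠ 0) :
    IsVolume q R n (toT t) where
  ne_zero h := ht0 (toT_injective n (by rw [h, map_zero]))
  ups_eq := by
    apply le_antisymm
    · intro x hx
      obtain ⟨y, hy, rfl⟩ := exists_toT_eq_of_mem_ups hq hx
      obtain ⟨r, hr⟩ := (finrank_eq_one_iff_of_nonzero' (⟨t, ht⟩ : Upsilon q R n)
        (fun h => ht0 (congrArg Subtype.val h))).1 hdim ⟨y, hy⟩
      have hr' : r • t = y := congrArg Subtype.val hr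
      rw [← hr', map_smul]
      exact Submodule.smul_mem _ _ (Submodule.mem_span_singleton_self _)
    · rw [Submodule.span_singleton_le_iff_mem]
      exact (toT_mem_ups_iff hq).2 ht
  vanish := by
    rw [eq_bot_iff]
    intro x hx
    obtain ⟨y, hy, rfl⟩ := exists_toT_eq_of_mem_ups hq hx
    rw [hvanish, Submodule.mem_bot] at hy
    rw [hy, map_zero]
    exact Submodule.zero_mem _

theorem toT_list_prod {n : ℕ} (L : List (Fin n)) (x : ⨂[K]^(n + 1) V) :
    toT ((L.map fun i : Fin n => heckeT R (n + 1) i (Nat.succ_lt_succ i.isLt)).prod x) =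
      ((L.map Fin.val).map (tau R)).prod (toT x) := by
  induction L with
  | nil => simp
  | cons i L ih =>
    simp only [List.map_cons, List.prod_cons, Module.End.mul_apply, toT_heckeT, ih]

theorem prod_range_eq_moveLeft {E : Type*} [Ring E] (c : ℕ → E) (n : ℕ) :
    ((List.range n).map c).prod = moveLeft c n := by
  induction n with
  | zero => rfl
  | succ n ih => rw [List.range_succ, List.map_append, List.prod_append, ih, moveLeft]; simp

theorem prod_reverse_range_eq_moveRight {E : Type*} [Ring E] (c : ℕ → E) (n : ℕ) :
    ((List.range n).reverse.map c).prod = moveRight c 0 n := by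
  induction n with
  | zero => rfl
  | succ n ih =>
    rw [List.range_succ, List.reverse_append, List.map_append, List.prod_append, ih,
      moveRight_succ, zero_add]
    simp

theorem toT_heckeUp {n : ℕ} (x : ⨂[K]^(n + 1) V) :
    toT (heckeUp R n x) = moveLeft (tau R) n (toT x) := by
  rw [heckeUp, toT_list_prod, List.map_coe_finRange_eq_range, prod_range_eq_moveLeft]

theorem toT_heckeDown {n : ℕ} (x : ⨂[K]^(n + 1) V) :
    toT (heckeDown R n x) = moveRight (tau R) 0 n (toT x) := by
  rw [heckeDown, toT_list_prod, List.map_reverse, List.map_coe_finRange_eq_range,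
    prod_reverse_range_eq_moveRight]

theorem isTheta_iff {n : ℕ} {t : ⨂[K]^n V} {θ : V ≃ₗ[K] V} :
    IsTheta R t θ ↔ IsThetaT R n (toT t) θ := by
  refine forall_congr' fun v => ?_
  rw [← (toT_injective (n + 1)).eq_iff, toT_heckeDown, toT_consMul, toT_snocMul]

theorem isThetaBar_iff {n : ℕ} {t : ⨂[K]^n V} {θ : V ≃ₗ[K] V} :
    IsThetaBar R t θ ↔ IsThetaBarT R n (toT t) θ := by
  refine forall_congr' fun v => ?_
  rw [← (toT_injective (n + 1)).eq_iff, toT_heckeUp, toT_consMul, toT_snocMul]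

/-! ### Traces -/

theorem trace_eq_sum_of_rank_one {M : Type*} [AddCommGroup M] [Module K M] [FiniteDimensional K M]
    {J : Type} [Fintype J] {g : M →ₗ[K] M} {f : J → M →ₗ[K] K} {z : J → M}
    (h : ∀ x, g x = ∑ j, f j x • z j) : LinearMap.trace K M g = ∑ j, f j (z j) := by
  have hg : g = ∑ j, (f j).smulRight (z j) := by
    ext x
    simp [h]
  rw [hg, map_sum]
  exact Finset.sum_congr rfl fun j _ => LinearMap.trace_smulRight _ _

/-- The rank one expansion gives invariance of Υ^(k) and the trace at once, as the vectors lie in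
Υ^(k) and the forms on the tensor algebra restrict to it. -/
theorem trace_upsilon (hq : q ≠ 0) {k : ℕ} {χ : V →ₗ[K] V} {c : K}
    (h : ∃ (J : Type) (_ : Fintype J) (f : J → 𝕋 →ₗ[K] K) (z : J → 𝕋),
      (∀ j, z j ∈ ups q R k) ∧ (∀ u ∈ ups q R k, mapT χ u = ∑ j, f j u • z j) ∧
      ∑ j, f j (z j) = c) :
    ∃ hχ : ∀ a ∈ Upsilon q R k, tensorPow χ k a ∈ Upsilon q R k,
      LinearMap.trace K (Upsilon q R k) ((tensorPow χ k).restrict hχ) = c := by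
  obtain ⟨J, _, f, z, hz, h1, rfl⟩ := h
  choose y hy hyz using fun j => exists_toT_eq_of_mem_ups hq (hz j)
  have h2 : ∀ a ∈ Upsilon q R k, tensorPow χ k a = ∑ j, f j (toT a) • y j := fun a ha => by
    apply toT_injective k
    rw [toT_tensorPow, h1 _ ((toT_mem_ups_iff hq).2 ha)]
    simp [hyz]
  have hχ : ∀ a ∈ Upsilon q R k, tensorPow χ k a ∈ Upsilon q R k := fun a ha => by
    rw [h2 a ha]
    exact Submodule.sum_mem _ fun j _ => Submodule.smul_mem _ _ (hy j)
  refine ⟨hχ, ?_⟩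
  rw [trace_eq_sum_of_rank_one (f := fun j => f j ∘ₗ toT ∘ₗ (Upsilon q R k).subtype)
    (z := fun j => ⟨y j, hy j⟩) fun x => Subtype.ext (by
      simp [h2 x.1 x.2])]
  simp [hyz]

theorem trace_of_rank_one_ups_one {χ : V →ₗ[K] V} {c : K}
    (h : ∃ (J : Type) (_ : Fintype J) (f : J → 𝕋 →ₗ[K] K) (z : J → 𝕋),
      (∀ j, z j ∈ ups q R 1) ∧ (∀ u ∈ ups q R 1, mapT χ u = ∑ j, f j u • z j) ∧
      ∑ j, f j (z j) = c) :
    LinearMap.trace K V χ = c := by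
  obtain ⟨J, _, f, z, hz, h1, rfl⟩ := h
  choose w hw using fun j => mem_deg_one.1 (ups_le_deg 1 (hz j))
  rw [trace_eq_sum_of_rank_one (f := fun j => f j ∘ₗ TensorAlgebra.ι K) (z := w) fun v => ?_]
  · simp [hw]
  · have := h1 (𝕚 v) (mem_ups.2 ⟨ι_mem_deg v, fun i hi => absurd hi (by omega)⟩)
    apply (TensorAlgebra.ι_inj K _ _).1
    rw [← mapT_ι, this]
    simp [hw]

end Bridge

end
end HeckeSym

/-! ### Proof of the theorem. -/

open HeckeSym in
theorem proposition3p9 {K V : Type*} [Field K] [AddCommGroup V] [Module K V]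
    [FiniteDimensional K V] (q : K) (R : V ⊗[K] V →ₗ[K] V ⊗[K] V)
    (hR : HeckeSym.IsHeckeSymmetry q R) (n : ℕ) (hn : 0 < n)
    (hdim : Module.finrank K (HeckeSym.Upsilon q R n) = 1)
    (hvanish : HeckeSym.Upsilon q R (n + 1) = ⊥)
    (t : ⨂[K]^n V) (ht : t ∈ HeckeSym.Upsilon q R n) (ht0 : t ≠ 0) :
    (∃! θ : V ≃ₗ[K] V, HeckeSym.IsTheta R t θ) ∧
    (∃! θ' : V ≃ₗ[K] V, HeckeSym.IsThetaBar R t θ') ∧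
    (∃! ψ : V ≃ₗ[K] V, HeckeSym.IsPsi q R n ψ) ∧
    ∀ θ θ' ψ : V ≃ₗ[K] V, HeckeSym.IsTheta R t θ → HeckeSym.IsThetaBar R t θ' →
      HeckeSym.IsPsi q R n ψ →
      (∀ k : ℕ, 1 ≤ k → k ≤ n →
        (∃ hξ : ∀ a ∈ HeckeSym.Upsilon q R k,
            HeckeSym.tensorPow (ψ.symm.toLinearMap ∘ₗ θ.toLinearMap) k a ∈
              HeckeSym.Upsilon q R k,
          LinearMap.trace K (HeckeSym.Upsilon q R k)
              ((HeckeSym.tensorPow (ψ.symm.toLinearMap ∘ₗ θ.toLinearMap) k).restrict hξ) =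
            (-1) ^ (k * n - k) * q ^ (k * (k + 1) / 2) * HeckeSym.qBinom q n k) ∧
        (∃ hη : ∀ a ∈ HeckeSym.Upsilon q R k,
            HeckeSym.tensorPow (ψ.toLinearMap ∘ₗ θ'.toLinearMap) k a ∈
              HeckeSym.Upsilon q R k,
          LinearMap.trace K (HeckeSym.Upsilon q R k)
              ((HeckeSym.tensorPow (ψ.toLinearMap ∘ₗ θ'.toLinearMap) k).restrict hη) =
            (-1) ^ (k * n - k) * q ^ (k * (k + 1) / 2) * HeckeSym.qBinom q n k)) ∧
      LinearMap.trace K V (ψ.symm.toLinearMap ∘ₗ θ.toLinearMap) =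
        (-1) ^ (n - 1) * q * HeckeSym.qInt q n ∧
      LinearMap.trace K V (ψ.toLinearMap ∘ₗ θ'.toLinearMap) =
        (-1) ^ (n - 1) * q * HeckeSym.qInt q n := by
  have hH := hR.isHecke
  have hq := hR.ne_zero
  have hV := isVolume_toT hq hdim hvanish ht ht0
  -- The traces on V are the case k = 1, since Υ^(1) = V.
  have hone : (-1 : K) ^ (1 * n - 1) * q ^ (1 * (1 + 1) / 2) * qBinom q n 1 =
      (-1) ^ (n - 1) * q * qInt q n := by
    rw [qBinom_one_right, one_mul]
    norm_num
  refine ⟨?_, ?_, hV.existsUnique_psi hH hn, fun θ θ' ψ hθ hθ' hψ => ?_⟩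
  · simp only [isTheta_iff]
    exact hV.existsUnique_thetaT hH
  · simp only [isThetaBar_iff]
    exact hV.existsUnique_thetaBarT hH
  · rw [isTheta_iff] at hθ
    rw [isThetaBar_iff] at hθ'
    rw [hV.isPsi_iff hH hn] at hψ
    refine ⟨fun k _ hk => ⟨trace_upsilon hq (hV.exists_rank_one_sum_theta hH hn hθ hψ hk),
      trace_upsilon hq (hV.exists_rank_one_sum_thetaBar hH hn hθ' hψ hk)⟩, ?_, ?_⟩
    · rw [← hone]
      exact trace_of_rank_one_ups_one (hV.exists_rank_one_sum_theta hH hn hθ hψ hn)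
    · rw [← hone]
      exact trace_of_rank_one_ups_one (hV.exists_rank_one_sum_thetaBar hH hn hθ' hψ hn)
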